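/- Fix $m\ge 1$, let $\mu_m\subset\mathbb C^*$ be the group of $m$-th roots of unity, and let $\mathfrak S_n(\mu_m)=\mu_m^n\rtimes\mathfrak S_n$, embedded in $\mathrm{GL}_n(\mathbb C)$ as the group of monomial matrices whose nonzero entries lie in $\mu_m$ ($n\ge 0$). Notation. For a partition $\lambda$ let $m_r(\lambda)$ be the number of parts equal to $r$, $\ell(\lambda)$ the number of parts, and $z_\lambda=\prod_{r\ge1}m_r(\lambda)!\,r^{m_r(\lambda)}$. Let $\Phi$ be the set of functions $\rho$ from $\mu_m$ to partitions, and put $|\rho|=\sum_\zeta|\rho(\zeta)|$ and $Z_\rho=\prod_\zeta z_{\rho(\zeta)}m^{\ell(\rho(\zeta))}$. For $\rho\in\Phi$ with $|\rho|=n$ let $C_\rho\subset\mathfrak S_n(\mu_m)$ be the class of those $(a_1,\dots,a_n;\sigma)$ for which, for all $\zeta\in\mu_m$ and $l\ge1$, exactly $m_l(\rho(\zeta))$ cycles $c$ of $\sigma$ of length $l$ have cycle product $\prod_{i\in c}a_i=\zeta$. Let $\Lambda$ be the ring of symmetric functions over $\mathbb C$, with power sums $p_\lambda$, complete functions $h_n$,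 Schur functions $s_\lambda$, and the bilinear Hall pairing $\langle p_\lambda,p_\mu\rangle=z_\lambda\delta_{\lambda\mu}$. This pairing is extended to $\langle K,f\rangle_Y$ for $f\in\Lambda$ and a formal series $K$ that is symmetric in the variables $Y=(y_1,y_2,\dots)$, degree by degree in $Y$ and coefficientwise in the other variables. For a formal series $A=\sum_\alpha c_\alpha t^\alpha$ let $f\mapsto f(A)$ be the $\mathbb C$-algebra homomorphism on $\Lambda$ with $p_n\mapsto p_n(A)=\sum_\alpha c_\alpha t^{n\alpha}$ for $n\ge 1$, and let $\Omega(A)=\sum_{n\ge0}h_n(A)$; put $\Omega(Y;\zeta)=\prod_{i\ge1}(1-\zeta y_i)^{-1}$. For $\zeta\in\mu_m$ let $X_\zeta=x_{\zeta,1}+x_{\zeta,2}+\cdots$ be a set of variables, let $\mathfrak X=(X_\zeta)_{\zeta\in\mu_m}$, and let $P_\rho(\mathfrak X)=\prod_\zeta p_{\rho(\zeta)}(X_\zeta)$. Proposition. Every class $C_\rho$ is nonempty, and the multiset $\Xi_\rho$ of eigenvalues (roots of the characteristic polynomial) of $\gamma\in C_\rho$ does not depend on the choice of $\gamma$. For every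 partition $\lambda$ the formal series $$F_\lambda(\mathfrak X)=\sum_{\rho\in\Phi}\frac{s_\lambda(\Xi_\rho)}{Z_\rho}P_\rho(\mathfrak X)\qquad\text{and}\qquad \Omega\Big(\frac1m\sum_{\zeta\in\mu_m}X_\zeta\,\Omega(Y;\zeta)\Big)$$ converge, the second is symmetric in $Y$, and $$F_\lambda(\mathfrak X)=\Big\langle \Omega\Big(\frac1m\sum_{\zeta\in\mu_m}X_\zeta\,\Omega(Y;\zeta)\Big),\ s_\lambda(Y)\Big\rangle_Y .$$ Moreover, for every $n\ge\ell(\lambda)$ the homogeneous component of degree $n$ of $F_\lambda$ is the Frobenius characteristic $\sum_{|\rho|=n}\frac{\chi(C_\rho)}{Z_\rho}P_\rho(\mathfrak X)$ of $\mathrm{Res}^{\mathrm{GL}_n(\mathbb C)}_{\mathfrak S_n(\mu_m)}V^\lambda$, where $\chi$ is the character of this restriction and $V^\lambda$ is the irreducible representation of $\mathrm{GL}_n(\mathbb C)$ with highest weight $\lambda$. -/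

import Mathlib

open scoped MvPowerSeries.WithPiTopology

noncomputable section

namespace WreathSym

/-- The set of all integer partitions. -/
abbrev Par : Type := Σ n : ℕ, n.Partition

namespace Par

/-- The parts `λ₁, λ₂, …` as a multiset of positive integers. -/
def parts (lam : Par) : Multiset ℕ := lam.2.parts

/-- `|λ|`. -/
def size (lam : Par) : ℕ := lam.1

/-- `ℓ(λ)`. -/
def length (lam : Par) : ℕ := lam.parts.card

/-- `m_r(λ)`. -/
def mult (lam : Par) (r : ℕ) : ℕ := lam.parts.count r

/-- `z_λ = ∏_r m_r(λ)! r^{m_r(λ)}`. -/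
def z (lam : Par) : ℕ :=
  ∏ r ∈ lam.parts.toFinset, (lam.mult r).factorial * r ^ lam.mult r

/-- The Young diagram whose row lengths are the parts of `λ` in decreasing order. -/
def diagram (lam : Par) : YoungDiagram :=
  YoungDiagram.ofRowLens (lam.parts.sort (· ≥ ·)) (lam.parts.pairwise_sort (· ≥ ·)).sortedGE

/-- The partition with a given multiset of positive parts. -/
def mk' (s : Multiset ℕ) (hs : ∀ i ∈ s, 0 < i) : Par := ⟨s.sum, ⟨s, fun {i} h => hs i h, rfl⟩⟩

theorem parts_mk' (s : Multiset ℕ) (hs : ∀ i ∈ s, 0 < i) : (mk' s hs).parts = s := rfl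

theorem pos (lam : Par) {i : ℕ} (h : i ∈ lam.parts) : 0 < i := lam.2.parts_pos h

theorem parts_injective : Function.Injective parts := by
  rintro ⟨n, p⟩ ⟨k, q⟩ h
  have h' : p.parts = q.parts := h
  have : n = k := by rw [← p.parts_sum, ← q.parts_sum, h']
  subst this
  rw [Nat.Partition.ext h']

end Par

/-! ### The ring of symmetric functions -/

/-- The formal power series `∑_a c_a x^a`. -/
def series {σ : Type*} (c : (σ →₀ ℕ) → ℂ) : MvPowerSeries σ ℂ := c

theorem coeff_series {σ : Type*} (c : (σ →₀ ℕ) → ℂ) (a : σ →₀ ℕ) :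
    MvPowerSeries.coeff a (series c) = c a := rfl

/-- A power series in `x₀, x₁, …` is symmetric if it is invariant under all permutations of the
variables. -/
def IsSymm (f : MvPowerSeries ℕ ℂ) : Prop :=
  ∀ e : Equiv.Perm ℕ, MvPowerSeries.rename e f = f

/-- A power series has bounded degree. -/
def IsBounded (f : MvPowerSeries ℕ ℂ) : Prop :=
  ∃ d : ℕ, ∀ a : ℕ →₀ ℕ, d < a.degree → MvPowerSeries.coeff a f = 0

/-- The ring `Λ` of symmetric functions over `ℂ`: symmetric power series of bounded degree. -/
def SymmFun : Subalgebra ℂ (MvPowerSeries ℕ ℂ) where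
  carrier := {f | IsSymm f ∧ IsBounded f}
  mul_mem' := by
    rintro f g ⟨hf, d, hd⟩ ⟨hg, k, hk⟩
    refine ⟨fun e => by rw [map_mul, hf e, hg e], d + k, fun a ha => ?_⟩
    rw [MvPowerSeries.coeff_mul]
    refine Finset.sum_eq_zero fun p hp => ?_
    have h := congrArg Finsupp.degree (Finset.HasAntidiagonal.mem_antidiagonal.mp hp)
    rw [map_add] at h
    rcases lt_or_ge d p.1.degree with h1 | h1
    · rw [hd _ h1, zero_mul]
    · rw [hk _ (by omega), mul_zero]
  add_mem' := by
    rintro f g ⟨hf, d, hd⟩ ⟨hg, k, hk⟩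
    refine ⟨fun e => by rw [map_add, hf e, hg e], d + k, fun a ha => ?_⟩
    rw [map_add, hd a (by omega), hk a (by omega), add_zero]
  algebraMap_mem' := by
    intro c
    refine ⟨fun e => AlgHom.commutes _ c, 0, fun a ha => ?_⟩
    have : a ≠ 0 := by rintro rfl; simp at ha
    classical
    rw [MvPowerSeries.algebraMap_apply, MvPowerSeries.coeff_C, if_neg this]

theorem isSymm_iff (f : MvPowerSeries ℕ ℂ) :
    IsSymm f ↔ ∀ (e : Equiv.Perm ℕ) (a : ℕ →₀ ℕ),
      MvPowerSeries.coeff (a.mapDomain e) f = MvPowerSeries.coeff a f := by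
  have key : ∀ (e : Equiv.Perm ℕ) (a : ℕ →₀ ℕ) (g : MvPowerSeries ℕ ℂ),
      MvPowerSeries.coeff (a.mapDomain e) (MvPowerSeries.rename e g) =
        MvPowerSeries.coeff a g := by
    intro e a g
    have := MvPowerSeries.coeff_embDomain_rename e.toEmbedding g a
    rwa [Finsupp.embDomain_eq_mapDomain] at this
  constructor
  · intro h e a
    conv_lhs => rw [← h e]
    exact key e a f
  · intro h e
    ext b
    obtain ⟨a, rfl⟩ : ∃ a : ℕ →₀ ℕ, a.mapDomain e = b := by
      refine ⟨b.mapDomain e.symm, ?_⟩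
      rw [← Finsupp.mapDomain_comp]
      simp
    rw [key, h]

/-- The power sum `p_r = ∑_i (x_i)^r` of a family of elements. -/
def powerSum {σ ι : Type*} (x : ι → MvPowerSeries σ ℂ) (r : ℕ) : MvPowerSeries σ ℂ :=
  ∑' i, x i ^ r

open Classical in
theorem coeff_powerSum_X {r : ℕ} (hr : 0 < r) (a : ℕ →₀ ℕ) :
    MvPowerSeries.coeff a (powerSum (fun i : ℕ => MvPowerSeries.X (R := ℂ) i) r) =
      if ∃ i, a = Finsupp.single i r then 1 else 0 := by
  have hs : HasSum (fun i : ℕ => (MvPowerSeries.X i : MvPowerSeries ℕ ℂ) ^ r)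
      (series fun a => if ∃ i, a = Finsupp.single i r then 1 else 0) := by
    rw [MvPowerSeries.WithPiTopology.hasSum_iff_hasSum_coeff]
    intro d
    simp only [MvPowerSeries.coeff_X_pow, coeff_series]
    by_cases h : ∃ i, d = Finsupp.single i r
    · obtain ⟨i, rfl⟩ := h
      rw [if_pos ⟨i, rfl⟩]
      have he : (fun j => if Finsupp.single i r = Finsupp.single j r then (1 : ℂ) else 0) =
          fun j => if j = i then 1 else 0 := by
        funext j
        simp only [Finsupp.single_left_inj hr.ne', eq_comm]
      rw [he]
      exact hasSum_ite_eq i (1 : ℂ)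
    · rw [if_neg h]
      push Not at h
      simp only [h, if_false]
      exact hasSum_zero
  rw [powerSum, hs.tsum_eq, coeff_series]

theorem powerSum_X_mem {r : ℕ} (hr : 0 < r) :
    powerSum (fun i : ℕ => MvPowerSeries.X (R := ℂ) i) r ∈ SymmFun := by
  classical
  refine ⟨(isSymm_iff _).2 fun e a => ?_, r, fun a ha => ?_⟩
  · rw [coeff_powerSum_X hr, coeff_powerSum_X hr]
    congr 1
    refine propext ⟨?_, ?_⟩
    · rintro ⟨i, hi⟩
      refine ⟨e.symm i, Finsupp.mapDomain_injective e.injective ?_⟩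
      simp [hi]
    · rintro ⟨i, rfl⟩
      exact ⟨e i, by simp⟩
  · rw [coeff_powerSum_X hr, if_neg]
    rintro ⟨i, rfl⟩
    simp at ha

/-- `p_λ(x) = ∏_i p_{λ_i}(x)`. -/
def powerSumPar {σ ι : Type*} (x : ι → MvPowerSeries σ ℂ) (lam : Par) : MvPowerSeries σ ℂ :=
  (lam.parts.map (powerSum x)).prod

theorem powerSumPar_X_mem (lam : Par) :
    powerSumPar (fun i : ℕ => MvPowerSeries.X (R := ℂ) i) lam ∈ SymmFun := by
  refine Subalgebra.multiset_prod_mem _ fun f hf => ?_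
  obtain ⟨r, hr, rfl⟩ := Multiset.mem_map.1 hf
  exact powerSum_X_mem (lam.pos hr)

/-- The power sum symmetric function `p_λ ∈ Λ`. -/
def pSym (lam : Par) : SymmFun := ⟨_, powerSumPar_X_mem lam⟩

/-- The complete homogeneous symmetric function `h_n ∈ Λ`, the sum of all monomials of
degree `n`. -/
def hSym (n : ℕ) : SymmFun :=
  ⟨series fun a => if a.degree = n then 1 else 0, (isSymm_iff _).2 fun e a => by
    rw [coeff_series, coeff_series, Finsupp.degree_mapDomain], n, fun a ha => by
    rw [coeff_series, if_neg (by omega)]⟩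

/-! ### The power sums form a basis -/

/-- The multiset of nonzero exponents of a monomial. -/
def shape (a : ℕ →₀ ℕ) : Multiset ℕ := a.support.val.map a

theorem shape_pos (a : ℕ →₀ ℕ) : ∀ i ∈ shape a, 0 < i := by
  intro i hi
  obtain ⟨j, hj, rfl⟩ := Multiset.mem_map.1 hi
  exact Nat.pos_of_ne_zero (Finsupp.mem_support_iff.1 hj)

theorem card_shape (a : ℕ →₀ ℕ) : (shape a).card = a.support.card := by
  simp [shape]

theorem sum_shape (a : ℕ →₀ ℕ) : (shape a).sum = a.degree := rfl

theorem shape_single_add {i r : ℕ} (hr : 0 < r) {a : ℕ →₀ ℕ} (hi : i ∉ a.support) :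
    shape (Finsupp.single i r + a) = r ::ₘ shape a := by
  have hd : Disjoint (Finsupp.single i r).support a.support := by
    rw [Finsupp.support_single _ hr.ne']
    simpa using hi
  have hs : (Finsupp.single i r + a).support = insert i a.support := by
    rw [Finsupp.support_add_eq hd, Finsupp.support_single _ hr.ne', Finset.insert_eq]
  rw [shape, hs, Finset.insert_val_of_notMem hi, Multiset.map_cons]
  congr 1
  · simp [Finsupp.notMem_support_iff.1 hi]
  · refine Multiset.map_congr rfl fun j hj => ?_
    have : i ≠ j := by rintro rfl; exact hi hj
    simp [this]

theorem exists_shape (s : Multiset ℕ) (hs : ∀ i ∈ s, 0 < i) : ∃ a, shape a = s := by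
  induction s using Multiset.induction with
  | empty => exact ⟨0, by simp [shape]⟩
  | cons r s ih =>
    obtain ⟨a, ha⟩ := ih fun i hi => hs i (Multiset.mem_cons_of_mem hi)
    obtain ⟨i, hi⟩ := Infinite.exists_notMem_finset a.support
    exact ⟨Finsupp.single i r + a, by
      rw [shape_single_add (hs r (Multiset.mem_cons_self r s)) hi, ha]⟩

theorem exists_perm_of_shape_eq {a b : ℕ →₀ ℕ} (hab : shape a = shape b) :
    ∃ e : Equiv.Perm ℕ, a.mapDomain e = b := by
  obtain ⟨f, hf⟩ : ∃ f : a.support ≃ b.support, ∀ x, b (f x) = a x := by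
    have hc : ∀ r, Fintype.card {x : a.support // a x = r} =
        Fintype.card {x : b.support // b x = r} := by
      intro r
      have := congrArg (Multiset.count r) hab
      rw [shape, shape, Multiset.count_map, Multiset.count_map] at this
      have h1 : ∀ c : ℕ →₀ ℕ, Fintype.card {x : c.support // c x = r} =
          (c.support.val.filter fun x => r = c x).card := by
        intro c
        rw [Fintype.card_subtype]
        rw [← Finset.card_map (Function.Embedding.subtype _)]
        change _ = (c.support.filter fun x => r = c x).card
        congr 1
        ext x
        simp [eq_comm, and_comm]

      rw [h1, h1, this]
    have g := fun r => Fintype.card_eq.1 (hc r)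
    replace g := fun r => Classical.choice (g r)
    refine ⟨(Equiv.sigmaFiberEquiv fun x : a.support => a x).symm.trans
      ((Equiv.sigmaCongrRight fun r => (g r)).trans
        (Equiv.sigmaFiberEquiv fun x : b.support => b x)), fun x => ?_⟩
    simp [Equiv.sigmaFiberEquiv]
    exact (g (a x) ⟨x, rfl⟩).2
  obtain ⟨e, he⟩ := Cardinal.extend_function_of_lt (s := (a.support : Set ℕ))
    (f.toEmbedding.trans (Function.Embedding.subtype _))
    (lt_of_lt_of_le (Cardinal.lt_aleph0_of_finite _) (Cardinal.aleph0_le_mk ℕ)) ⟨Equiv.refl ℕ⟩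
  refine ⟨e, Finsupp.ext fun y => ?_⟩
  obtain ⟨x, rfl⟩ := e.surjective y
  rw [Finsupp.mapDomain_apply e.injective]
  by_cases hx : x ∈ a.support
  · have := he ⟨x, hx⟩
    rw [this]
    exact (hf ⟨x, hx⟩).symm
  · rw [Finsupp.notMem_support_iff.1 hx]
    by_contra hne
    have hy : e x ∈ b.support := Finsupp.mem_support_iff.2 fun h => hne h.symm
    have h2 := he (f.symm ⟨e x, hy⟩)
    have h3 : e (f.symm ⟨e x, hy⟩ : a.support) = e x := by rw [h2]; simp
    exact hx (e.injective h3 ▸ (f.symm ⟨e x, hy⟩).2)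

theorem coeff_eq_of_shape_eq {f : MvPowerSeries ℕ ℂ} (hf : IsSymm f) {a b : ℕ →₀ ℕ}
    (hab : shape a = shape b) : MvPowerSeries.coeff a f = MvPowerSeries.coeff b f := by
  obtain ⟨e, rfl⟩ := exists_perm_of_shape_eq hab
  exact ((isSymm_iff f).1 hf e a).symm

/-- `a` is the exponent of a monomial occurring in the product of the power sums `p_r`, `r ∈ s`. -/
def Rep (s : Multiset ℕ) (a : ℕ →₀ ℕ) : Prop :=
  ∃ t : Multiset (ℕ × ℕ), t.map Prod.snd = s ∧
    (t.map fun q => Finsupp.single q.1 q.2).sum = a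

theorem rep_shape (a : ℕ →₀ ℕ) : Rep (shape a) a := by
  refine ⟨a.support.val.map fun i => (i, a i), ?_, ?_⟩
  · simp [shape]
  · rw [Multiset.map_map]
    exact Finsupp.sum_single a

theorem card_support_of_rep (t : Multiset (ℕ × ℕ)) (ht : ∀ q ∈ t, 0 < q.2) :
    (t.map fun q => Finsupp.single q.1 q.2).sum.support.card ≤ t.card ∧
    ((t.map fun q => Finsupp.single q.1 q.2).sum.support.card = t.card →
      shape (t.map fun q => Finsupp.single q.1 q.2).sum = t.map Prod.snd) := by
  induction t using Multiset.induction with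
  | empty => simp [shape]
  | cons q t ih =>
    obtain ⟨i1, i2⟩ := ih fun q hq => ht q (Multiset.mem_cons_of_mem hq)
    have hq := ht q (Multiset.mem_cons_self q t)
    rw [Multiset.map_cons, Multiset.sum_cons, Multiset.card_cons, Multiset.map_cons]
    set a := (t.map fun q => Finsupp.single q.1 q.2).sum
    by_cases hm : q.1 ∈ a.support
    · have : (Finsupp.single q.1 q.2 + a).support ⊆ a.support := by
        refine Finsupp.support_add.trans (Finset.union_subset ?_ subset_rfl)
        exact Finsupp.support_single_subset.trans (by simpa using hm)
      have := Finset.card_le_card this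
      exact ⟨by omega, fun h => by omega⟩
    · have hsh := shape_single_add hq hm
      have hc := congrArg Multiset.card hsh
      rw [card_shape, Multiset.card_cons, card_shape] at hc
      exact ⟨by omega, fun h => by rw [hsh, i2 (by omega)]⟩

theorem exists_coeff_prod (s : Multiset ℕ) (hs : ∀ i ∈ s, 0 < i) :
    ∃ c : (ℕ →₀ ℕ) → ℕ, ∀ a, MvPowerSeries.coeff a
      (s.map (powerSum fun i : ℕ => MvPowerSeries.X (R := ℂ) i)).prod = c a ∧
      (c a ≠ 0 ↔ Rep s a) := by
  classical
  induction s using Multiset.induction with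
  | empty =>
    refine ⟨fun a => if a = 0 then 1 else 0, fun a => ⟨?_, ?_⟩⟩
    · simp [MvPowerSeries.coeff_one]
    · by_cases ha : a = 0
      · simp [ha]; exact ⟨0, by simp⟩
      · simp only [ha, if_false]
        refine ⟨fun h => absurd rfl h, ?_⟩
        rintro ⟨t, ht, h2⟩
        rw [Multiset.map_eq_zero] at ht
        subst ht
        exact absurd h2.symm ha
  | cons r s ih =>
    obtain ⟨c, hc⟩ := ih fun i hi => hs i (Multiset.mem_cons_of_mem hi)
    have hr := hs r (Multiset.mem_cons_self r s)
    refine ⟨fun a => ∑ x ∈ Finset.HasAntidiagonal.antidiagonal a,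
      (if ∃ i, x.1 = Finsupp.single i r then 1 else 0) * c x.2, fun a => ⟨?_, ?_⟩⟩
    · rw [Multiset.map_cons, Multiset.prod_cons, MvPowerSeries.coeff_mul]
      push_cast
      refine Finset.sum_congr rfl fun x _ => ?_
      rw [coeff_powerSum_X hr, (hc x.2).1]
    · rw [Ne, Finset.sum_eq_zero_iff, not_forall]
      simp only [Classical.not_imp]
      constructor
      · rintro ⟨x, hx, h2⟩
        have h3 := right_ne_zero_of_mul h2
        obtain ⟨i, hi⟩ : ∃ i, x.1 = Finsupp.single i r := by
          by_contra hne
          simp [hne] at h2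
        obtain ⟨t, ht, hta⟩ := ((hc x.2).2).1 h3
        refine ⟨(i, r) ::ₘ t, by simp [ht], ?_⟩
        rw [Multiset.map_cons, Multiset.sum_cons, hta, ← hi]
        exact Finset.HasAntidiagonal.mem_antidiagonal.1 hx
      · rintro ⟨t, ht, hta⟩
        obtain ⟨q, hq, hqr⟩ : ∃ q ∈ t, q.2 = r := by
          have : r ∈ t.map Prod.snd := ht ▸ Multiset.mem_cons_self r s
          simpa using this
        obtain ⟨t', rfl⟩ := Multiset.exists_cons_of_mem hq
        rw [Multiset.map_cons, hqr, Multiset.cons_inj_right] at ht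
        rw [Multiset.map_cons, Multiset.sum_cons, hqr] at hta
        refine ⟨(Finsupp.single q.1 r, (t'.map fun q => Finsupp.single q.1 q.2).sum),
          Finset.HasAntidiagonal.mem_antidiagonal.2 hta, ?_⟩
        rw [if_pos ⟨q.1, rfl⟩, one_mul]
        exact ((hc _).2).2 ⟨t', ht, rfl⟩

theorem coeff_p_shape_ne_zero (lam : Par) {a : ℕ →₀ ℕ} (ha : shape a = lam.parts) :
    MvPowerSeries.coeff a (pSym lam : MvPowerSeries ℕ ℂ) ≠ 0 := by
  obtain ⟨c, hc⟩ := exists_coeff_prod lam.parts fun i hi => lam.pos hi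
  change MvPowerSeries.coeff a (lam.parts.map (powerSum _)).prod ≠ 0
  rw [(hc a).1, Nat.cast_ne_zero, (hc a).2, ← ha]
  exact rep_shape a

theorem coeff_p_ne_zero (lam : Par) {a : ℕ →₀ ℕ}
    (ha : MvPowerSeries.coeff a (pSym lam : MvPowerSeries ℕ ℂ) ≠ 0) :
    a.degree = lam.size ∧ a.support.card ≤ lam.length ∧
      (a.support.card = lam.length → shape a = lam.parts) := by
  obtain ⟨c, hc⟩ := exists_coeff_prod lam.parts fun i hi => lam.pos hi
  change MvPowerSeries.coeff a (lam.parts.map (powerSum _)).prod ≠ 0 at ha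
  rw [(hc a).1, Nat.cast_ne_zero, (hc a).2] at ha
  obtain ⟨t, ht, rfl⟩ := ha
  have hpos : ∀ q ∈ t, 0 < q.2 := fun q hq =>
    lam.pos (ht ▸ Multiset.mem_map_of_mem Prod.snd hq)
  have h := card_support_of_rep t hpos
  have hl : lam.length = t.card := by rw [Par.length, ← ht, Multiset.card_map]
  refine ⟨?_, ?_⟩
  · rw [Par.size, ← lam.2.parts_sum, map_multiset_sum, Multiset.map_map]
    change _ = lam.parts.sum
    rw [← ht]
    simp
  · rw [hl, ← ht]
    exact h

theorem linearIndependent_p : LinearIndependent ℂ pSym := by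
  rw [linearIndependent_iff]
  intro l hl
  by_contra hne
  obtain ⟨lam, hlam, hmax⟩ := Finset.exists_max_image l.support Par.length
    (Finsupp.support_nonempty_iff.2 hne)
  obtain ⟨a, ha⟩ := exists_shape lam.parts fun i hi => lam.pos hi
  have hcard : a.support.card = lam.length := by rw [← card_shape, ha]; rfl
  have h0 := congrArg (fun f : SymmFun => MvPowerSeries.coeff a (f : MvPowerSeries ℕ ℂ)) hl
  simp only [Finsupp.linearCombination_apply, Finsupp.sum, AddSubmonoidClass.coe_finsetSum,
    Subalgebra.coe_smul, map_sum, map_smul, ZeroMemClass.coe_zero, map_zero] at h0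
  rw [Finset.sum_eq_single lam] at h0
  · exact smul_ne_zero (Finsupp.mem_support_iff.1 hlam) (coeff_p_shape_ne_zero lam ha) h0
  · intro mu hmu hml
    by_contra hc
    obtain ⟨-, h1, h2⟩ := coeff_p_ne_zero mu (right_ne_zero_of_smul hc)
    have := hmax mu hmu
    exact hml (Par.parts_injective (by rw [← ha, h2 (by omega)]))
  · intro h; exact absurd hlam h

theorem mem_span_p (d L : ℕ) : ∀ f : SymmFun,
    (∀ a : ℕ →₀ ℕ, d < a.degree → MvPowerSeries.coeff a (f : MvPowerSeries ℕ ℂ) = 0) →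
    (∀ a : ℕ →₀ ℕ, MvPowerSeries.coeff a (f : MvPowerSeries ℕ ℂ) ≠ 0 → a.support.card < L) →
    f ∈ Submodule.span ℂ (Set.range pSym) := by
  classical
  induction L with
  | zero =>
    intro f _ hf
    have : f = 0 := by
      ext a
      by_contra h
      exact absurd (hf a h) (by omega)
    rw [this]
    exact Submodule.zero_mem _
  | succ L ih =>
    intro f hd hf
    choose mon hmon using fun lam : Par => exists_shape lam.parts fun i hi => lam.pos hi
    let S : Finset Par := ((Finset.range (d + 1)).sigma fun n =>
      (Finset.univ : Finset n.Partition)).filter fun lam => lam.length = L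
    let g : SymmFun := ∑ lam ∈ S, (MvPowerSeries.coeff (mon lam) (f : MvPowerSeries ℕ ℂ) /
      MvPowerSeries.coeff (mon lam) (pSym lam : MvPowerSeries ℕ ℂ)) • pSym lam
    have hS : ∀ lam : Par, lam ∈ S ↔ lam.size ≤ d ∧ lam.length = L := by
      intro lam
      simp [S, Par.size]
    have hg : g ∈ Submodule.span ℂ (Set.range pSym) :=
      Submodule.sum_mem _ fun lam _ =>
        Submodule.smul_mem _ _ (Submodule.subset_span ⟨lam, rfl⟩)
    have hgc : ∀ a : ℕ →₀ ℕ, MvPowerSeries.coeff a (g : MvPowerSeries ℕ ℂ) =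
        ∑ lam ∈ S, (MvPowerSeries.coeff (mon lam) (f : MvPowerSeries ℕ ℂ) /
          MvPowerSeries.coeff (mon lam) (pSym lam : MvPowerSeries ℕ ℂ)) *
          MvPowerSeries.coeff a (pSym lam : MvPowerSeries ℕ ℂ) := by
      intro a
      simp only [g, AddSubmonoidClass.coe_finsetSum, Subalgebra.coe_smul, map_sum, map_smul,
        smul_eq_mul]
    have hterm : ∀ a : ℕ →₀ ℕ, L ≤ a.support.card → ∀ lam ∈ S, lam.parts ≠ shape a →
        MvPowerSeries.coeff a (pSym lam : MvPowerSeries ℕ ℂ) = 0 := by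
      intro a ha lam hlam hne
      by_contra hc
      obtain ⟨-, h1, h2⟩ := coeff_p_ne_zero lam hc
      have := ((hS lam).1 hlam).2
      exact hne (h2 (by omega)).symm
    have hsize : ∀ lam : Par, lam.parts.sum = lam.size := fun lam => lam.2.parts_sum
    have hzero : ∀ a : ℕ →₀ ℕ, L ≤ a.support.card →
        MvPowerSeries.coeff a (f : MvPowerSeries ℕ ℂ) =
          MvPowerSeries.coeff a (g : MvPowerSeries ℕ ℂ) := by
      intro a ha
      rw [hgc]
      by_cases hin : a.degree ≤ d ∧ a.support.card = L
      · have hmS : Par.mk' (shape a) (shape_pos a) ∈ S :=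
          (hS _).2 ⟨hin.1, by rw [Par.length, Par.parts_mk', card_shape, hin.2]⟩
        rw [Finset.sum_eq_single_of_mem _ hmS]
        · set lam := Par.mk' (shape a) (shape_pos a)
          have hsh : shape (mon lam) = shape a := hmon lam
          rw [coeff_eq_of_shape_eq f.2.1 hsh, coeff_eq_of_shape_eq (pSym lam).2.1 hsh,
            div_mul_cancel₀ _ (coeff_p_shape_ne_zero lam rfl)]
        · intro mu hmu hne
          rw [hterm a ha mu hmu fun h => hne (Par.parts_injective h), mul_zero]
      · rw [Finset.sum_eq_zero]
        · by_contra hc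
          have h1 := hf a hc
          have h2 : a.degree ≤ d := by
            by_contra h3
            exact hc (hd a (by omega))
          exact hin ⟨h2, by omega⟩
        · intro lam hlam
          rw [hterm a ha lam hlam, mul_zero]
          intro hsh
          have h1 := (hS lam).1 hlam
          rw [← hsize lam, hsh, sum_shape, Par.length, hsh, card_shape] at h1
          exact hin h1
    have hfg : f - g ∈ Submodule.span ℂ (Set.range pSym) := by
      refine ih (f - g) (fun a ha => ?_) fun a hc => ?_
      · rw [Subalgebra.coe_sub, map_sub, hd a ha, hgc, Finset.sum_eq_zero, sub_zero]
        intro lam hlam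
        by_contra hc
        have h1 := (coeff_p_ne_zero lam (right_ne_zero_of_mul hc)).1
        have h2 := ((hS lam).1 hlam).1
        omega
      · by_contra h
        refine hc ?_
        rw [Subalgebra.coe_sub, map_sub, hzero a (by omega), sub_self]
    have := Submodule.add_mem _ hfg hg
    rwa [sub_add_cancel] at this

/-! ### Schur functions -/

/-- The content of a semistandard tableau: the exponent of the monomial `∏_c x_{T(c)}`. -/
def content {mu : YoungDiagram} (T : SemistandardYoungTableau mu) : ℕ →₀ ℕ :=
  ∑ c ∈ mu.cells, Finsupp.single (T c.1 c.2) 1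

namespace BenderKnuth

variable {mu : YoungDiagram} (T : SemistandardYoungTableau mu)

/-- The number of entries smaller than `v` in row `r`. -/
def num (r v : ℕ) : ℕ := ((Finset.range (mu.rowLen r)).filter fun j => T r j < v).card

theorem lt_num_iff {r v j : ℕ} (hj : j < mu.rowLen r) : T r j < v ↔ j < num T r v := by
  constructor
  · intro h
    have hsub : Finset.range (j + 1) ⊆
        (Finset.range (mu.rowLen r)).filter fun i => T r i < v := by
      intro i hi
      rw [Finset.mem_range] at hi
      rw [Finset.mem_filter, Finset.mem_range]
      exact ⟨by omega, lt_of_le_of_lt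
        (T.row_weak_of_le (by omega) (YoungDiagram.mem_iff_lt_rowLen.2 hj)) h⟩
    have := Finset.card_le_card hsub
    rw [Finset.card_range] at this
    exact this
  · intro h
    by_contra hc
    have hsub : ((Finset.range (mu.rowLen r)).filter fun i => T r i < v) ⊆ Finset.range j := by
      intro i hi
      rw [Finset.mem_filter, Finset.mem_range] at hi
      rw [Finset.mem_range]
      by_contra hij
      have := T.row_weak_of_le (show j ≤ i by omega) (YoungDiagram.mem_iff_lt_rowLen.2 hi.1)
      omega
    have := Finset.card_le_card hsub
    rw [Finset.card_range] at this
    exact absurd h (not_lt.2 this)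

theorem num_le_rowLen (r v : ℕ) : num T r v ≤ mu.rowLen r :=
  (Finset.card_filter_le _ _).trans (Finset.card_range _).le

theorem num_mono (r : ℕ) {v w : ℕ} (h : v ≤ w) : num T r v ≤ num T r w :=
  Finset.card_le_card fun i hi => by
    rw [Finset.mem_filter] at hi ⊢
    exact ⟨hi.1, by omega⟩

theorem num_succ_le (r v : ℕ) : num T (r + 1) (v + 1) ≤ num T r v := by
  by_contra hc
  push Not at hc
  have hj : num T r v < mu.rowLen (r + 1) := hc.trans_le (num_le_rowLen T _ _)
  have h1 := (lt_num_iff T hj).2 hc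
  have h2 := T.col_strict (lt_add_one r) (YoungDiagram.mem_iff_lt_rowLen.2 hj)
  have hj' : num T r v < mu.rowLen r := hj.trans_le (mu.rowLen_anti r (r + 1) (Nat.le_succ r))
  have h3 := (lt_num_iff T (v := v) hj').1 (by omega)
  omega

/-- A number characterised by the thresholds of row `r`. -/
theorem num_eq_of (r v N : ℕ) (hN : N ≤ mu.rowLen r)
    (h : ∀ j < mu.rowLen r, T r j < v ↔ j < N) : num T r v = N := by
  rw [num]
  conv_rhs => rw [← Finset.card_range N]
  congr 1
  ext j
  rw [Finset.mem_filter, Finset.mem_range, Finset.mem_range]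
  constructor
  · rintro ⟨h1, h2⟩
    exact (h j h1).1 h2
  · intro h1
    exact ⟨by omega, (h j (by omega)).2 h1⟩

variable (k : ℕ)

/-- Lower bound for the number of entries at most `k` in row `r`. -/
def lo (r : ℕ) : ℕ := max (num T r k) (num T (r + 1) (k + 2))

/-- Upper bound for the number of entries at most `k` in row `r`. -/
def hi : ℕ → ℕ
  | 0 => num T 0 (k + 2)
  | r + 1 => min (num T (r + 1) (k + 2)) (num T r k)

/-- The reflected number of entries at most `k` in row `r`. -/
def mid (r : ℕ) : ℕ := lo T k r + hi T k r - num T r (k + 1)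

theorem lo_le (r : ℕ) : lo T k r ≤ num T r (k + 1) :=
  max_le (num_mono T r (by omega)) (num_succ_le T r (k + 1))

theorem le_hi (r : ℕ) : num T r (k + 1) ≤ hi T k r := by
  cases r with
  | zero => exact num_mono T 0 (by omega)
  | succ r => exact le_min (num_mono T _ (by omega)) (num_succ_le T r k)

theorem lo_le_mid (r : ℕ) : lo T k r ≤ mid T k r := by
  have := le_hi T k r
  have := lo_le T k r
  rw [mid]; omega

theorem mid_le_hi (r : ℕ) : mid T k r ≤ hi T k r := by
  have := le_hi T k r
  have := lo_le T k r
  rw [mid]; omega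

theorem le_mid (r : ℕ) : num T r k ≤ mid T k r := (le_max_left _ _).trans (lo_le_mid T k r)

theorem mid_le (r : ℕ) : mid T k r ≤ num T r (k + 2) := by
  refine (mid_le_hi T k r).trans ?_
  cases r with
  | zero => exact le_rfl
  | succ r => exact min_le_left _ _

/-- The entries after exchanging the roles of `k` and `k + 1`. -/
def entry (r j : ℕ) : ℕ :=
  if j < mu.rowLen r then
    if j < num T r k ∨ num T r (k + 2) ≤ j then T r j
    else if j < mid T k r then k else k + 1
  else 0

theorem entry_col {r j : ℕ} (hj : j < mu.rowLen (r + 1)) : entry T k r j < entry T k (r + 1) j := by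
  have hj' : j < mu.rowLen r := hj.trans_le (mu.rowLen_anti r (r + 1) (Nat.le_succ r))
  have hc := T.col_strict (lt_add_one r) (YoungDiagram.mem_iff_lt_rowLen.2 hj)
  have a1 := lt_num_iff T (v := k) hj
  have a2 := lt_num_iff T (v := k) hj'
  have c1 := lt_num_iff T (v := k + 2) hj
  have c2 := lt_num_iff T (v := k + 2) hj'
  have m1 : num T (r + 1) (k + 2) ≤ mid T k r := (le_max_right _ _).trans (lo_le_mid T k r)
  have m2 : mid T k (r + 1) ≤ num T r k := (mid_le_hi T k (r + 1)).trans (min_le_right _ _)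
  have m3 := le_mid T k r
  have m4 := mid_le T k r
  have m5 := le_mid T k (r + 1)
  have m6 := mid_le T k (r + 1)
  rw [entry, entry, if_pos hj, if_pos hj']
  split_ifs <;> omega

/-- The Bender–Knuth involution for `k` and `k + 1`. -/
def flip : SemistandardYoungTableau mu where
  entry := entry T k
  row_weak' := by
    intro r j1 j2 hlt hcell
    have hj := YoungDiagram.mem_iff_lt_rowLen.1 hcell
    have hj1 : j1 < mu.rowLen r := hlt.trans hj
    have hw := T.row_weak hlt hcell
    have a1 := lt_num_iff T (v := k) hj
    have a2 := lt_num_iff T (v := k) hj1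
    have c1 := lt_num_iff T (v := k + 2) hj
    have c2 := lt_num_iff T (v := k + 2) hj1
    have m3 := le_mid T k r
    have m4 := mid_le T k r
    rw [entry, entry, if_pos hj, if_pos hj1]
    split_ifs <;> omega
  col_strict' := by
    intro i1 i2 j hlt hcell
    induction i2, hlt using Nat.le_induction with
    | base => exact entry_col T k (YoungDiagram.mem_iff_lt_rowLen.1 hcell)
    | succ i hi ih =>
      exact (ih (mu.up_left_mem (Nat.le_succ i) le_rfl hcell)).trans
        (entry_col T k (YoungDiagram.mem_iff_lt_rowLen.1 hcell))
  zeros' := by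
    intro i j hcell
    rw [entry, if_neg fun h => hcell (YoungDiagram.mem_iff_lt_rowLen.2 h)]

theorem flip_apply (r j : ℕ) : flip T k r j = entry T k r j := rfl

theorem num_flip_of_ne (r : ℕ) {v : ℕ} (hv : v ≠ k + 1) : num (flip T k) r v = num T r v := by
  refine num_eq_of _ r v _ (num_le_rowLen T r v) fun j hj => ?_
  rw [← lt_num_iff T hj]
  have a1 := lt_num_iff T (v := k) hj
  have c1 := lt_num_iff T (v := k + 2) hj
  have m3 := le_mid T k r
  have m4 := mid_le T k r
  rw [flip_apply, entry, if_pos hj]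
  split_ifs <;> omega

theorem num_flip (r : ℕ) : num (flip T k) r (k + 1) = mid T k r := by
  refine num_eq_of _ r _ _ ((mid_le T k r).trans (num_le_rowLen T r _)) fun j hj => ?_
  have a1 := lt_num_iff T (v := k) hj
  have c1 := lt_num_iff T (v := k + 2) hj
  have m3 := le_mid T k r
  have m4 := mid_le T k r
  rw [flip_apply, entry, if_pos hj]
  split_ifs <;> omega

theorem mid_flip (r : ℕ) : mid (flip T k) k r = num T r (k + 1) := by
  have h1 : lo (flip T k) k r = lo T k r := by
    rw [lo, lo, num_flip_of_ne T k _ (by omega), num_flip_of_ne T k _ (by omega)]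
  have h2 : hi (flip T k) k r = hi T k r := by
    cases r with
    | zero => rw [hi, hi, num_flip_of_ne T k _ (by omega)]
    | succ r =>
      rw [hi, hi, num_flip_of_ne T k _ (by omega), num_flip_of_ne T k _ (by omega)]
  have h3 := lo_le T k r
  have h4 := le_hi T k r
  rw [mid, h1, h2, num_flip, mid]
  omega

theorem flip_flip : flip (flip T k) k = T := by
  ext r j
  rw [flip_apply, entry]
  split_ifs with hj h1 h2
  · rw [num_flip_of_ne T k _ (by omega), num_flip_of_ne T k _ (by omega)] at h1
    rw [flip_apply, entry, if_pos hj, if_pos h1]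
  · rw [num_flip_of_ne T k _ (by omega), num_flip_of_ne T k _ (by omega)] at h1
    rw [mid_flip] at h2
    have a1 := lt_num_iff T (v := k) hj
    have b1 := lt_num_iff T (v := k + 1) hj
    omega
  · rw [num_flip_of_ne T k _ (by omega), num_flip_of_ne T k _ (by omega)] at h1
    rw [mid_flip] at h2
    have c1 := lt_num_iff T (v := k + 2) hj
    have b1 := lt_num_iff T (v := k + 1) hj
    omega
  · exact (T.zeros fun h => hj (YoungDiagram.mem_iff_lt_rowLen.1 h)).symm

theorem content_apply (v : ℕ) : content T v = (mu.cells.filter fun c => T c.1 c.2 = v).card := by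
  rw [content, Finsupp.finsetSum_apply, Finset.card_filter]
  exact Finset.sum_congr rfl fun c _ => Finsupp.single_apply

theorem content_add (v : ℕ) : content T v + ∑ r ∈ Finset.range (mu.colLen 0), num T r v =
    ∑ r ∈ Finset.range (mu.colLen 0), num T r (v + 1) := by
  have hS : mu.cells = ((Finset.range (mu.colLen 0)).sigma fun r => Finset.range (mu.rowLen r)).map
      (Equiv.sigmaEquivProd ℕ ℕ).toEmbedding := by
    ext ⟨i, j⟩
    rw [YoungDiagram.mem_cells]
    simp only [Finset.mem_map_equiv, Finset.mem_sigma, Finset.mem_range]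
    constructor
    · intro h
      exact ⟨YoungDiagram.mem_iff_lt_colLen.1 (mu.up_left_mem le_rfl (Nat.zero_le j) h),
        YoungDiagram.mem_iff_lt_rowLen.1 h⟩
    · rintro ⟨-, h⟩
      exact YoungDiagram.mem_iff_lt_rowLen.2 h
  rw [content_apply, Finset.card_filter, hS, Finset.sum_map, Finset.sum_sigma,
    ← Finset.sum_add_distrib]
  refine Finset.sum_congr rfl fun r _ => ?_
  rw [num, num, Finset.card_filter, Finset.card_filter, ← Finset.sum_add_distrib]
  refine Finset.sum_congr rfl fun j _ => ?_
  change (if T r j = v then 1 else 0) + _ = _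
  split_ifs <;> omega

theorem sum_lo_hi (L : ℕ) : ∑ r ∈ Finset.range L, lo T k r + ∑ r ∈ Finset.range (L + 1), hi T k r =
    ∑ r ∈ Finset.range L, num T r k + ∑ r ∈ Finset.range (L + 1), num T r (k + 2) := by
  induction L with
  | zero => simp [hi]
  | succ L ih =>
    rw [Finset.sum_range_succ, Finset.sum_range_succ _ (L + 1),
      Finset.sum_range_succ (fun r => num T r k), Finset.sum_range_succ _ (L + 1), lo, hi]
    have := max_add_min (num T L k) (num T (L + 1) (k + 2))
    rw [min_comm] at this
    omega

theorem sum_mid : ∑ r ∈ Finset.range (mu.colLen 0), mid T k r +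
      ∑ r ∈ Finset.range (mu.colLen 0), num T r (k + 1) =
    ∑ r ∈ Finset.range (mu.colLen 0), num T r k +
      ∑ r ∈ Finset.range (mu.colLen 0), num T r (k + 2) := by
  have h := sum_lo_hi T k (mu.colLen 0)
  have hz : mu.rowLen (mu.colLen 0) = 0 := by
    by_contra hne
    have : (mu.colLen 0, 0) ∈ mu := YoungDiagram.mem_iff_lt_rowLen.2 (Nat.pos_of_ne_zero hne)
    exact absurd (YoungDiagram.mem_iff_lt_colLen.1 this) (lt_irrefl _)
  have h1 : num T (mu.colLen 0) (k + 2) = 0 := by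
    have := num_le_rowLen T (mu.colLen 0) (k + 2)
    omega
  have h2 : hi T k (mu.colLen 0) = 0 := by
    cases hL : mu.colLen 0 with
    | zero => rw [hL] at h1; exact h1
    | succ L => rw [hL] at h1; rw [hi, h1, Nat.zero_min]
  rw [Finset.sum_range_succ, Finset.sum_range_succ _ (mu.colLen 0), h1, h2, add_zero,
    add_zero] at h
  rw [← h, ← Finset.sum_add_distrib, ← Finset.sum_add_distrib]
  refine Finset.sum_congr rfl fun r _ => ?_
  have h3 := lo_le T k r
  have h4 := le_hi T k r
  rw [mid]
  omega

theorem content_flip : content (flip T k) = (content T).mapDomain (Equiv.swap k (k + 1)) := by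
  ext v
  obtain ⟨w, rfl⟩ := (Equiv.swap k (k + 1)).surjective v
  rw [Finsupp.mapDomain_apply (Equiv.injective _)]
  have hs := sum_mid T k
  have e1 := content_add T w
  have e2 := content_add (flip T k) (Equiv.swap k (k + 1) w)
  by_cases h1 : w = k
  · subst h1
    rw [Equiv.swap_apply_left] at e2 ⊢
    simp only [num_flip] at e2
    rw [Finset.sum_congr rfl fun r _ => num_flip_of_ne T w r (v := w + 1 + 1) (by omega)] at e2
    change _ = ∑ r ∈ _, num T r (w + 2) at e2
    omega
  · by_cases h2 : w = k + 1
    · subst h2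
      rw [Equiv.swap_apply_right] at e2 ⊢
      simp only [num_flip] at e2
      rw [Finset.sum_congr rfl fun r _ => num_flip_of_ne T k r (v := k) (by omega)] at e2
      change _ = ∑ r ∈ _, num T r (k + 2) at e1
      omega
    · rw [Equiv.swap_apply_of_ne_of_ne h1 h2] at e2 ⊢
      rw [Finset.sum_congr rfl fun r _ => num_flip_of_ne T k r (v := w) (by omega),
        Finset.sum_congr rfl fun r _ => num_flip_of_ne T k r (v := w + 1) (by omega)] at e2
      omega

end BenderKnuth

/-- The Schur function as a power series: `∑_T x^T` over all semistandard tableaux of shape `mu`. -/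
def schurSeries (mu : YoungDiagram) : MvPowerSeries ℕ ℂ :=
  series fun a => (Nat.card {T : SemistandardYoungTableau mu // content T = a} : ℂ)

theorem isSymm_of_swap {f : MvPowerSeries ℕ ℂ}
    (hf : ∀ (k : ℕ) (a : ℕ →₀ ℕ), MvPowerSeries.coeff (a.mapDomain (Equiv.swap k (k + 1))) f =
      MvPowerSeries.coeff a f) : IsSymm f := by
  let G : Submonoid (Equiv.Perm ℕ) :=
    { carrier := {e | ∀ a : ℕ →₀ ℕ, MvPowerSeries.coeff (a.mapDomain e) f =
        MvPowerSeries.coeff a f}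
      mul_mem' := by
        intro e e' he he' a
        rw [Equiv.Perm.coe_mul, Finsupp.mapDomain_comp, he, he']
      one_mem' := by
        intro a
        rw [Equiv.Perm.coe_one, Finsupp.mapDomain_id] }
  have hadj : ∀ i d, Equiv.swap i (i + d) ∈ G := by
    intro i d
    induction d with
    | zero =>
      rw [add_zero, Equiv.swap_self]
      exact G.one_mem
    | succ d ih =>
      rcases Nat.eq_zero_or_pos d with rfl | hd
      · exact hf i
      · have h := Equiv.swap_mul_swap_mul_swap (x := i + d + 1) (y := i + d) (z := i)
          (by omega) (by omega)
        rw [Equiv.swap_comm (i + d) i, Equiv.swap_comm (i + d + 1) (i + d)] at h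
        rw [← add_assoc, ← h]
        exact G.mul_mem (G.mul_mem ih (hf (i + d))) ih
  have hswap : ∀ i j, Equiv.swap i j ∈ G := by
    intro i j
    rcases le_total i j with h | h
    · obtain ⟨d, rfl⟩ := Nat.exists_eq_add_of_le h
      exact hadj i d
    · obtain ⟨d, rfl⟩ := Nat.exists_eq_add_of_le h
      rw [Equiv.swap_comm]
      exact hadj j d
  have hext : ∀ (e : Equiv.Perm ℕ) (s : Finset ℕ), ∃ e' ∈ G, ∀ x ∈ s, e' x = e x := by
    intro e s
    induction s using Finset.induction with
    | empty => exact ⟨1, G.one_mem, by simp⟩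
    | insert x s hx ih =>
      obtain ⟨e', he', hs⟩ := ih
      refine ⟨Equiv.swap (e' x) (e x) * e', G.mul_mem (hswap _ _) he', fun y hy => ?_⟩
      rw [Equiv.Perm.mul_apply]
      rcases Finset.mem_insert.1 hy with rfl | hy'
      · rw [Equiv.swap_apply_left]
      · have hyx : y ≠ x := by rintro rfl; exact hx hy'
        rw [Equiv.swap_apply_of_ne_of_ne, hs y hy']
        · exact fun h => hyx (e'.injective h)
        · rw [hs y hy']
          exact fun h => hyx (e.injective h)
  refine (isSymm_iff f).2 fun e a => ?_
  obtain ⟨e', he', hs⟩ := hext e a.support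
  rw [← he' a, Finsupp.mapDomain_congr fun x hx => (hs x hx).symm]

theorem schurSeries_mem (mu : YoungDiagram) : schurSeries mu ∈ SymmFun := by
  refine ⟨isSymm_of_swap fun k a => ?_, mu.cells.card, fun a ha => ?_⟩
  · rw [schurSeries, coeff_series, coeff_series, Nat.cast_inj]
    have hinv : ∀ b : ℕ →₀ ℕ, (b.mapDomain (Equiv.swap k (k + 1))).mapDomain
        (Equiv.swap k (k + 1)) = b := by
      intro b
      rw [← Finsupp.mapDomain_comp, ← Equiv.Perm.coe_mul, Equiv.swap_mul_self,
        Equiv.Perm.coe_one, Finsupp.mapDomain_id]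
    refine Nat.card_congr
      { toFun := fun T => ⟨BenderKnuth.flip T.1 k, by
          rw [BenderKnuth.content_flip, T.2, hinv]⟩
        invFun := fun T => ⟨BenderKnuth.flip T.1 k, by
          rw [BenderKnuth.content_flip, T.2]⟩
        left_inv := fun T => Subtype.ext (BenderKnuth.flip_flip T.1 k)
        right_inv := fun T => Subtype.ext (BenderKnuth.flip_flip T.1 k) }
  · rw [schurSeries, coeff_series, Nat.cast_eq_zero, Nat.card_eq_zero]
    left
    refine ⟨fun T => ?_⟩
    have h := congrArg Finsupp.degree T.2
    rw [content, map_sum] at h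
    simp only [Finsupp.degree_single, Finset.sum_const, smul_eq_mul, mul_one] at h
    omega

/-- The Schur function `s_λ ∈ Λ`. -/
def schur (lam : Par) : SymmFun := ⟨schurSeries lam.diagram, schurSeries_mem _⟩

/-! ### The Hall pairing and plethystic substitution -/

/-- The basis `(p_λ)_λ` of `Λ`. -/
def pBasis : Module.Basis Par ℂ SymmFun :=
  Module.Basis.mk linearIndependent_p fun f _ => by
    obtain ⟨d, hd⟩ := f.2.2
    refine mem_span_p d (d + 1) f hd fun a ha => Nat.lt_succ_of_le ?_
    have h1 : a.degree ≤ d := by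
      by_contra h
      exact ha (hd a (by omega))
    refine le_trans ?_ h1
    rw [Finsupp.degree_apply, Finset.card_eq_sum_ones]
    exact Finset.sum_le_sum fun i hi => Nat.pos_of_ne_zero (Finsupp.mem_support_iff.1 hi)

theorem pBasis_apply (lam : Par) : pBasis lam = pSym lam := Module.Basis.mk_apply _ _ _

/-- The Hall pairing: the bilinear form on `Λ` with `⟨p_λ, p_μ⟩ = z_λ δ_{λ,μ}`. -/
def hallPairing : SymmFun →ₗ[ℂ] SymmFun →ₗ[ℂ] ℂ :=
  pBasis.constr ℂ fun lam => pBasis.constr ℂ fun mu => if lam = mu then (lam.z : ℂ) else 0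

theorem hallPairing_p (lam mu : Par) :
    hallPairing (pSym lam) (pSym mu) = if lam = mu then (lam.z : ℂ) else 0 := by
  rw [hallPairing, ← pBasis_apply, ← pBasis_apply, Module.Basis.constr_basis,
    Module.Basis.constr_basis]

/-- `p_n(A) = ∑_a c_a t^{n a}` for a series `A = ∑_a c_a t^a` and `n ≥ 1`. -/
def adams {σ : Type*} (n : ℕ) (A : MvPowerSeries σ ℂ) : MvPowerSeries σ ℂ :=
  if hn : n = 0 then 0 else MvPowerSeries.expand n hn A

/-- The union of two partitions. -/
def Par.union (lam mu : Par) : Par :=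
  Par.mk' (lam.parts + mu.parts) fun i hi => by
    rcases Multiset.mem_add.1 hi with h | h
    · exact lam.pos h
    · exact mu.pos h

theorem p_mul (lam mu : Par) : pSym lam * pSym mu = pSym (lam.union mu) := by
  refine Subtype.ext ?_
  change (lam.parts.map _).prod * (mu.parts.map _).prod = ((lam.parts + mu.parts).map _).prod
  rw [Multiset.map_add, Multiset.prod_add]

/-- The plethystic substitution `f ↦ f(A)`: the algebra homomorphism on `Λ` determined by
`p_n ↦ p_n(A)`. -/
def plethysm {σ : Type*} (A : MvPowerSeries σ ℂ) : SymmFun →ₐ[ℂ] MvPowerSeries σ ℂ :=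
  AlgHom.ofLinearMap
    (pBasis.constr ℂ fun lam : Par => (lam.parts.map fun r => adams r A).prod)
    (by
      have h1 : (1 : SymmFun) = pBasis (Par.mk' 0 (by simp)) := by
        rw [pBasis_apply]
        rfl
      rw [h1, Module.Basis.constr_basis]
      rfl)
    (by
      intro f g
      set φ := pBasis.constr ℂ fun lam : Par => (lam.parts.map fun r => adams r A).prod with hφ
      have key : (LinearMap.mul ℂ SymmFun).compr₂ φ =
          (LinearMap.mul ℂ (MvPowerSeries σ ℂ)).compl₁₂ φ φ := by
        refine pBasis.ext fun lam => pBasis.ext fun mu => ?_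
        rw [LinearMap.compr₂_apply, LinearMap.compl₁₂_apply, LinearMap.mul_apply',
          LinearMap.mul_apply', pBasis_apply, pBasis_apply, p_mul, ← pBasis_apply,
          ← pBasis_apply, ← pBasis_apply, hφ, Module.Basis.constr_basis,
          Module.Basis.constr_basis, Module.Basis.constr_basis, ← Multiset.prod_add,
          ← Multiset.map_add]
        rfl
      exact LinearMap.congr_fun (LinearMap.congr_fun key f) g)

/-- The plethystic exponential `Ω(A) = ∑_{n ≥ 0} h_n(A)`. -/
def plethysticExp {σ : Type*} (A : MvPowerSeries σ ℂ) : MvPowerSeries σ ℂ :=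
  ∑' n : ℕ, plethysm A (hSym n)

/-- `Ω(x; ζ) = ∏_i (1 - ζ x_i)⁻¹`. -/
def omegaProd {σ ι : Type*} (x : ι → MvPowerSeries σ ℂ) (ζ : ℂ) : MvPowerSeries σ ℂ :=
  ∏' i, (1 - MvPowerSeries.C ζ * x i)⁻¹

/-- The homogeneous component of degree `d` of a symmetric series (of possibly unbounded
degree). -/
def symmComponent (F : MvPowerSeries ℕ ℂ) (hF : IsSymm F) (d : ℕ) : SymmFun :=
  ⟨MvPowerSeries.homogeneousComponent d F, (isSymm_iff _).2 fun e a => by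
    rw [MvPowerSeries.coeff_homogeneousComponent, MvPowerSeries.coeff_homogeneousComponent,
      Finsupp.degree_mapDomain, (isSymm_iff F).1 hF], d, fun a ha => by
    rw [MvPowerSeries.coeff_homogeneousComponent, if_neg (by omega)]⟩

/-- The Hall pairing `⟨F, f⟩` of a symmetric series `F` of possibly unbounded degree with
`f ∈ Λ`: only the finitely many degrees occurring in `f` contribute. -/
def hallSeries (F : MvPowerSeries ℕ ℂ) (hF : IsSymm F) (f : SymmFun) : ℂ :=
  ∑ᶠ d : ℕ, hallPairing (symmComponent F hF d) f

/-- The coefficient of `x^a` in `K(x, y)`, a series in `y`. -/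
def coeffX {σ : Type*} (a : σ →₀ ℕ) (K : MvPowerSeries (σ ⊕ ℕ) ℂ) : MvPowerSeries ℕ ℂ :=
  series fun b => MvPowerSeries.coeff (a.sumElim b) K

/-- `K(x, y)` is symmetric in `y`. -/
def IsSymmY {σ : Type*} (K : MvPowerSeries (σ ⊕ ℕ) ℂ) : Prop :=
  ∀ a : σ →₀ ℕ, IsSymm (coeffX a K)

/-- The pairing `⟨K(x, y), f(y)⟩_y`, taken coefficientwise in `x`. -/
def pairingY {σ : Type*} (K : MvPowerSeries (σ ⊕ ℕ) ℂ) (hK : IsSymmY K) (f : SymmFun) :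
    MvPowerSeries σ ℂ :=
  series fun a => hallSeries (coeffX a K) (hK a) f

/-- The evaluation `f(x_0, …, x_{n-1})`, all other variables being set to zero. -/
def evalFin {n : ℕ} (f : SymmFun) (x : Fin n → ℂ) : ℂ :=
  ∑ᶠ b : Fin n →₀ ℕ, MvPowerSeries.coeff (b.embDomain Fin.valEmbedding) (f : MvPowerSeries ℕ ℂ) *
    ∏ i, x i ^ b i

/-- The evaluation of `f ∈ Λ` at a finite multiset of complex numbers. -/
def evalMultiset (f : SymmFun) (A : Multiset ℂ) : ℂ := evalFin f A.toList.get

/-! ### Wreath products -/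

instance fintypeRoots (m : ℕ) [NeZero m] : Fintype (rootsOfUnity m ℂ) := Fintype.ofFinite _

/-- `𝔖_n(μ_m) = μ_m^n ⋊ 𝔖_n`, where `(σ • a)_i = a_{σ⁻¹ i}`. -/
abbrev WreathGroup (m n : ℕ) : Type :=
  (Fin n → rootsOfUnity m ℂ) ⋊[mulAutArrow (G := Equiv.Perm (Fin n))] Equiv.Perm (Fin n)

/-- The monomial matrix of `(a; σ)`: its nonzero entries are `a_{σ j}` at `(σ j, j)`. -/
def toMatrix {m n : ℕ} : WreathGroup m n →* Matrix (Fin n) (Fin n) ℂ where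
  toFun γ := Matrix.of fun i j => if i = γ.right j then ((γ.left i : ℂˣ) : ℂ) else 0
  map_one' := by
    ext i j
    rw [Matrix.one_apply]
    simp
    congr
  map_mul' γ δ := by
    ext i j
    rw [Matrix.mul_apply, Finset.sum_eq_single (δ.right j)]
    · by_cases hi : i = γ.right (δ.right j)
      · subst hi
        have hact : δ.left (γ.right⁻¹ (γ.right (δ.right j))) = δ.left (δ.right j) := by simp
        simp
        exact congrArg (fun z : rootsOfUnity m ℂ => ((z : ℂˣ) : ℂ)) hact
      · simp [hi]
    · intro b _ hb
      simp [hb]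
    · simp

/-- The embedding of `𝔖_n(μ_m)` into `GL_n(ℂ)`. -/
def toGL {m n : ℕ} : WreathGroup m n →* Matrix.GeneralLinearGroup (Fin n) ℂ :=
  toMatrix.toHomUnits

/-- The cycles of the permutation part of `γ`, fixed points included. -/
abbrev Cycle {m n : ℕ} (γ : WreathGroup m n) : Type :=
  Quotient (Equiv.Perm.SameCycle.setoid γ.right)

open Classical in
/-- The set of points of a cycle. -/
def Cycle.points {m n : ℕ} {γ : WreathGroup m n} (q : Cycle γ) : Finset (Fin n) :=
  Finset.univ.filter fun i => Quotient.mk (Equiv.Perm.SameCycle.setoid γ.right) i = q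

/-- The cycle product `∏_{i ∈ q} a_i ∈ μ_m`. -/
def cycleProduct {m n : ℕ} {γ : WreathGroup m n} (q : Cycle γ) : rootsOfUnity m ℂ :=
  ∏ i ∈ q.points, γ.left i

/-- `Φ`: functions from `μ_m` to partitions. -/
abbrev Phi (m : ℕ) : Type := rootsOfUnity m ℂ → Par

/-- `|ρ| = ∑_ζ |ρ(ζ)|`. -/
def Phi.size {m : ℕ} [NeZero m] (ρ : Phi m) : ℕ := ∑ ζ, (ρ ζ).size

instance finite_phi {m : ℕ} [NeZero m] (n : ℕ) : Finite {ρ : Phi m // ρ.size = n} := by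
  have hS : {lam : Par | lam.size ≤ n}.Finite := by
    refine (((Finset.range (n + 1)).sigma fun k =>
      (Finset.univ : Finset k.Partition)).finite_toSet).subset fun lam hlam => ?_
    simpa [Par.size, Nat.lt_succ_iff] using hlam
  refine ((Set.Finite.pi' fun _ : rootsOfUnity m ℂ => hS).subset fun ρ hρ ζ => ?_).to_subtype
  have h : Phi.size ρ = n := hρ
  exact (Finset.single_le_sum (f := fun ζ => (ρ ζ).size) (fun _ _ => Nat.zero_le _)
    (Finset.mem_univ ζ)).trans h.le

/-- `Z_ρ = ∏_ζ z_{ρ(ζ)} m^{ℓ(ρ(ζ))}`. -/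
def Phi.Z {m : ℕ} [NeZero m] (ρ : Phi m) : ℕ := ∏ ζ, (ρ ζ).z * m ^ (ρ ζ).length

/-- The class `C_ρ ⊆ 𝔖_n(μ_m)`: elements with exactly `m_ℓ(ρ(ζ))` cycles of length `ℓ` and cycle
product `ζ`, for all `ζ ∈ μ_m` and `ℓ ≥ 1`. -/
def conjClass {m : ℕ} (n : ℕ) (ρ : Phi m) : Set (WreathGroup m n) :=
  {γ | ∀ (ζ : rootsOfUnity m ℂ) (l : ℕ), 1 ≤ l →
    Nat.card {q : Cycle γ // cycleProduct q = ζ ∧ q.points.card = l} = (ρ ζ).mult l}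

open Classical in
/-- A representative of the class `C_ρ ⊆ 𝔖_n(μ_m)`. -/
def classRep {m : ℕ} (n : ℕ) (ρ : Phi m) : WreathGroup m n :=
  if hne : (conjClass n ρ).Nonempty then hne.some else 1

/-- `Ξ_ρ`: the multiset of roots of the characteristic polynomial of an element of `C_ρ`. -/
def Xi {m : ℕ} [NeZero m] (ρ : Phi m) : Multiset ℂ :=
  (toMatrix (classRep ρ.size ρ)).charpoly.roots

/-- `P_ρ = ∏_ζ p_{ρ(ζ)}(X_ζ)`, where `X_ζ` is the variable set `x_{ζ,0}, x_{ζ,1}, …`. -/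
def P {m : ℕ} [NeZero m] (ρ : Phi m) : MvPowerSeries (rootsOfUnity m ℂ × ℕ) ℂ :=
  ∏ ζ, powerSumPar (fun i : ℕ => MvPowerSeries.X (ζ, i)) (ρ ζ)

/-- The term of index `ρ` of the generating series `F_λ`. -/
def FTerm {m : ℕ} [NeZero m] (lam : Par) (ρ : Phi m) :
    MvPowerSeries (rootsOfUnity m ℂ × ℕ) ℂ :=
  (evalMultiset (schur lam) (Xi ρ) / (ρ.Z : ℂ)) • P ρ

/-- `F_λ = ∑_{ρ ∈ Φ} P_ρ s_λ(Ξ_ρ) / Z_ρ`. -/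
def F (m : ℕ) [NeZero m] (lam : Par) : MvPowerSeries (rootsOfUnity m ℂ × ℕ) ℂ :=
  ∑' ρ : Phi m, FTerm lam ρ

/-- The series `(1/m) ∑_ζ X_ζ Ω(Y; ζ)`, where `X_ζ = x_{ζ,0} + x_{ζ,1} + …`, in the variables
`x_{ζ,i}` (left summand) and `y_i` (right summand). -/
def kernelAlphabet (m : ℕ) [NeZero m] : MvPowerSeries ((rootsOfUnity m ℂ × ℕ) ⊕ ℕ) ℂ :=
  (1 / (m : ℂ)) • ∑ ζ : rootsOfUnity m ℂ,
    (∑' i : ℕ, MvPowerSeries.X (Sum.inl (ζ, i))) *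
      omegaProd (fun i : ℕ => MvPowerSeries.X (Sum.inr i)) ((ζ : ℂˣ) : ℂ)

/-! ### Highest weight representations -/

/-- The action of `GL_n(ℂ)` on polynomials in the variables `x_{a,c}`, `a ∈ ℕ`, `c < n`, by
`(g f)(x) = f(x g)`. -/
def polyRep (n : ℕ) : Representation ℂ (Matrix.GeneralLinearGroup (Fin n) ℂ)
    (MvPolynomial (ℕ × Fin n) ℂ) where
  toFun g := (MvPolynomial.aeval fun q : ℕ × Fin n =>
    ∑ d, (g.val d q.2) • (MvPolynomial.X (q.1, d) : MvPolynomial (ℕ × Fin n) ℂ)).toLinearMap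
  map_one' := by
    refine congrArg AlgHom.toLinearMap (MvPolynomial.algHom_ext (g := AlgHom.id ℂ _) fun q => ?_)
    simp [Matrix.one_apply, ite_smul]
  map_mul' g g' := by
    refine congrArg AlgHom.toLinearMap (MvPolynomial.algHom_ext (g := AlgHom.comp
      (MvPolynomial.aeval fun q : ℕ × Fin n => ∑ d, (g.val d q.2) • MvPolynomial.X (q.1, d))
      (MvPolynomial.aeval fun q : ℕ × Fin n => ∑ d, (g'.val d q.2) • MvPolynomial.X (q.1, d)))
      fun q => ?_)
    simp only [MvPolynomial.aeval_X, AlgHom.comp_apply, map_sum, map_smul, Finset.smul_sum,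
      smul_smul, Units.val_mul, Matrix.mul_apply, Finset.sum_smul]
    rw [Finset.sum_comm]
    refine Finset.sum_congr rfl fun d _ => Finset.sum_congr rfl fun e _ => ?_
    rw [mul_comm]

/-- The minor of `(x_{a,c})` on the first `k` rows and the columns `c_0, …, c_{k-1}`. -/
def minor {n k : ℕ} (c : Fin k → Fin n) : MvPolynomial (ℕ × Fin n) ℂ :=
  Matrix.det (Matrix.of fun a b : Fin k => MvPolynomial.X ((a : ℕ), c b))

/-- The product of the minors given by the columns of a filling `T` of the diagram `mu` with
entries in `{0, …, n-1}`; `T j` is the `j`-th column. -/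
def minorProd {n : ℕ} (mu : YoungDiagram)
    (T : (j : Fin (mu.rowLen 0)) → Fin (mu.colLen j) → Fin n) : MvPolynomial (ℕ × Fin n) ℂ :=
  ∏ j, minor (T j)

theorem polyRep_minor {n k : ℕ} (g : Matrix.GeneralLinearGroup (Fin n) ℂ) (c : Fin k → Fin n) :
    polyRep n g (minor c) = ∑ d : Fin k → Fin n, (∏ b, g.val (d b) (c b)) • minor d := by
  change MvPolynomial.aeval _ (minor c) = _
  rw [minor, AlgHom.map_det, ← Matrix.det_transpose]
  have hrow : (AlgHom.mapMatrix (MvPolynomial.aeval fun q : ℕ × Fin n =>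
      ∑ d, (g.val d q.2) • (MvPolynomial.X (q.1, d) : MvPolynomial (ℕ × Fin n) ℂ))
      (Matrix.of fun a b : Fin k =>
        (MvPolynomial.X ((a : ℕ), c b) : MvPolynomial (ℕ × Fin n) ℂ))).transpose =
      fun b : Fin k => ∑ d : Fin n, (MvPolynomial.C (σ := ℕ × Fin n) (g.val d (c b))) •
        fun a : Fin k => (MvPolynomial.X ((a : ℕ), d) : MvPolynomial (ℕ × Fin n) ℂ) := by
    funext b a
    simp [MvPolynomial.smul_eq_C_mul]
  rw [hrow]
  change (Matrix.detRowAlternating (n := Fin k)).toMultilinearMap _ = _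
  rw [MultilinearMap.map_sum]
  refine Finset.sum_congr rfl fun d _ => ?_
  rw [MultilinearMap.map_smul_univ, minor, ← Matrix.det_transpose, ← map_prod,
    MvPolynomial.smul_eq_C_mul]
  rfl

/-- The underlying space of `V^λ`: the span of the products of minors over all fillings of the
diagram `mu`. The filling `T j b = b` gives the product of the leading minors
`Δ_{λ'_1} Δ_{λ'_2} ⋯` (`λ'` the conjugate partition), which is fixed by the upper unitriangular
matrices and on which `diag(t_1, …, t_n)` acts by `t_1^{λ_1} ⋯ t_n^{λ_n}`: it is the highest weight
vector of this irreducible module. -/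
def weylModule (n : ℕ) (mu : YoungDiagram) : Submodule ℂ (MvPolynomial (ℕ × Fin n) ℂ) :=
  Submodule.span ℂ (Set.range (minorProd (n := n) mu))

theorem weylModule_invariant (n : ℕ) (mu : YoungDiagram)
    (g : Matrix.GeneralLinearGroup (Fin n) ℂ) :
    weylModule n mu ≤ (weylModule n mu).comap (polyRep n g) := by
  refine Submodule.span_le.2 ?_
  rintro _ ⟨T, rfl⟩
  have hprod : polyRep n g (minorProd mu T) = ∏ j, polyRep n g (minor (T j)) :=
    map_prod (MvPolynomial.aeval fun q : ℕ × Fin n =>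
      ∑ d, (g.val d q.2) • (MvPolynomial.X (q.1, d) : MvPolynomial (ℕ × Fin n) ℂ)) _ _
  change polyRep n g (minorProd mu T) ∈ weylModule n mu
  rw [hprod]
  simp only [polyRep_minor]
  rw [Finset.prod_univ_sum]
  refine Submodule.sum_mem _ fun T' _ => ?_
  rw [Finset.prod_smul]
  exact Submodule.smul_mem _ _ (Submodule.subset_span ⟨T', rfl⟩)

instance finiteDimensional_weylModule (n : ℕ) (mu : YoungDiagram) :
    FiniteDimensional ℂ (weylModule n mu) :=
  FiniteDimensional.span_of_finite ℂ (Set.finite_range _)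

/-- The highest weight representation `V^λ` of `GL_n(ℂ)`, for `ℓ(λ) ≤ n`, realised on the span of
products of minors. -/
def weylRep (n : ℕ) (lam : Par) :
    Representation ℂ (Matrix.GeneralLinearGroup (Fin n) ℂ) (weylModule n lam.diagram) :=
  (polyRep n).subrepresentation _ (weylModule_invariant n lam.diagram)

/-- The restriction of `V^λ` to `𝔖_n(μ_m)`. -/
def resWeylRep (m n : ℕ) (lam : Par) :
    Representation ℂ (WreathGroup m n) (weylModule n lam.diagram) :=
  (weylRep n lam).comp toGL

/-- The Frobenius characteristic `∑_{ρ ∈ Φ_n} (χ(C_ρ) / Z_ρ) P_ρ` of a representation of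
`𝔖_n(μ_m)` with character `χ`. -/
def frobeniusChar {m n : ℕ} [NeZero m] {V : Type*} [AddCommGroup V] [Module ℂ V]
    [FiniteDimensional ℂ V] (W : Representation ℂ (WreathGroup m n) V) :
    MvPowerSeries (rootsOfUnity m ℂ × ℕ) ℂ :=
  ∑ᶠ ρ : {ρ : Phi m // ρ.size = n}, (W.character (classRep n ρ.1) / (ρ.1.Z : ℂ)) • P ρ.1

end WreathSym

end

open scoped MvPowerSeries.WithPiTopology

noncomputable section

namespace WreathSym

/-!
In power sums, `Ω(A) = ∑_ν p_ν(A) / z_ν`, and `Ω` turns sums of alphabets into products. So the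
kernel is `∑_ρ P_ρ(𝔛) / Z_ρ · K_ρ(Y)` with `K_ρ = ∏_ζ ∏_{l ∈ ρ(ζ)} ∏_i (1 - ζ y_i^l)⁻¹`. A cycle of
length `l` with cycle product `ζ` has the `l`-th roots of `ζ` as eigenvalues, and
`∏_{ξ^l = ζ} (1 - ξ y) = 1 - ζ y^l`, so `K_ρ = ∏_{ξ ∈ Ξ_ρ} Ω(Y; ξ)` is the reproducing kernel of the
evaluation `f ↦ f(Ξ_ρ)`: pairing it with `s_λ` gives `s_λ(Ξ_ρ)`. All of this is read off from power
sums, where the `r`-th power sum of the eigenvalues is the trace of the `r`-th power of a monomial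
matrix.

For the representation theory, `γ` has finite order, hence is conjugate to a diagonal matrix. On
`V^λ`, realized by products of minors, such a matrix has an eigenbasis indexed by the semistandard
tableaux: the standard products of minors span by the exchange relations, and they are independent
because their leading monomials are distinct. The trace is therefore `s_λ` of the eigenvalues.
-/

/-! ### The exponential formula for power sums -/

/-- The finite set of partitions of `n`, as a set of elements of `Par`. -/
def parOf (n : ℕ) : Finset Par := Finset.univ.map ⟨Sigma.mk n, sigma_mk_injective⟩

theorem mem_parOf {n : ℕ} {lam : Par} : lam ∈ parOf n ↔ lam.size = n := by
  rw [parOf, Finset.mem_map]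
  constructor
  · rintro ⟨p, -, rfl⟩
    rfl
  · rintro rfl
    exact ⟨lam.2, Finset.mem_univ _, rfl⟩

namespace Par

theorem sum_parts (lam : Par) : lam.parts.sum = lam.size := lam.2.parts_sum

theorem sum_mul_mult (lam : Par) : ∑ r ∈ lam.parts.toFinset, r * lam.mult r = lam.size := by
  rw [← lam.sum_parts, Finset.sum_multiset_count]
  exact Finset.sum_congr rfl fun r _ => mul_comm _ _

/-- The partition with one part `r` more. -/
def cons (r : ℕ) (lam : Par) (hr : 0 < r) : Par :=
  mk' (r ::ₘ lam.parts) (Multiset.forall_mem_cons.2 ⟨hr, fun _ => lam.pos⟩)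

/-- The partition with one part `r` less, or `λ` itself if `r` is not one of its parts. -/
def erase (r : ℕ) (lam : Par) : Par :=
  mk' (lam.parts.erase r) fun _ hi => lam.pos (Multiset.mem_of_mem_erase hi)

theorem parts_cons (r : ℕ) (lam : Par) (hr : 0 < r) : (cons r lam hr).parts = r ::ₘ lam.parts := rfl

theorem parts_erase (r : ℕ) (lam : Par) : (erase r lam).parts = lam.parts.erase r := rfl

theorem cons_erase {r : ℕ} {lam : Par} (h : r ∈ lam.parts) :
    cons r (erase r lam) (lam.pos h) = lam :=
  parts_injective (Multiset.cons_erase h)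

theorem erase_cons (r : ℕ) (lam : Par) (hr : 0 < r) : erase r (cons r lam hr) = lam :=
  parts_injective (Multiset.erase_cons_head r lam.parts)

theorem size_cons (r : ℕ) (lam : Par) (hr : 0 < r) : (cons r lam hr).size = r + lam.size := by
  rw [← sum_parts, parts_cons, Multiset.sum_cons, sum_parts]

theorem size_erase {r : ℕ} {lam : Par} (h : r ∈ lam.parts) :
    r + (lam.erase r).size = lam.size := by
  rw [← size_cons r _ (lam.pos h), cons_erase h]

theorem z_pos (lam : Par) : 0 < lam.z :=
  Finset.prod_pos fun _ hr => Nat.mul_pos (Nat.factorial_pos _)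
    (pow_pos (lam.pos (Multiset.mem_toFinset.1 hr)) _)

theorem mult_pos {r : ℕ} {lam : Par} (h : r ∈ lam.parts) : 0 < lam.mult r :=
  Multiset.count_pos.2 h

theorem z_eq_prod_of_subset (lam : Par) {s : Finset ℕ} (hs : lam.parts.toFinset ⊆ s) :
    lam.z = ∏ r ∈ s, (lam.mult r).factorial * r ^ lam.mult r := by
  refine Finset.prod_subset hs fun r _ hr => ?_
  have hmult : lam.mult r = 0 := Multiset.count_eq_zero.2 fun h => hr (Multiset.mem_toFinset.2 h)
  rw [hmult, Nat.factorial_zero, pow_zero, one_mul]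

theorem z_erase {r : ℕ} {lam : Par} (h : r ∈ lam.parts) :
    lam.z = r * lam.mult r * (lam.erase r).z := by
  have hsub : (lam.erase r).parts.toFinset ⊆ lam.parts.toFinset :=
    Multiset.toFinset_subset.2 (Multiset.erase_subset r lam.parts)
  have hmult : lam.mult r = (lam.erase r).mult r + 1 := by
    have := mult_pos h
    rw [mult, mult, parts_erase, Multiset.count_erase_self]
    exact (Nat.succ_pred_eq_of_pos this).symm
  have hne : ∀ i ∈ lam.parts.toFinset.erase r, (lam.erase r).mult i = lam.mult i := fun i hi => by
    rw [mult, mult, parts_erase, Multiset.count_erase_of_ne (Finset.ne_of_mem_erase hi)]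
  have hprod : ∏ i ∈ lam.parts.toFinset.erase r, (lam.mult i).factorial * i ^ lam.mult i =
      ∏ i ∈ lam.parts.toFinset.erase r, ((lam.erase r).mult i).factorial *
        i ^ (lam.erase r).mult i :=
    Finset.prod_congr rfl fun i hi => by rw [hne i hi]
  rw [z, z_eq_prod_of_subset _ hsub, ← Finset.mul_prod_erase _ _ (Multiset.mem_toFinset.2 h),
    ← Finset.mul_prod_erase _ _ (Multiset.mem_toFinset.2 h), hprod, hmult, Nat.factorial_succ,
    pow_succ]
  ring

end Par

/-- `c_λ = ∏_i c_{λ_i}` for a sequence `c₁, c₂, …`; the value `c 0` is never used. -/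
def parProd {M : Type*} [CommMonoid M] (c : ℕ → M) (lam : Par) : M := (lam.parts.map c).prod

section ParProd

variable {M : Type*} [CommMonoid M]

theorem parProd_congr {c d : ℕ → M} (h : ∀ r, 0 < r → c r = d r) (lam : Par) :
    parProd c lam = parProd d lam :=
  congrArg Multiset.prod (Multiset.map_congr rfl fun r hr => h r (lam.pos hr))

theorem parProd_mul (c d : ℕ → M) (lam : Par) :
    parProd (fun r => c r * d r) lam = parProd c lam * parProd d lam := Multiset.prod_map_mul

theorem map_parProd {N : Type*} [CommMonoid N] (φ : M →* N) (c : ℕ → M) (lam : Par) :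
    φ (parProd c lam) = parProd (fun r => φ (c r)) lam := by
  rw [parProd, map_multiset_prod, Multiset.map_map]
  rfl

theorem parProd_smul {K R : Type*} [CommSemiring K] [CommSemiring R] [Algebra K R] (a : ℕ → K)
    (c : ℕ → R) (lam : Par) :
    parProd (fun r => a r • c r) lam = parProd a lam • parProd c lam := by
  simp only [Algebra.smul_def, parProd_mul]
  exact congrArg (· * _) (map_parProd (algebraMap K R : K →* R) a lam).symm

theorem parProd_eq_mul_erase (c : ℕ → M) {r : ℕ} {lam : Par} (h : r ∈ lam.parts) :
    parProd c lam = c r * parProd c (lam.erase r) :=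
  (Multiset.prod_map_erase h).symm

end ParProd

/-- Newton's identities between a sequence of power sums `c₁, c₂, …` and the generating series `F`
of the complete symmetric functions, in the form of the differential equation
`F' = (∑_{r ≥ 0} c_{r+1} t^r) F` with `F(0) = 1`. -/
structure IsNewton {R : Type*} [CommSemiring R] (c : ℕ → R) (F : PowerSeries R) : Prop where
  coeff_zero : PowerSeries.coeff 0 F = 1
  derivative : PowerSeries.derivative R F = PowerSeries.mk (fun n => c (n + 1)) * F

namespace IsNewton

section CommSemiring

variable {R : Type*} [CommSemiring R]

theorem one : IsNewton (fun _ => (0 : R)) 1 := by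
  refine ⟨PowerSeries.coeff_zero_one, ?_⟩
  have hmk : PowerSeries.mk (fun _ : ℕ => (0 : R)) = 0 := rfl
  rw [hmk, zero_mul, PowerSeries.derivative_one]

theorem mul {c d : ℕ → R} {F G : PowerSeries R} (hF : IsNewton c F) (hG : IsNewton d G) :
    IsNewton (fun r => c r + d r) (F * G) := by
  refine ⟨?_, ?_⟩
  · rw [PowerSeries.coeff_zero_eq_constantCoeff_apply, map_mul,
      ← PowerSeries.coeff_zero_eq_constantCoeff_apply,
      ← PowerSeries.coeff_zero_eq_constantCoeff_apply, hF.coeff_zero, hG.coeff_zero, one_mul]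
  · have hmk : PowerSeries.mk (fun n => c (n + 1) + d (n + 1)) =
        PowerSeries.mk (fun n => c (n + 1)) + PowerSeries.mk (fun n => d (n + 1)) := rfl
    rw [hmk, Derivation.leibniz, hF.derivative, hG.derivative, smul_eq_mul, smul_eq_mul]
    ring

theorem multiset_prod {ι : Type*} (s : Multiset ι) {c : ι → ℕ → R} {F : ι → PowerSeries R}
    (h : ∀ i ∈ s, IsNewton (c i) (F i)) :
    IsNewton (fun r => (s.map fun i => c i r).sum) (s.map F).prod := by
  induction s using Multiset.induction with
  | empty => simpa only [Multiset.map_zero, Multiset.sum_zero, Multiset.prod_zero] using one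
  | cons i s ih =>
    rw [Multiset.forall_mem_cons] at h
    simpa only [Multiset.map_cons, Multiset.sum_cons, Multiset.prod_cons] using h.1.mul (ih h.2)

theorem prod {ι : Type*} (s : Finset ι) {c : ι → ℕ → R} {F : ι → PowerSeries R}
    (h : ∀ i ∈ s, IsNewton (c i) (F i)) :
    IsNewton (fun r => ∑ i ∈ s, c i r) (∏ i ∈ s, F i) :=
  multiset_prod s.val h

theorem congr {c d : ℕ → R} {F : PowerSeries R} (hF : IsNewton c F)
    (h : ∀ r, 0 < r → c r = d r) : IsNewton d F :=
  ⟨hF.coeff_zero, by simp only [hF.derivative, h _ (Nat.succ_pos _)]⟩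

end CommSemiring

theorem map {R S : Type*} [CommSemiring R] [CommSemiring S] (φ : R →+* S) {c : ℕ → R}
    {F : PowerSeries R} (h : IsNewton c F) : IsNewton (φ ∘ c) (PowerSeries.map φ F) := by
  refine ⟨by rw [PowerSeries.coeff_map, h.coeff_zero, map_one], ?_⟩
  have hmk : PowerSeries.mk (fun n => (φ ∘ c) (n + 1)) =
      PowerSeries.map φ (PowerSeries.mk fun n => c (n + 1)) := by
    ext n
    rw [PowerSeries.coeff_map, PowerSeries.coeff_mk, PowerSeries.coeff_mk, Function.comp_apply]
  rw [hmk, ← map_mul, ← h.derivative]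
  ext n
  simp only [PowerSeries.coeff_derivative, PowerSeries.coeff_map, map_mul, map_add, map_natCast,
    map_one]

theorem rescale {R : Type*} [CommSemiring R] (a : R) {c : ℕ → R} {F : PowerSeries R}
    (h : IsNewton c F) : IsNewton (fun r => a ^ r * c r) (PowerSeries.rescale a F) := by
  refine ⟨by rw [PowerSeries.coeff_rescale, pow_zero, one_mul, h.coeff_zero], ?_⟩
  have hmk : PowerSeries.mk (fun n => a ^ (n + 1) * c (n + 1)) =
      PowerSeries.C a * PowerSeries.rescale a (PowerSeries.mk fun n => c (n + 1)) := by
    ext n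
    rw [PowerSeries.coeff_C_mul, PowerSeries.coeff_rescale, PowerSeries.coeff_mk,
      PowerSeries.coeff_mk, pow_succ', mul_assoc]
  rw [hmk, mul_assoc, ← map_mul, ← h.derivative]
  ext n
  rw [PowerSeries.coeff_C_mul, PowerSeries.coeff_rescale, PowerSeries.coeff_derivative,
    PowerSeries.coeff_derivative, PowerSeries.coeff_rescale, pow_succ']
  ring

theorem expand {R : Type*} [CommRing R] {l : ℕ} (hl : l ≠ 0) {c : ℕ → R} {F : PowerSeries R}
    (h : IsNewton c F) :
    IsNewton (fun r => if l ∣ r then (l : R) * c (r / l) else 0) (PowerSeries.expand l hl F) := by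
  refine ⟨by rw [PowerSeries.coeff_zero_eq_constantCoeff_apply, PowerSeries.constantCoeff_expand,
    ← PowerSeries.coeff_zero_eq_constantCoeff_apply, h.coeff_zero], ?_⟩
  have hmk : PowerSeries.mk (fun n => if l ∣ n + 1 then (l : R) * c ((n + 1) / l) else 0) =
      PowerSeries.expand l hl (PowerSeries.mk fun n => c (n + 1)) *
        PowerSeries.derivative R (PowerSeries.X ^ l) := by
    ext n
    rw [PowerSeries.derivative_pow, PowerSeries.derivative_X, mul_one, mul_left_comm,
      ← map_natCast (PowerSeries.C (R := R)), PowerSeries.coeff_C_mul, PowerSeries.coeff_mul_X_pow',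
      PowerSeries.coeff_expand, PowerSeries.coeff_mk, PowerSeries.coeff_mk]
    obtain ⟨l, rfl⟩ := Nat.exists_eq_succ_of_ne_zero hl
    rw [Nat.succ_sub_one]
    by_cases hn : l ≤ n
    · obtain ⟨k, rfl⟩ := Nat.exists_eq_add_of_le' hn
      rw [if_pos hn, Nat.add_sub_cancel, mul_ite, mul_zero, add_assoc,
        Nat.add_div_right k l.succ_pos]
      exact if_congr Nat.dvd_add_self_right rfl rfl
    · rw [if_neg hn, mul_zero, if_neg]
      exact fun hdvd => hn (Nat.le_of_succ_le_succ (Nat.le_of_dvd n.succ_pos hdvd))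
  rw [hmk, PowerSeries.expand_apply, PowerSeries.derivative_subst (PowerSeries.HasSubst.X_pow hl),
    h.derivative, ← PowerSeries.expand_apply l hl, ← PowerSeries.expand_apply l hl, map_mul]
  ring

end IsNewton

theorem isNewton_mk_iff {R : Type*} [CommSemiring R] {c f : ℕ → R} :
    IsNewton c (PowerSeries.mk f) ↔ f 0 = 1 ∧
      ∀ n, f (n + 1) * (n + 1) =
        ∑ p ∈ Finset.HasAntidiagonal.antidiagonal n, c (p.1 + 1) * f p.2 := by
  have hderiv : PowerSeries.derivative R (PowerSeries.mk f) =
      PowerSeries.mk (fun n => c (n + 1)) * PowerSeries.mk f ↔ ∀ n, f (n + 1) * (n + 1) =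
        ∑ p ∈ Finset.HasAntidiagonal.antidiagonal n, c (p.1 + 1) * f p.2 := by
    simp only [PowerSeries.ext_iff, PowerSeries.coeff_derivative, PowerSeries.coeff_mul,
      PowerSeries.coeff_mk]
  rw [← hderiv, ← PowerSeries.coeff_mk 0 f]
  exact ⟨fun h => ⟨h.1, h.2⟩, fun h => ⟨h.1, h.2⟩⟩

theorem IsNewton.unique (K : Type*) {R : Type*} [Field K] [CharZero K] [CommRing R] [Algebra K R]
    {c : ℕ → R} {F G : PowerSeries R} (hF : IsNewton c F) (hG : IsNewton c G) : F = G := by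
  ext n
  induction n using Nat.strong_induction_on with
  | _ n ih =>
    cases n with
    | zero => rw [hF.coeff_zero, hG.coeff_zero]
    | succ n =>
      have hderiv : PowerSeries.coeff n (PowerSeries.derivative R F) =
          PowerSeries.coeff n (PowerSeries.derivative R G) := by
        rw [hF.derivative, hG.derivative, PowerSeries.coeff_mul, PowerSeries.coeff_mul]
        refine Finset.sum_congr rfl fun p hp => ?_
        rw [ih p.2 (Nat.lt_succ_of_le (Finset.HasAntidiagonal.antidiagonal.snd_le hp))]
      have hunit : IsUnit ((n : R) + 1) := by
        simpa using (IsUnit.mk0 ((n : K) + 1) (Nat.cast_add_one_ne_zero n)).map (algebraMap K R)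
      rw [PowerSeries.coeff_derivative, PowerSeries.coeff_derivative] at hderiv
      exact hunit.mul_right_cancel hderiv

theorem parOf_zero : parOf 0 = {Par.mk' 0 fun i h => absurd h (Multiset.notMem_zero i)} := by
  refine Finset.eq_singleton_iff_unique_mem.2 ⟨mem_parOf.2 rfl, fun lam hlam => ?_⟩
  have hsum : lam.parts.sum = 0 := lam.sum_parts.trans (mem_parOf.1 hlam)
  exact Par.parts_injective (Multiset.eq_zero_of_forall_notMem fun r hr =>
    (lam.pos hr).ne' (Multiset.sum_eq_zero_iff.1 hsum r hr))

/-- A partition of `n + 1` with a marked part size `r = i + 1` is a partition of `n - i` to which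
`r` is adjoined. -/
theorem sum_parOf_succ_sum_parts {M : Type*} [AddCommMonoid M] (f : ℕ → Par → M) (n : ℕ) :
    ∑ lam ∈ parOf (n + 1), ∑ r ∈ lam.parts.toFinset, f r (lam.erase r) =
      ∑ p ∈ Finset.HasAntidiagonal.antidiagonal n, ∑ nu ∈ parOf p.2, f (p.1 + 1) nu := by
  rw [Finset.sum_sigma', Finset.sum_sigma']
  refine Finset.sum_bij' (fun x _ => ⟨(x.2 - 1, n + 1 - x.2), x.1.erase x.2⟩)
    (fun x _ => ⟨x.2.cons (x.1.1 + 1) (Nat.succ_pos _), x.1.1 + 1⟩) ?_ ?_ ?_ ?_ ?_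
  · rintro ⟨lam, r⟩ h
    simp only [Finset.mem_sigma, mem_parOf, Multiset.mem_toFinset,
      Finset.HasAntidiagonal.mem_antidiagonal] at h ⊢
    have hsize := Par.size_erase h.2
    have hr := lam.pos h.2
    omega
  · rintro ⟨⟨i, j⟩, nu⟩ h
    simp only [Finset.mem_sigma, mem_parOf, Multiset.mem_toFinset,
      Finset.HasAntidiagonal.mem_antidiagonal, Par.size_cons, Par.parts_cons] at h ⊢
    exact ⟨by omega, Multiset.mem_cons_self _ _⟩
  · rintro ⟨lam, r⟩ h
    simp only [Finset.mem_sigma, Multiset.mem_toFinset] at h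
    simp only [Nat.sub_add_cancel (lam.pos h.2), Par.cons_erase h.2]
  · rintro ⟨⟨i, j⟩, nu⟩ h
    simp only [Finset.mem_sigma, Finset.HasAntidiagonal.mem_antidiagonal] at h
    have hj : n - i = j := by omega
    simp only [Par.erase_cons, Nat.add_sub_cancel, Nat.add_sub_add_right, hj]
  · rintro ⟨lam, r⟩ h
    simp only [Finset.mem_sigma, Multiset.mem_toFinset] at h
    simp only [Nat.sub_add_cancel (lam.pos h.2)]

section ExpCoeff

variable (K : Type*) {R : Type*} [Field K] [CommRing R] [Algebra K R]

/-- `∑_{|λ| = n} c_λ / z_λ`, the value of `h_n` when the power sums have the values `c_r`. -/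
def expCoeff (c : ℕ → R) (n : ℕ) : R := ∑ lam ∈ parOf n, ((lam.z : K)⁻¹) • parProd c lam

theorem expCoeff_congr {c d : ℕ → R} (h : ∀ r, 0 < r → c r = d r) : expCoeff K c = expCoeff K d :=
  funext fun n => Finset.sum_congr rfl fun lam _ => by rw [parProd_congr h]

theorem expCoeff_zero (c : ℕ → R) : expCoeff K c 0 = 1 := by
  rw [expCoeff, parOf_zero, Finset.sum_singleton, parProd, Par.z, Par.parts_mk']
  simp only [Multiset.toFinset_zero, Finset.prod_empty, Nat.cast_one, inv_one, Multiset.map_zero,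
    Multiset.prod_zero, one_smul]

variable [CharZero K]

theorem inv_z_smul_parProd_mul_size (c : ℕ → R) (lam : Par) :
    ((lam.z : K)⁻¹) • parProd c lam * lam.size =
      ∑ r ∈ lam.parts.toFinset, (((lam.erase r).z : K)⁻¹) • (c r * parProd c (lam.erase r)) := by
  rw [← lam.sum_mul_mult, Nat.cast_sum, Finset.mul_sum]
  refine Finset.sum_congr rfl fun r hr => ?_
  have hmem := Multiset.mem_toFinset.1 hr
  have hne : ((r * lam.mult r : ℕ) : K) ≠ 0 :=
    Nat.cast_ne_zero.2 (Nat.mul_pos (lam.pos hmem) (Par.mult_pos hmem)).ne'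
  rw [← parProd_eq_mul_erase c hmem, Par.z_erase hmem, ← map_natCast (algebraMap K R),
    mul_comm, ← Algebra.smul_def, smul_smul, Nat.cast_mul _ (Par.z _), mul_inv,
    mul_inv_cancel_left₀ hne]

theorem isNewton_expCoeff (c : ℕ → R) : IsNewton c (PowerSeries.mk (expCoeff K c)) := by
  refine isNewton_mk_iff.2 ⟨expCoeff_zero K c, fun n => ?_⟩
  calc expCoeff K c (n + 1) * (n + 1)
      = ∑ lam ∈ parOf (n + 1), ((lam.z : K)⁻¹) • parProd c lam * lam.size := by
        rw [expCoeff, Finset.sum_mul]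
        refine Finset.sum_congr rfl fun lam hlam => ?_
        rw [mem_parOf.1 hlam, Nat.cast_succ]
    _ = ∑ p ∈ Finset.HasAntidiagonal.antidiagonal n, ∑ nu ∈ parOf p.2,
          ((nu.z : K)⁻¹) • (c (p.1 + 1) * parProd c nu) := by
        simp only [inv_z_smul_parProd_mul_size]
        exact sum_parOf_succ_sum_parts (fun r nu => ((nu.z : K)⁻¹) • (c r * parProd c nu)) n
    _ = ∑ p ∈ Finset.HasAntidiagonal.antidiagonal n, c (p.1 + 1) * expCoeff K c p.2 := by
        simp only [expCoeff, Finset.mul_sum, mul_smul_comm]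

theorem IsNewton.eq_mk_expCoeff {c : ℕ → R} {F : PowerSeries R} (h : IsNewton c F) :
    F = PowerSeries.mk (expCoeff K c) :=
  h.unique K (isNewton_expCoeff K c)

theorem expCoeff_sum {ι : Type*} [DecidableEq ι] (s : Finset ι) (c : ι → ℕ → R) (n : ℕ) :
    expCoeff K (fun r => ∑ i ∈ s, c i r) n =
      ∑ l ∈ s.finsuppAntidiag n, ∏ i ∈ s, expCoeff K (c i) (l i) := by
  have hprod := (IsNewton.prod s fun i _ => isNewton_expCoeff K (c i)).eq_mk_expCoeff K
  have hcoeff := congrArg (PowerSeries.coeff n) hprod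
  rw [PowerSeries.coeff_mk, PowerSeries.coeff_prod] at hcoeff
  simpa only [PowerSeries.coeff_mk] using hcoeff.symm

end ExpCoeff

/-! ### Power sums and complete symmetric functions -/

section RenameExpand

variable {σ τ : Type*} {R : Type*}

theorem continuous_rename [CommSemiring R] [TopologicalSpace R] (e : σ ↪ τ) :
    Continuous (MvPowerSeries.rename (R := R) e) := by
  refine continuous_pi fun d => ?_
  change Continuous fun f => MvPowerSeries.coeff d (MvPowerSeries.rename e f)
  by_cases hd : d ∈ Set.range (Finsupp.mapDomain e)
  · obtain ⟨x, rfl⟩ := hd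
    simp only [← Finsupp.embDomain_eq_mapDomain, MvPowerSeries.coeff_embDomain_rename]
    exact MvPowerSeries.WithPiTopology.continuous_coeff R x
  · simp only [MvPowerSeries.coeff_rename_eq_zero _ _ hd]
    exact continuous_const

theorem exists_eq_smul_of_forall_dvd {l : ℕ} {d : σ →₀ ℕ} (h : ∀ i, l ∣ d i) :
    ∃ x : σ →₀ ℕ, d = l • x :=
  ⟨d.mapRange (· / l) (Nat.zero_div l), Finsupp.ext fun i => (Nat.mul_div_cancel' (h i)).symm⟩

theorem continuous_expand [CommRing R] [TopologicalSpace R] {l : ℕ} (hl : l ≠ 0) :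
    Continuous (MvPowerSeries.expand (σ := σ) (R := R) l hl) := by
  refine continuous_pi fun d => ?_
  change Continuous fun f => MvPowerSeries.coeff d (MvPowerSeries.expand l hl f)
  by_cases hd : ∀ i, l ∣ d i
  · obtain ⟨x, rfl⟩ := exists_eq_smul_of_forall_dvd hd
    simp only [MvPowerSeries.coeff_expand_smul]
    exact MvPowerSeries.WithPiTopology.continuous_coeff R x
  · obtain ⟨i, hi⟩ := not_forall.1 hd
    simp only [MvPowerSeries.coeff_expand_of_not_dvd _ _ _ hi]
    exact continuous_const

theorem expand_rename [CommRing R] (e : σ ↪ τ) {l : ℕ} (hl : l ≠ 0) (f : MvPowerSeries σ R) :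
    MvPowerSeries.expand l hl (MvPowerSeries.rename e f) =
      MvPowerSeries.rename e (MvPowerSeries.expand l hl f) := by
  have hX : MvPowerSeries.HasSubst (MvPowerSeries.X ∘ e : σ → MvPowerSeries τ R) :=
    MvPowerSeries.HasSubst.X_comp e
  rw [MvPowerSeries.rename_eq_subst, MvPowerSeries.expand_subst l hl hX,
    MvPowerSeries.rename_eq_subst]
  change _ = MvPowerSeries.subst _ (MvPowerSeries.substAlgHom (MvPowerSeries.HasSubst.X_pow hl) f)
  rw [MvPowerSeries.substAlgHom_apply,
    MvPowerSeries.subst_comp_subst_apply (MvPowerSeries.HasSubst.X_pow hl) hX]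
  congr 1
  funext i
  simp only [Function.comp_apply, MvPowerSeries.expand_X, MvPowerSeries.subst_pow hX,
    MvPowerSeries.subst_X hX]

end RenameExpand

section PowerSum

variable {σ τ ι : Type*}

theorem hasSum_X_pow (e : ι ↪ σ) {r : ℕ} (hr : 0 < r) :
    HasSum (fun i => (MvPowerSeries.X (e i) : MvPowerSeries σ ℂ) ^ r)
      (powerSum (fun i => MvPowerSeries.X (e i)) r) := by
  classical
  refine Summable.hasSum (MvPowerSeries.WithPiTopology.summable_iff_summable_coeff.2 fun d => ?_)
  refine summable_of_hasFiniteSupport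
    ((d.support.finite_toSet.preimage e.injective.injOn).subset fun i hi => ?_)
  rw [Function.mem_support, MvPowerSeries.coeff_X_pow, ite_ne_right_iff] at hi
  rw [Set.mem_preimage, hi.1, Finset.mem_coe, Finsupp.mem_support_iff, Finsupp.single_eq_same]
  exact hr.ne'

theorem rename_powerSum (e : σ ↪ τ) (f : ι ↪ σ) {r : ℕ} (hr : 0 < r) :
    MvPowerSeries.rename e (powerSum (fun i => MvPowerSeries.X (R := ℂ) (f i)) r) =
      powerSum (fun i => MvPowerSeries.X (e (f i))) r := by
  refine ((hasSum_X_pow f hr).map _ (continuous_rename e)).unique ?_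
  simpa only [Function.comp_def, map_pow, MvPowerSeries.rename_X, Function.Embedding.trans_apply]
    using hasSum_X_pow (f.trans e) hr

theorem expand_powerSum (f : ι ↪ σ) {l r : ℕ} (hl : l ≠ 0) (hr : 0 < r) :
    MvPowerSeries.expand l hl (powerSum (fun i => MvPowerSeries.X (R := ℂ) (f i)) r) =
      powerSum (fun i => MvPowerSeries.X (f i)) (l * r) := by
  refine ((hasSum_X_pow f hr).map _ (continuous_expand hl)).unique ?_
  simpa only [Function.comp_def, map_pow, MvPowerSeries.expand_X, pow_mul] using
    hasSum_X_pow f (Nat.mul_pos (Nat.pos_of_ne_zero hl) hr)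

end PowerSum

/-- The power sum `p_r` in the variables `x₀, x₁, …`. -/
abbrev pX (r : ℕ) : MvPowerSeries ℕ ℂ := powerSum (fun i : ℕ => MvPowerSeries.X i) r

theorem coe_pSym (lam : Par) : (pSym lam : MvPowerSeries ℕ ℂ) = parProd pX lam := rfl

theorem coeff_pX_mul {r : ℕ} (hr : 0 < r) (F : MvPowerSeries ℕ ℂ) (b : ℕ →₀ ℕ) :
    MvPowerSeries.coeff b (pX r * F) = ∑ k ∈ b.support,
      if r ≤ b k then MvPowerSeries.coeff (b - Finsupp.single k r) F else 0 := by
  have hsum := (hasSum_X_pow (Function.Embedding.refl ℕ) hr).mul_right F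
  rw [MvPowerSeries.WithPiTopology.hasSum_iff_hasSum_coeff] at hsum
  refine (hsum b).unique ?_
  simp only [Function.Embedding.refl_apply, MvPowerSeries.X_pow_eq,
    MvPowerSeries.coeff_monomial_mul, one_mul, Finsupp.single_le_iff]
  refine hasSum_sum_of_ne_finset_zero fun k hk => if_neg ?_
  rw [Finsupp.notMem_support_iff.1 hk]
  omega

theorem coeff_pX_succ_mul_hSym (i j : ℕ) (b : ℕ →₀ ℕ) :
    MvPowerSeries.coeff b (pX (i + 1) * (hSym j : MvPowerSeries ℕ ℂ)) =
      if b.degree = i + j + 1 then ((b.support.filter (i < b ·)).card : ℂ) else 0 := by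
  have hterm : ∀ k ∈ b.support, (if i + 1 ≤ b k then
      MvPowerSeries.coeff (b - Finsupp.single k (i + 1)) (hSym j : MvPowerSeries ℕ ℂ) else 0) =
      if b.degree = i + j + 1 then (if i < b k then 1 else 0) else 0 := fun k _ => by
    rw [← ite_and]
    by_cases hk : i + 1 ≤ b k
    · have hdeg := congrArg Finsupp.degree (tsub_add_cancel_of_le (Finsupp.single_le_iff.2 hk))
      rw [map_add, Finsupp.degree_single] at hdeg
      rw [if_pos hk, hSym, coeff_series]
      exact if_congr (by omega) rfl rfl
    · rw [if_neg hk, if_neg fun h => hk h.2]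
  rw [coeff_pX_mul (Nat.succ_pos i), Finset.sum_congr rfl hterm]
  split_ifs
  · exact Finset.sum_boole _ _
  · exact Finset.sum_const_zero

theorem sum_antidiagonal_card_filter_lt {n : ℕ} {b : ℕ →₀ ℕ} (hb : b.degree = n + 1) :
    ∑ p ∈ Finset.HasAntidiagonal.antidiagonal n, (b.support.filter (p.1 < b ·)).card = n + 1 := by
  have hfilter : ∀ k, (Finset.range (n + 1)).filter (· < b k) = Finset.range (b k) := fun k => by
    have hle : b k ≤ n + 1 := hb ▸ Finsupp.le_degree k b
    ext i
    rw [Finset.mem_filter, Finset.mem_range, Finset.mem_range]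
    omega
  rw [Finset.Nat.sum_antidiagonal_eq_sum_range_succ_mk, ← hb, Finsupp.degree_apply]
  simp only [Finset.card_filter]
  rw [Finset.sum_comm]
  simp only [← Finset.card_filter, Nat.succ_eq_add_one, hfilter, Finset.card_range]

theorem isNewton_hSym : IsNewton pX (PowerSeries.mk fun n => (hSym n : MvPowerSeries ℕ ℂ)) := by
  refine isNewton_mk_iff.2 ⟨?_, fun n => ?_⟩
  · classical
    ext b
    rw [hSym, coeff_series, MvPowerSeries.coeff_one]
    exact if_congr (Finsupp.degree_eq_zero_iff b) rfl rfl
  · ext b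
    have hC : (n : MvPowerSeries ℕ ℂ) + 1 = MvPowerSeries.C ((n : ℂ) + 1) := by
      rw [map_add, map_natCast, map_one]
    have hterm : ∀ p ∈ Finset.HasAntidiagonal.antidiagonal n,
        MvPowerSeries.coeff b (pX (p.1 + 1) * (hSym p.2 : MvPowerSeries ℕ ℂ)) =
          if b.degree = n + 1 then ((b.support.filter (p.1 < b ·)).card : ℂ) else 0 := by
      intro p hp
      rw [coeff_pX_succ_mul_hSym, Finset.HasAntidiagonal.mem_antidiagonal.1 hp]
    rw [hC, MvPowerSeries.coeff_mul_C, map_sum, Finset.sum_congr rfl hterm, hSym, coeff_series]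
    split_ifs with hb
    · rw [one_mul, ← Nat.cast_sum, sum_antidiagonal_card_filter_lt hb, Nat.cast_succ]
    · rw [zero_mul, Finset.sum_const_zero]

theorem coe_hSym (n : ℕ) : (hSym n : MvPowerSeries ℕ ℂ) = expCoeff ℂ pX n := by
  have hcoeff := congrArg (PowerSeries.coeff n) (isNewton_hSym.eq_mk_expCoeff ℂ)
  rwa [PowerSeries.coeff_mk, PowerSeries.coeff_mk] at hcoeff

theorem hSym_eq_sum_pSym (n : ℕ) :
    hSym n = ∑ lam ∈ parOf n, ((lam.z : ℂ)⁻¹) • pSym lam := by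
  refine Subtype.ext ?_
  rw [coe_hSym, expCoeff, AddSubmonoidClass.coe_finsetSum]
  rfl

theorem plethysm_pSym {σ : Type*} (A : MvPowerSeries σ ℂ) (lam : Par) :
    plethysm A (pSym lam) = parProd (fun r => adams r A) lam := by
  change pBasis.constr ℂ (fun nu : Par => parProd (fun r => adams r A) nu) (pSym lam) = _
  rw [← pBasis_apply, Module.Basis.constr_basis]

theorem plethysm_hSym {σ : Type*} (A : MvPowerSeries σ ℂ) (n : ℕ) :
    plethysm A (hSym n) = expCoeff ℂ (fun r => adams r A) n := by
  simp only [hSym_eq_sum_pSym, map_sum, map_smul, plethysm_pSym, expCoeff]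

/-! ### The series `Ω(Y; ζ)` -/

section HSeries

variable {σ ι : Type*}

/-- `∑_b ζ^{|b|} y^b = ∑_n ζ^n h_n(y)`, the expansion of `Ω(y; ζ) = ∏_i (1 - ζ y_i)⁻¹`. -/
def hSeries (ζ : ℂ) : MvPowerSeries σ ℂ := series fun b => ζ ^ b.degree

open Classical in
/-- The part of `hSeries ζ` in the variables from `s`: the expansion of the partial product
`∏_{i ∈ s} (1 - ζ y_i)⁻¹`. -/
def hSeriesOn (ζ : ℂ) (s : Finset σ) : MvPowerSeries σ ℂ :=
  series fun b => if b.support ⊆ s then ζ ^ b.degree else 0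

theorem hSeriesOn_empty (ζ : ℂ) : hSeriesOn ζ (∅ : Finset σ) = 1 := by
  classical
  ext b
  rw [hSeriesOn, coeff_series, MvPowerSeries.coeff_one]
  simp only [Finset.subset_empty, Finsupp.support_eq_empty]
  split_ifs with hb
  · rw [hb, map_zero, pow_zero]
  · rfl

theorem support_add_single_subset_insert [DecidableEq σ] {s : Finset σ} {i : σ} {a : σ →₀ ℕ} :
    (a + Finsupp.single i 1).support ⊆ insert i s ↔ a.support ⊆ insert i s := by
  refine ⟨fun h j hj => h ?_, fun h => Finsupp.support_add.trans
    (Finset.union_subset h (Finsupp.support_single_subset.trans ?_))⟩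
  · rw [Finsupp.mem_support_iff] at hj ⊢
    exact fun h0 => hj (Nat.eq_zero_of_add_eq_zero_right h0)
  · exact Finset.singleton_subset_iff.2 (Finset.mem_insert_self i s)

theorem one_sub_mul_hSeriesOn_insert [DecidableEq σ] (ζ : ℂ) {s : Finset σ} {i : σ} (hi : i ∉ s) :
    (1 - MvPowerSeries.C ζ * MvPowerSeries.X i) * hSeriesOn ζ (insert i s) = hSeriesOn ζ s := by
  ext b
  rw [sub_mul, one_mul, mul_assoc, map_sub, MvPowerSeries.coeff_C_mul, MvPowerSeries.X,
    MvPowerSeries.coeff_monomial_mul, one_mul]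
  simp only [hSeriesOn, coeff_series, Finsupp.single_le_iff]
  by_cases hb : 1 ≤ b i
  · obtain ⟨a, rfl⟩ : ∃ a, b = a + Finsupp.single i 1 :=
      ⟨_, (tsub_add_cancel_of_le (Finsupp.single_le_iff.2 hb)).symm⟩
    have hns : ¬ (a + Finsupp.single i 1).support ⊆ s := fun h =>
      hi (h (Finsupp.mem_support_iff.2 (Nat.one_le_iff_ne_zero.1 hb)))
    rw [if_pos hb, if_neg hns, add_tsub_cancel_right, map_add, Finsupp.degree_single, pow_succ]
    simp only [support_add_single_subset_insert]
    split_ifs <;> ring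
  · have hib : i ∉ b.support := fun h => hb (Nat.one_le_iff_ne_zero.2 (Finsupp.mem_support_iff.1 h))
    simp only [if_neg hb, Finset.subset_insert_iff_of_notMem hib, mul_zero, sub_zero]
    congr

theorem constantCoeff_one_sub_C_mul_X (ζ : ℂ) (i : σ) :
    MvPowerSeries.constantCoeff (1 - MvPowerSeries.C ζ * MvPowerSeries.X i) = (1 : ℂ) := by
  rw [map_sub, map_one, map_mul, MvPowerSeries.constantCoeff_X, mul_zero, sub_zero]

theorem one_sub_C_mul_X_mul_inv (ζ : ℂ) (i : σ) :
    (1 - MvPowerSeries.C ζ * MvPowerSeries.X i) *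
      (1 - MvPowerSeries.C ζ * MvPowerSeries.X i : MvPowerSeries σ ℂ)⁻¹ = 1 :=
  MvPowerSeries.mul_inv_cancel _ (by rw [constantCoeff_one_sub_C_mul_X]; exact one_ne_zero)

theorem prod_inv_one_sub_eq_hSeriesOn (ζ : ℂ) (s : Finset σ) :
    ∏ i ∈ s, (1 - MvPowerSeries.C ζ * MvPowerSeries.X i)⁻¹ = hSeriesOn ζ s := by
  classical
  induction s using Finset.induction with
  | empty => rw [Finset.prod_empty, hSeriesOn_empty]
  | insert i s hi ih =>
    rw [Finset.prod_insert hi, ih, ← one_sub_mul_hSeriesOn_insert ζ hi, ← mul_assoc,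
      mul_comm _ (1 - _), one_sub_C_mul_X_mul_inv, one_mul]

theorem hasProd_hSeries (ζ : ℂ) :
    HasProd (fun i : σ => (1 - MvPowerSeries.C ζ * MvPowerSeries.X i)⁻¹) (hSeries ζ) := by
  rw [HasProd, MvPowerSeries.WithPiTopology.tendsto_iff_coeff_tendsto]
  intro d
  refine tendsto_const_nhds.congr' ?_
  rw [SummationFilter.unconditional_filter]
  filter_upwards [Filter.eventually_ge_atTop d.support] with s hs
  rw [prod_inv_one_sub_eq_hSeriesOn, hSeriesOn, hSeries, coeff_series, coeff_series, if_pos hs]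

theorem omegaProd_X (e : ι ↪ σ) (ζ : ℂ) :
    omegaProd (fun i => MvPowerSeries.X (e i)) ζ = MvPowerSeries.rename e (hSeries ζ) := by
  rw [omegaProd, ← ((hasProd_hSeries ζ).map _ (continuous_rename e)).tprod_eq]
  refine tprod_congr fun i => Eq.symm ?_
  have hrename : (1 - MvPowerSeries.C ζ * MvPowerSeries.X (e i) : MvPowerSeries σ ℂ) =
      MvPowerSeries.rename e (1 - MvPowerSeries.C ζ * MvPowerSeries.X i) := by
    simp only [map_sub, map_one, map_mul, MvPowerSeries.rename_C, MvPowerSeries.rename_X]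
  rw [Function.comp_apply, MvPowerSeries.eq_inv_iff_mul_eq_one
    (by rw [constantCoeff_one_sub_C_mul_X]; exact one_ne_zero), hrename, ← map_mul, mul_comm,
    one_sub_C_mul_X_mul_inv, map_one]

end HSeries

/-! ### Series in two sets of variables -/

/-- A series in `x`, as a series in `x` and `y`. -/
abbrev inX {σ : Type*} : MvPowerSeries σ ℂ →ₐ[ℂ] MvPowerSeries (σ ⊕ ℕ) ℂ :=
  MvPowerSeries.rename (Function.Embedding.inl : σ ↪ σ ⊕ ℕ)

/-- A series in `y`, as a series in `x` and `y`. -/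
abbrev inY {σ : Type*} : MvPowerSeries ℕ ℂ →ₐ[ℂ] MvPowerSeries (σ ⊕ ℕ) ℂ :=
  MvPowerSeries.rename (Function.Embedding.inr : ℕ ↪ σ ⊕ ℕ)

theorem exists_embDomain_eq_of_coeff_rename_ne_zero {σ τ R : Type*} [CommSemiring R] {e : σ ↪ τ}
    {f : MvPowerSeries σ R} {d : τ →₀ ℕ}
    (h : MvPowerSeries.coeff d (MvPowerSeries.rename e f) ≠ 0) :
    ∃ a : σ →₀ ℕ, a.embDomain e = d := by
  by_contra hd
  refine h (MvPowerSeries.coeff_rename_eq_zero _ _ ?_)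
  rintro ⟨a, rfl⟩
  exact hd ⟨a, Finsupp.embDomain_eq_mapDomain e a⟩

theorem sumElim_eq_add_embDomain {σ τ : Type*} (a : σ →₀ ℕ) (b : τ →₀ ℕ) :
    a.sumElim b = a.embDomain Function.Embedding.inl + b.embDomain Function.Embedding.inr := by
  rw [Finsupp.sumElim_eq_add, Finsupp.embDomain_eq_mapDomain, Finsupp.embDomain_eq_mapDomain]
  rfl

theorem coeff_sumElim_rename_inl_mul_rename_inr {σ τ R : Type*} [CommSemiring R] (a : σ →₀ ℕ)
    (b : τ →₀ ℕ) (f : MvPowerSeries σ R) (g : MvPowerSeries τ R) :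
    MvPowerSeries.coeff (a.sumElim b)
      (MvPowerSeries.rename (Function.Embedding.inl : σ ↪ σ ⊕ τ) f *
        MvPowerSeries.rename (Function.Embedding.inr : τ ↪ σ ⊕ τ) g) =
      MvPowerSeries.coeff a f * MvPowerSeries.coeff b g := by
  classical
  rw [MvPowerSeries.coeff_mul, Finset.sum_eq_single (a.embDomain Function.Embedding.inl,
    b.embDomain Function.Embedding.inr), MvPowerSeries.coeff_embDomain_rename,
    MvPowerSeries.coeff_embDomain_rename]
  · rintro ⟨u, v⟩ huv hne
    by_contra hc
    obtain ⟨a', rfl⟩ := exists_embDomain_eq_of_coeff_rename_ne_zero (left_ne_zero_of_mul hc)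
    obtain ⟨b', rfl⟩ := exists_embDomain_eq_of_coeff_rename_ne_zero (right_ne_zero_of_mul hc)
    have hsum : a'.sumElim b' = a.sumElim b := by
      rw [← Finset.HasAntidiagonal.mem_antidiagonal.1 huv, sumElim_eq_add_embDomain]
    obtain ⟨rfl, rfl⟩ := Prod.ext_iff.1 (Finsupp.sumFinsuppEquivProdFinsupp.symm.injective
      (a₁ := (a', b')) (a₂ := (a, b)) hsum)
    exact hne rfl
  · intro h
    exact absurd (Finset.HasAntidiagonal.mem_antidiagonal.2 (sumElim_eq_add_embDomain a b).symm) h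

/-! ### The expansion of the kernel -/

section Kernel

variable {m : ℕ}

/-- The embedding of the variable set `X_ζ` into the set of all `x`-variables. -/
def varEmb (ζ : rootsOfUnity m ℂ) : ℕ ↪ rootsOfUnity m ℂ × ℕ := Function.Embedding.sectR ζ ℕ

/-- `p_r` of the part `(1/m) X_ζ Ω(Y; ζ)` of the kernel alphabet. -/
def kernelPowerSum (ζ : rootsOfUnity m ℂ) (r : ℕ) :
    MvPowerSeries ((rootsOfUnity m ℂ × ℕ) ⊕ ℕ) ℂ :=
  (m : ℂ)⁻¹ • (inX (powerSum (fun i => MvPowerSeries.X (varEmb ζ i)) r) *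
    inY (adams r (hSeries ((ζ : ℂˣ) : ℂ))))

theorem adams_of_pos {σ : Type*} {r : ℕ} (hr : 0 < r) (A : MvPowerSeries σ ℂ) :
    adams r A = MvPowerSeries.expand r hr.ne' A :=
  dif_neg hr.ne'

theorem inv_z_smul_parProd_kernelPowerSum (ζ : rootsOfUnity m ℂ) (lam : Par) :
    (lam.z : ℂ)⁻¹ • parProd (kernelPowerSum ζ) lam =
      ((lam.z * m ^ lam.length : ℕ) : ℂ)⁻¹ •
        (inX (powerSumPar (fun i => MvPowerSeries.X (varEmb ζ i)) lam) *
          inY (parProd (fun l => adams l (hSeries ((ζ : ℂˣ) : ℂ))) lam)) := by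
  have hconst : parProd (fun _ => (m : ℂ)⁻¹) lam = ((m : ℂ)⁻¹) ^ lam.length := by
    rw [parProd, Multiset.map_const', Multiset.prod_replicate, Par.length]
  have hX := map_parProd (MonoidHomClass.toMonoidHom (inX (σ := rootsOfUnity m ℂ × ℕ)))
    (powerSum fun i => MvPowerSeries.X (varEmb ζ i)) lam
  have hY := map_parProd (MonoidHomClass.toMonoidHom (inY (σ := rootsOfUnity m ℂ × ℕ)))
    (fun l => adams l (hSeries ((ζ : ℂˣ) : ℂ))) lam
  have hcast : ((lam.z * m ^ lam.length : ℕ) : ℂ)⁻¹ =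
      (lam.z : ℂ)⁻¹ * ((m : ℂ)⁻¹) ^ lam.length := by
    rw [Nat.cast_mul, Nat.cast_pow, mul_inv, inv_pow]
  rw [hcast, ← hconst, mul_smul]
  unfold kernelPowerSum
  rw [parProd_smul, parProd_mul]
  exact congrArg _ (congrArg _ (congrArg₂ _ hX.symm hY.symm))

variable [NeZero m]

/-- The finite set of all `ρ ∈ Φ` with `|ρ| = n`. -/
def phiOf (m n : ℕ) [NeZero m] : Finset (Phi m) :=
  (@Set.toFinite _ {ρ : Phi m | ρ.size = n} (finite_phi n)).toFinset

theorem mem_phiOf {n : ℕ} {ρ : Phi m} : ρ ∈ phiOf m n ↔ ρ.size = n :=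
  Set.Finite.mem_toFinset _

theorem sum_finsuppAntidiag_piFinset_parOf [DecidableEq (rootsOfUnity m ℂ)] {M : Type*}
    [AddCommMonoid M] (n : ℕ) (f : Phi m → M) :
    ∑ l ∈ Finset.univ.finsuppAntidiag n, ∑ ρ ∈ Fintype.piFinset fun ζ => parOf (l ζ), f ρ =
      ∑ ρ ∈ phiOf m n, f ρ := by
  rw [Finset.sum_sigma']
  refine Finset.sum_bij' (fun x _ => x.2)
    (fun ρ _ => ⟨Finsupp.equivFunOnFinite.symm fun ζ => (ρ ζ).size, ρ⟩) ?_ ?_ ?_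
    (fun _ _ => rfl) (fun _ _ => rfl)
  · rintro ⟨l, ρ⟩ h
    simp only [Finset.mem_sigma, Finset.mem_finsuppAntidiag, Fintype.mem_piFinset, mem_parOf] at h
    rw [mem_phiOf, Phi.size, Finset.sum_congr rfl fun ζ _ => h.2 ζ, h.1.1]
  · intro ρ h
    simp only [Finset.mem_sigma, Finset.mem_finsuppAntidiag, Fintype.mem_piFinset, mem_parOf]
    exact ⟨⟨mem_phiOf.1 h, Finset.subset_univ _⟩, fun _ => rfl⟩
  · rintro ⟨l, ρ⟩ h
    simp only [Finset.mem_sigma, Fintype.mem_piFinset, mem_parOf] at h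
    obtain rfl : Finsupp.equivFunOnFinite.symm (fun ζ => (ρ ζ).size) = l := Finsupp.ext h.2
    rfl

/-- `∏_ζ ∏_{l ∈ ρ(ζ)} Ω(Y^l; ζ)`, the coefficient of `P_ρ / Z_ρ` in the kernel. -/
def cauchySeries (ρ : Phi m) : MvPowerSeries ℕ ℂ :=
  ∏ ζ : rootsOfUnity m ℂ, parProd (fun l => adams l (hSeries ((ζ : ℂˣ) : ℂ))) (ρ ζ)

theorem adams_kernelAlphabet {r : ℕ} (hr : 0 < r) :
    adams r (kernelAlphabet m) = ∑ ζ : rootsOfUnity m ℂ, kernelPowerSum ζ r := by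
  have halphabet : kernelAlphabet m = ∑ ζ : rootsOfUnity m ℂ, (m : ℂ)⁻¹ •
      (inX (powerSum (fun i => MvPowerSeries.X (varEmb ζ i)) 1) *
        inY (hSeries ((ζ : ℂˣ) : ℂ))) := by
    rw [kernelAlphabet, Finset.smul_sum, one_div]
    refine Finset.sum_congr rfl fun ζ _ => ?_
    rw [inX, inY, rename_powerSum _ _ one_pos, ← omegaProd_X]
    simp only [powerSum, pow_one]
    rfl
  rw [halphabet, adams_of_pos hr, map_sum]
  refine Finset.sum_congr rfl fun ζ _ => ?_
  rw [map_smul, map_mul, expand_rename, expand_rename, expand_powerSum _ _ one_pos, mul_one,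
    kernelPowerSum, adams_of_pos hr]

theorem prod_inv_z_smul_parProd_kernelPowerSum (ρ : Phi m) :
    ∏ ζ : rootsOfUnity m ℂ, ((ρ ζ).z : ℂ)⁻¹ • parProd (kernelPowerSum ζ) (ρ ζ) =
      (ρ.Z : ℂ)⁻¹ • (inX (P ρ) * inY (cauchySeries ρ)) := by
  simp only [inv_z_smul_parProd_kernelPowerSum]
  rw [Finset.prod_smul, Finset.prod_mul_distrib, P, cauchySeries, map_prod, map_prod, Phi.Z,
    Nat.cast_prod, Finset.prod_inv_distrib]
  rfl

theorem plethysm_kernelAlphabet (n : ℕ) :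
    plethysm (kernelAlphabet m) (hSym n) =
      ∑ ρ ∈ phiOf m n, (ρ.Z : ℂ)⁻¹ • (inX (P ρ) * inY (cauchySeries ρ)) := by
  classical
  rw [plethysm_hSym, expCoeff_congr ℂ fun r hr => adams_kernelAlphabet hr, expCoeff_sum]
  simp only [expCoeff, Finset.prod_univ_sum, prod_inv_z_smul_parProd_kernelPowerSum]
  exact sum_finsuppAntidiag_piFinset_parOf n _

end Kernel

section Homogeneous

variable {σ ι R : Type*} [CommSemiring R]

theorem isHomogeneous_one : (1 : MvPowerSeries σ R).IsHomogeneous 0 := by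
  classical
  intro d hd
  rw [MvPowerSeries.coeff_one, ite_ne_right_iff] at hd
  rw [hd.1, map_zero]

theorem isHomogeneous_multiset_prod (s : Multiset ι) {f : ι → MvPowerSeries σ R} {k : ι → ℕ}
    (h : ∀ i ∈ s, (f i).IsHomogeneous (k i)) :
    (s.map f).prod.IsHomogeneous (s.map k).sum := by
  induction s using Multiset.induction with
  | empty =>
    rw [Multiset.map_zero, Multiset.prod_zero, Multiset.map_zero, Multiset.sum_zero]
    exact isHomogeneous_one
  | cons i s ih =>
    rw [Multiset.forall_mem_cons] at h
    rw [Multiset.map_cons, Multiset.prod_cons, Multiset.map_cons, Multiset.sum_cons]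
    exact MvPowerSeries.IsHomogeneous.mul h.1 (ih h.2)

theorem isHomogeneous_parProd {c : ℕ → MvPowerSeries σ R}
    (h : ∀ r, 0 < r → (c r).IsHomogeneous r) (lam : Par) :
    (parProd c lam).IsHomogeneous lam.size := by
  have hsum : (lam.parts.map fun r => r).sum = lam.size := by
    rw [Multiset.map_id', lam.sum_parts]
  rw [← hsum]
  exact @isHomogeneous_multiset_prod σ ℕ R _ lam.parts c (fun r => r) fun r hr => h r (lam.pos hr)

theorem isHomogeneous_powerSum (e : ι ↪ σ) {r : ℕ} (hr : 0 < r) :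
    (powerSum (fun i => MvPowerSeries.X (R := ℂ) (e i)) r).IsHomogeneous r := by
  classical
  intro a ha
  by_contra hne
  have hsum := MvPowerSeries.WithPiTopology.hasSum_iff_hasSum_coeff.1 (hasSum_X_pow e hr) a
  refine ha (hsum.unique ?_)
  refine hasSum_zero.congr_fun fun i => ?_
  rw [MvPowerSeries.coeff_X_pow, if_neg]
  rintro rfl
  exact hne (by rw [Finsupp.weight_single, Pi.one_apply, smul_eq_mul, mul_one])

end Homogeneous

/-! ### The coefficients of the kernel -/

section KernelCoeff

variable {m : ℕ} [NeZero m]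

theorem isHomogeneous_P (ρ : Phi m) : (P ρ).IsHomogeneous ρ.size :=
  isHomogeneous_multiset_prod Finset.univ.val fun ζ _ =>
    isHomogeneous_parProd (fun _ hr => isHomogeneous_powerSum (varEmb ζ) hr) (ρ ζ)

theorem exists_eq_sumElim {σ τ : Type*} (c : σ ⊕ τ →₀ ℕ) :
    ∃ (a : σ →₀ ℕ) (b : τ →₀ ℕ), c = a.sumElim b :=
  ⟨_, _, (Finsupp.sumFinsuppEquivProdFinsupp.symm_apply_apply c).symm⟩

theorem coeff_plethysm_kernelAlphabet (n : ℕ) (a : rootsOfUnity m ℂ × ℕ →₀ ℕ) (b : ℕ →₀ ℕ) :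
    MvPowerSeries.coeff (a.sumElim b) (plethysm (kernelAlphabet m) (hSym n)) =
      ∑ ρ ∈ phiOf m n, (ρ.Z : ℂ)⁻¹ *
        (MvPowerSeries.coeff a (P ρ) * MvPowerSeries.coeff b (cauchySeries ρ)) := by
  rw [plethysm_kernelAlphabet, map_sum]
  refine Finset.sum_congr rfl fun ρ _ => ?_
  rw [map_smul, inX, inY, coeff_sumElim_rename_inl_mul_rename_inr, smul_eq_mul]

theorem hasSum_coeff_kernel (a : rootsOfUnity m ℂ × ℕ →₀ ℕ) (b : ℕ →₀ ℕ) :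
    HasSum (fun n => MvPowerSeries.coeff (a.sumElim b) (plethysm (kernelAlphabet m) (hSym n)))
      (MvPowerSeries.coeff (a.sumElim b) (plethysm (kernelAlphabet m) (hSym a.degree))) := by
  refine hasSum_single _ fun n hn => ?_
  rw [coeff_plethysm_kernelAlphabet]
  refine Finset.sum_eq_zero fun ρ hρ => ?_
  have hdeg : a.degree ≠ ρ.size := mem_phiOf.1 hρ ▸ hn.symm
  rw [MvPowerSeries.IsHomogeneous.coeff_eq_zero (isHomogeneous_P ρ) hdeg, zero_mul, mul_zero]

theorem summable_kernel : Summable fun n => plethysm (kernelAlphabet m) (hSym n) := by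
  rw [MvPowerSeries.WithPiTopology.summable_iff_summable_coeff]
  intro d
  obtain ⟨a, b, rfl⟩ := exists_eq_sumElim d
  exact (hasSum_coeff_kernel a b).summable

theorem coeffX_kernel (a : rootsOfUnity m ℂ × ℕ →₀ ℕ) :
    coeffX a (plethysticExp (kernelAlphabet m)) = ∑ ρ ∈ phiOf m a.degree,
      ((ρ.Z : ℂ)⁻¹ * MvPowerSeries.coeff a (P ρ)) • cauchySeries ρ := by
  ext b
  have hsum := MvPowerSeries.WithPiTopology.hasSum_iff_hasSum_coeff.1
    (summable_kernel (m := m)).hasSum (a.sumElim b)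
  rw [coeffX, coeff_series, plethysticExp, hsum.unique (hasSum_coeff_kernel a b),
    coeff_plethysm_kernelAlphabet, map_sum]
  refine Finset.sum_congr rfl fun ρ _ => ?_
  rw [map_smul, smul_eq_mul, mul_assoc]

end KernelCoeff

/-! ### Homogeneous components -/

section Components

variable {σ R : Type*} [CommSemiring R]

theorem homogeneousComponent_one (d : ℕ) :
    MvPowerSeries.homogeneousComponent d (1 : MvPowerSeries σ R) = if d = 0 then 1 else 0 := by
  classical
  ext b
  rw [MvPowerSeries.coeff_homogeneousComponent, MvPowerSeries.coeff_one]
  by_cases hb : b = 0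
  · rw [hb, map_zero, if_pos rfl]
    by_cases hd : d = 0
    · rw [if_pos hd.symm, if_pos hd, MvPowerSeries.coeff_zero_one]
    · rw [if_neg (Ne.symm hd), if_neg hd, map_zero]
  · rw [if_neg hb, ite_self, apply_ite (MvPowerSeries.coeff b), MvPowerSeries.coeff_one, if_neg hb,
      map_zero, ite_self]

theorem homogeneousComponent_mul (F G : MvPowerSeries σ R) (d : ℕ) :
    MvPowerSeries.homogeneousComponent d (F * G) = ∑ p ∈ Finset.HasAntidiagonal.antidiagonal d,
      MvPowerSeries.homogeneousComponent p.1 F * MvPowerSeries.homogeneousComponent p.2 G := by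
  classical
  ext b
  rw [map_sum]
  simp only [MvPowerSeries.coeff_mul, MvPowerSeries.coeff_homogeneousComponent,
    ite_zero_mul_ite_zero]
  have hterm : ∀ y ∈ Finset.HasAntidiagonal.antidiagonal b,
      (∑ x ∈ Finset.HasAntidiagonal.antidiagonal d, if y.1.degree = x.1 ∧ y.2.degree = x.2 then
        MvPowerSeries.coeff y.1 F * MvPowerSeries.coeff y.2 G else 0) =
      if b.degree = d then MvPowerSeries.coeff y.1 F * MvPowerSeries.coeff y.2 G else 0 := by
    intro y hy
    have hdeg : b.degree = y.1.degree + y.2.degree := by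
      rw [← Finset.HasAntidiagonal.mem_antidiagonal.1 hy, map_add]
    have hpair (x : ℕ × ℕ) : y.1.degree = x.1 ∧ y.2.degree = x.2 ↔
        (y.1.degree, y.2.degree) = x := by rw [Prod.ext_iff]
    simp only [hpair, Finset.sum_ite_eq, Finset.HasAntidiagonal.mem_antidiagonal, hdeg]
  rw [Finset.sum_comm, Finset.sum_congr rfl hterm]
  split_ifs
  · rfl
  · exact Finset.sum_const_zero.symm

/-- The generating function of the homogeneous components of a series; it is what turns a product
of series into a product of power series satisfying Newton's identities. -/
def components : MvPowerSeries σ R →* PowerSeries (MvPowerSeries σ R) where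
  toFun F := PowerSeries.mk fun d => MvPowerSeries.homogeneousComponent d F
  map_one' := by
    ext1 d
    rw [PowerSeries.coeff_mk, homogeneousComponent_one, PowerSeries.coeff_one]
  map_mul' F G := by
    ext1 d
    rw [PowerSeries.coeff_mul, PowerSeries.coeff_mk, homogeneousComponent_mul]
    simp only [PowerSeries.coeff_mk]

theorem coeff_components (F : MvPowerSeries σ R) (d : ℕ) :
    PowerSeries.coeff d (components F) = MvPowerSeries.homogeneousComponent d F :=
  PowerSeries.coeff_mk d fun d => MvPowerSeries.homogeneousComponent d F

end Components

theorem components_expand {σ R : Type*} [CommRing R] {l : ℕ} (hl : l ≠ 0)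
    (F : MvPowerSeries σ R) : components (MvPowerSeries.expand l hl F) =
      PowerSeries.expand l hl
        (PowerSeries.map (RingHomClass.toRingHom (MvPowerSeries.expand (σ := σ) (R := R) l hl))
          (components F)) := by
  ext d b
  rw [coeff_components, MvPowerSeries.coeff_homogeneousComponent, PowerSeries.coeff_expand,
    PowerSeries.coeff_map, coeff_components, RingHom.coe_coe, apply_ite (MvPowerSeries.coeff b),
    map_zero]
  by_cases hb : ∀ i, l ∣ b i
  · obtain ⟨a, rfl⟩ := exists_eq_smul_of_forall_dvd hb
    rw [MvPowerSeries.coeff_expand_smul, MvPowerSeries.coeff_expand_smul,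
      MvPowerSeries.coeff_homogeneousComponent, map_nsmul, smul_eq_mul, ← ite_and]
    refine if_congr ⟨?_, ?_⟩ rfl rfl
    · rintro rfl
      exact ⟨dvd_mul_right _ _, (Nat.mul_div_cancel_left _ (Nat.pos_of_ne_zero hl)).symm⟩
    · rintro ⟨hdvd, hdeg⟩
      rw [hdeg, Nat.mul_div_cancel' hdvd]
  · obtain ⟨i, hi⟩ := not_forall.1 hb
    rw [MvPowerSeries.coeff_expand_of_not_dvd _ _ _ hi,
      MvPowerSeries.coeff_expand_of_not_dvd _ _ _ hi, ite_self, ite_self]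

theorem isNewton_components_hSeries (ζ : ℂ) :
    IsNewton (fun r => ζ ^ r • pX r) (components (hSeries ζ)) := by
  have hcomp : components (hSeries ζ) = PowerSeries.rescale (MvPowerSeries.C ζ)
      (PowerSeries.mk fun n => (hSym n : MvPowerSeries ℕ ℂ)) := by
    ext d b
    rw [coeff_components, MvPowerSeries.coeff_homogeneousComponent, PowerSeries.coeff_rescale,
      PowerSeries.coeff_mk, ← map_pow, MvPowerSeries.coeff_C_mul, hSeries, hSym, coeff_series,
      coeff_series, mul_ite, mul_one, mul_zero]
    exact ite_congr rfl (fun hd => by rw [hd]) fun _ => rfl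
  rw [hcomp]
  refine (isNewton_hSym.rescale _).congr fun r _ => ?_
  rw [← map_pow, MvPowerSeries.smul_eq_C_mul]

theorem isNewton_components_adams_hSeries (ζ : ℂ) {l : ℕ} (hl : 0 < l) :
    IsNewton (fun r => (if l ∣ r then (l : ℂ) * ζ ^ (r / l) else 0) • pX r)
      (components (adams l (hSeries ζ))) := by
  rw [adams_of_pos hl, components_expand]
  refine (((isNewton_components_hSeries ζ).map _).expand hl.ne').congr fun r hr => ?_
  rw [ite_smul, zero_smul]
  refine ite_congr rfl ?_ fun _ => rfl
  rintro ⟨k, rfl⟩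
  have hk := expand_powerSum (Function.Embedding.refl ℕ) hl.ne' (Nat.pos_of_mul_pos_left hr)
  rw [Nat.mul_div_cancel_left _ hl, Function.comp_apply, RingHom.coe_coe, map_smul, mul_smul,
    Nat.cast_smul_eq_nsmul, nsmul_eq_mul]
  exact congrArg (fun p => (l : MvPowerSeries ℕ ℂ) * (ζ ^ k • p)) hk

section Pairing

variable {m : ℕ} [NeZero m]

/-- `∑_ζ ∑_{l ∈ ρ(ζ), l ∣ r} l ζ^{r/l}`, the `r`-th power sum of the eigenvalues of the elements
of `C_ρ`. -/
def eigenPowerSum (ρ : Phi m) (r : ℕ) : ℂ :=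
  ∑ ζ : rootsOfUnity m ℂ, ((ρ ζ).parts.map fun l =>
    if l ∣ r then (l : ℂ) * ((ζ : ℂˣ) : ℂ) ^ (r / l) else 0).sum

theorem isNewton_components_cauchySeries (ρ : Phi m) :
    IsNewton (fun r => eigenPowerSum ρ r • pX r) (components (cauchySeries ρ)) := by
  have hcomp : components (cauchySeries ρ) = ∏ ζ : rootsOfUnity m ℂ,
      ((ρ ζ).parts.map fun l => components (adams l (hSeries ((ζ : ℂˣ) : ℂ)))).prod := by
    rw [cauchySeries, map_prod]
    refine Finset.prod_congr rfl fun ζ _ => ?_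
    rw [parProd, map_multiset_prod, Multiset.map_map, Function.comp_def]
  rw [hcomp]
  refine (IsNewton.prod Finset.univ fun (ζ : rootsOfUnity m ℂ) _ =>
    IsNewton.multiset_prod (ρ ζ).parts fun l hl =>
      isNewton_components_adams_hSeries ((ζ : ℂˣ) : ℂ) ((ρ ζ).pos hl)).congr fun r _ => ?_
  rw [eigenPowerSum, Finset.sum_smul]
  refine Finset.sum_congr rfl fun ζ _ => ?_
  rw [Multiset.sum_smul, Multiset.map_map, Function.comp_def]

theorem homogeneousComponent_cauchySeries (ρ : Phi m) (d : ℕ) :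
    MvPowerSeries.homogeneousComponent d (cauchySeries ρ) = ∑ lam ∈ parOf d,
      ((lam.z : ℂ)⁻¹ * parProd (eigenPowerSum ρ) lam) • (pSym lam : MvPowerSeries ℕ ℂ) := by
  rw [← coeff_components, (isNewton_components_cauchySeries ρ).eq_mk_expCoeff ℂ,
    PowerSeries.coeff_mk, expCoeff]
  refine Finset.sum_congr rfl fun lam _ => ?_
  rw [parProd_smul, smul_smul, coe_pSym]

theorem homogeneousComponent_coeffX_kernel (a : rootsOfUnity m ℂ × ℕ →₀ ℕ) (d : ℕ) :
    MvPowerSeries.homogeneousComponent d (coeffX a (plethysticExp (kernelAlphabet m))) =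
      ∑ lam ∈ parOf d, (∑ ρ ∈ phiOf m a.degree, (ρ.Z : ℂ)⁻¹ * MvPowerSeries.coeff a (P ρ) *
        ((lam.z : ℂ)⁻¹ * parProd (eigenPowerSum ρ) lam)) • (pSym lam : MvPowerSeries ℕ ℂ) := by
  rw [coeffX_kernel, map_sum]
  simp only [map_smul, homogeneousComponent_cauchySeries, Finset.sum_smul, Finset.smul_sum,
    smul_smul]
  rw [Finset.sum_comm]

/-! ### The Hall pairing with a symmetric series -/

theorem isSymm_of_homogeneousComponent_eq_sum {F : MvPowerSeries ℕ ℂ} {α : Par → ℂ}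
    (h : ∀ d, MvPowerSeries.homogeneousComponent d F =
      ∑ lam ∈ parOf d, α lam • (pSym lam : MvPowerSeries ℕ ℂ)) : IsSymm F := by
  rw [isSymm_iff]
  intro e a
  have hsymm : IsSymm (MvPowerSeries.homogeneousComponent a.degree F) := by
    rw [h]
    exact (Subalgebra.sum_mem SymmFun fun lam _ =>
      Subalgebra.smul_mem _ (pSym lam).2 (α lam)).1
  have hcoeff := (isSymm_iff _).1 hsymm e a
  rwa [MvPowerSeries.coeff_homogeneousComponent, MvPowerSeries.coeff_homogeneousComponent,
    Finsupp.degree_mapDomain, if_pos rfl, if_pos rfl] at hcoeff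

theorem hallPairing_pSym_left (lam : Par) (f : SymmFun) :
    hallPairing (pSym lam) f = pBasis.repr f lam * lam.z := by
  have hfun : hallPairing (pSym lam) = (lam.z : ℂ) • pBasis.coord lam := by
    classical
    refine pBasis.ext fun mu => ?_
    rw [pBasis_apply, hallPairing_p, LinearMap.smul_apply, ← pBasis_apply,
      Module.Basis.coord_apply, Module.Basis.repr_self, Finsupp.single_apply, smul_eq_mul,
      mul_ite, mul_one, mul_zero]
    exact if_congr eq_comm rfl rfl
  rw [hfun, LinearMap.smul_apply, Module.Basis.coord_apply, smul_eq_mul, mul_comm]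

theorem finsum_sum_parOf {M : Type*} [AddCommMonoid M] {s : Finset Par} {g : Par → M}
    (hg : ∀ lam ∉ s, g lam = 0) :
    ∑ᶠ d, ∑ lam ∈ parOf d, g lam = ∑ lam ∈ s, g lam := by
  classical
  have hd : ∀ d, ∑ lam ∈ parOf d, g lam = ∑ lam ∈ s with lam.size = d, g lam := fun d => by
    refine (Finset.sum_subset (fun lam h => mem_parOf.2 (Finset.mem_filter.1 h).2)
      fun lam h hs => hg lam fun hlam => hs ?_).symm
    exact Finset.mem_filter.2 ⟨hlam, mem_parOf.1 h⟩
  simp only [hd]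
  rw [finsum_eq_sum_of_support_subset (s := s.image Par.size)]
  · exact Finset.sum_fiberwise_of_maps_to (fun lam => Finset.mem_image_of_mem _) _
  · intro d hne
    obtain ⟨lam, hlam, -⟩ := Finset.exists_ne_zero_of_sum_ne_zero hne
    rw [Finset.mem_filter] at hlam
    exact Finset.mem_coe.2 (Finset.mem_image.2 ⟨lam, hlam⟩)

theorem hallSeries_eq_sum {F : MvPowerSeries ℕ ℂ} (hF : IsSymm F) {α : Par → ℂ}
    (h : ∀ d, MvPowerSeries.homogeneousComponent d F =
      ∑ lam ∈ parOf d, α lam • (pSym lam : MvPowerSeries ℕ ℂ)) (f : SymmFun) :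
    hallSeries F hF f = (pBasis.repr f).sum fun lam c => c * (α lam * lam.z) := by
  have hd : ∀ d, hallPairing (symmComponent F hF d) f =
      ∑ lam ∈ parOf d, pBasis.repr f lam * (α lam * lam.z) := fun d => by
    have hcomp : symmComponent F hF d = ∑ lam ∈ parOf d, α lam • pSym lam := by
      refine Subtype.ext ?_
      rw [AddSubmonoidClass.coe_finsetSum]
      exact h d
    rw [hcomp, map_sum, LinearMap.sum_apply]
    refine Finset.sum_congr rfl fun lam _ => ?_
    rw [map_smul, LinearMap.smul_apply, hallPairing_pSym_left, smul_eq_mul, mul_left_comm]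
  rw [hallSeries, finsum_congr hd, Finsupp.sum]
  refine finsum_sum_parOf fun lam hlam => ?_
  rw [Finsupp.notMem_support_iff.1 hlam, zero_mul]

theorem isSymmY_kernel : IsSymmY (plethysticExp (kernelAlphabet m)) := fun a =>
  isSymm_of_homogeneousComponent_eq_sum (homogeneousComponent_coeffX_kernel a)

/-- The specialization `p_λ ↦ c_λ` of `Λ`, as a linear functional. -/
def evalPower (c : ℕ → ℂ) : SymmFun →ₗ[ℂ] ℂ := pBasis.constr ℂ fun lam => parProd c lam

theorem coeff_pairingY_kernel (a : rootsOfUnity m ℂ × ℕ →₀ ℕ) (f : SymmFun) :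
    MvPowerSeries.coeff a (pairingY (plethysticExp (kernelAlphabet m)) isSymmY_kernel f) =
      ∑ ρ ∈ phiOf m a.degree, evalPower (eigenPowerSum ρ) f / (ρ.Z : ℂ) *
        MvPowerSeries.coeff a (P ρ) := by
  rw [pairingY, coeff_series, hallSeries_eq_sum _ (homogeneousComponent_coeffX_kernel a)]
  simp only [evalPower, Module.Basis.constr_apply, Finsupp.sum, smul_eq_mul, Finset.sum_div,
    Finset.sum_mul, Finset.mul_sum]
  rw [Finset.sum_comm]
  refine Finset.sum_congr rfl fun ρ _ => Finset.sum_congr rfl fun lam _ => ?_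
  have hz : (lam.z : ℂ) ≠ 0 := Nat.cast_ne_zero.2 lam.z_pos.ne'
  field_simp

end Pairing

/-! ### Evaluation at finitely many numbers -/

/-- The restriction of symmetric functions to `n` variables, as a linear map into polynomials. -/
def toMvPolynomial (n : ℕ) : SymmFun →ₗ[ℂ] MvPolynomial (Fin n) ℂ :=
  pBasis.constr ℂ fun lam => parProd (MvPolynomial.psum (Fin n) ℂ) lam

theorem embDomain_eq_single_iff {σ τ M : Type*} [AddCommMonoid M] (e : σ ↪ τ) {b : σ →₀ M}
    {j : τ} {r : M} (hr : r ≠ 0) :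
    b.embDomain e = Finsupp.single j r ↔ ∃ i, e i = j ∧ b = Finsupp.single i r := by
  classical
  constructor
  · intro h
    have hj : j ∈ (b.embDomain e).support := by
      rw [h, Finsupp.support_single _ hr]
      exact Finset.mem_singleton_self j
    rw [Finsupp.support_embDomain, Finset.mem_map] at hj
    obtain ⟨i, -, rfl⟩ := hj
    refine ⟨i, rfl, Finsupp.embDomain_injective e ?_⟩
    rw [h, Finsupp.embDomain_single]
  · rintro ⟨i, rfl, rfl⟩
    exact Finsupp.embDomain_single e i r

theorem killCompl_pX (n : ℕ) {r : ℕ} (hr : 0 < r) :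
    MvPowerSeries.killCompl (Fin.valEmbedding : Fin n ↪ ℕ) (pX r) =
      (MvPolynomial.psum (Fin n) ℂ r : MvPowerSeries (Fin n) ℂ) := by
  classical
  ext b
  rw [MvPowerSeries.coeff_killCompl, pX, coeff_powerSum_X hr, MvPolynomial.coeff_coe,
    MvPolynomial.psum, MvPolynomial.coeff_sum]
  simp only [MvPolynomial.coeff_X_pow, embDomain_eq_single_iff _ hr.ne']
  split_ifs with h
  · obtain ⟨_, i, -, rfl⟩ := h
    simp only [Finsupp.single_left_inj hr.ne', Finset.sum_ite_eq', Finset.mem_univ, if_true]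
  · exact (Finset.sum_eq_zero fun i _ => if_neg fun hi => h ⟨_, i, rfl, hi.symm⟩).symm

theorem killCompl_eq_toMvPolynomial (n : ℕ) (f : SymmFun) :
    MvPowerSeries.killCompl (Fin.valEmbedding : Fin n ↪ ℕ) (f : MvPowerSeries ℕ ℂ) =
      (toMvPolynomial n f : MvPowerSeries (Fin n) ℂ) := by
  have hlin : (MvPowerSeries.killCompl (R := ℂ) (Fin.valEmbedding : Fin n ↪ ℕ)).toLinearMap ∘ₗ
      SymmFun.val.toLinearMap =
      (MvPolynomial.coeToMvPowerSeries.algHom (σ := Fin n) (R := ℂ) ℂ).toLinearMap ∘ₗ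
        toMvPolynomial n := by
    refine pBasis.ext fun lam => ?_
    rw [LinearMap.comp_apply, LinearMap.comp_apply, toMvPolynomial, Module.Basis.constr_basis,
      pBasis_apply]
    refine (map_parProd (MonoidHomClass.toMonoidHom
      (MvPowerSeries.killCompl (R := ℂ) (Fin.valEmbedding : Fin n ↪ ℕ))) pX lam).trans ?_
    refine Eq.trans ?_ (map_parProd (MonoidHomClass.toMonoidHom
      (MvPolynomial.coeToMvPowerSeries.algHom (σ := Fin n) (R := ℂ) ℂ)) _ lam).symm
    exact parProd_congr (fun r hr => killCompl_pX n hr) lam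
  exact LinearMap.congr_fun hlin f

theorem eval_toMvPolynomial {n : ℕ} (x : Fin n → ℂ) (f : SymmFun) :
    MvPolynomial.eval x (toMvPolynomial n f) = evalPower (fun r => ∑ i, x i ^ r) f := by
  have hlin : (MvPolynomial.aeval x).toLinearMap ∘ₗ toMvPolynomial n =
      evalPower fun r => ∑ i, x i ^ r := by
    refine pBasis.ext fun lam => ?_
    rw [LinearMap.comp_apply, toMvPolynomial, evalPower, Module.Basis.constr_basis,
      Module.Basis.constr_basis]
    refine (map_parProd (MonoidHomClass.toMonoidHom (MvPolynomial.aeval (R := ℂ) x)) _ lam).trans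
      (parProd_congr (fun r _ => ?_) lam)
    change MvPolynomial.aeval x (MvPolynomial.psum (Fin n) ℂ r) = _
    simp only [MvPolynomial.psum, map_sum, map_pow, MvPolynomial.aeval_X]
  exact LinearMap.congr_fun hlin f

theorem evalFin_eq_evalPower {n : ℕ} (f : SymmFun) (x : Fin n → ℂ) :
    evalFin f x = evalPower (fun r => ∑ i, x i ^ r) f := by
  rw [← eval_toMvPolynomial, MvPolynomial.eval_eq', evalFin]
  simp only [← MvPowerSeries.coeff_killCompl, killCompl_eq_toMvPolynomial, MvPolynomial.coeff_coe]
  refine finsum_eq_sum_of_support_subset _ fun b hb => ?_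
  rw [Function.mem_support] at hb
  exact Finset.mem_coe.2 (MvPolynomial.mem_support_iff.2 (left_ne_zero_of_mul hb))

theorem evalPower_congr {c d : ℕ → ℂ} (h : ∀ r, 0 < r → c r = d r) :
    evalPower c = evalPower d :=
  congrArg (pBasis.constr ℂ) (funext (parProd_congr h))

theorem sum_get_toList {α M : Type*} [AddCommMonoid M] (s : Multiset α) (f : α → M) :
    ∑ k : Fin s.toList.length, f (s.toList.get k) = (s.map f).sum := by
  conv_rhs => rw [← s.coe_toList, Multiset.map_coe, Multiset.sum_coe, ← List.ofFn_get s.toList,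
    List.map_ofFn, List.sum_ofFn]
  rfl

theorem evalMultiset_eq_evalPower (f : SymmFun) (A : Multiset ℂ) :
    evalMultiset f A = evalPower (fun r => (A.map fun a => a ^ r).sum) f := by
  rw [evalMultiset, evalFin_eq_evalPower]
  exact LinearMap.congr_fun (evalPower_congr fun r _ => sum_get_toList A fun a => a ^ r) f

section PowerSums

variable {K : Type*} [Field K]

theorem sum_map_eval_eq_of_sum_map_pow_eq {A B : Multiset K}
    (h : ∀ r : ℕ, (A.map fun a => a ^ r).sum = (B.map fun a => a ^ r).sum) (p : Polynomial K) :
    (A.map fun a => p.eval a).sum = (B.map fun a => p.eval a).sum := by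
  simp only [Polynomial.eval_eq_sum_range, Multiset.sum_map_sum, Multiset.sum_map_mul_left, h]

theorem sum_map_eval_basis_eq_count [DecidableEq K] {A : Multiset K} {s : Finset K} {c : K}
    (hc : c ∈ s) (hA : A.toFinset ⊆ s) :
    (A.map fun a => (Lagrange.basis s id c).eval a).sum = A.count c := by
  rw [Finset.sum_multiset_map_count, Finset.sum_eq_single c]
  · have hself := Lagrange.eval_basis_self (v := (id : K → K)) Function.injective_id.injOn hc
    exact (congrArg (A.count c • ·) hself).trans (nsmul_one _)
  · intro a ha hac
    have hne := Lagrange.eval_basis_of_ne (v := (id : K → K)) hac.symm (hA ha)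
    exact (congrArg (A.count a • ·) hne).trans (smul_zero _)
  · intro h
    rw [Multiset.count_eq_zero.2 (mt Multiset.mem_toFinset.2 h), zero_smul]

theorem eq_of_sum_map_pow_eq [CharZero K] {A B : Multiset K}
    (h : ∀ r : ℕ, (A.map fun a => a ^ r).sum = (B.map fun a => a ^ r).sum) : A = B := by
  classical
  ext c
  have hcount := sum_map_eval_eq_of_sum_map_pow_eq h
    (Lagrange.basis (insert c (A.toFinset ∪ B.toFinset)) id c)
  rw [sum_map_eval_basis_eq_count (Finset.mem_insert_self _ _)
      (Finset.subset_union_left.trans (Finset.subset_insert _ _)),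
    sum_map_eval_basis_eq_count (Finset.mem_insert_self _ _)
      (Finset.subset_union_right.trans (Finset.subset_insert _ _))] at hcount
  exact Nat.cast_injective hcount

end PowerSums

/-! ### Diagonalization of matrices of finite order -/

section Diagonalization

variable {ι K : Type*} [Fintype ι] [DecidableEq ι] [Field K]

theorem isSemisimple_toLin'_of_pow_eq_one {N : ℕ} (hN : (N : K) ≠ 0) {A : Matrix ι ι K}
    (hA : A ^ N = 1) : Module.End.IsSemisimple (Matrix.toLin' A) := by
  refine Module.End.isSemisimple_of_squarefree_aeval_eq_zero (p := Polynomial.X ^ N - 1)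
    (Polynomial.separable_X_pow_sub_C (1 : K) hN one_ne_zero).squarefree ?_
  rw [map_sub, map_pow, Polynomial.aeval_X, map_one, ← Matrix.toLin'_pow, hA, Matrix.toLin'_one]
  exact sub_self _

variable [IsAlgClosed K]

theorem exists_basis_mulVec_eq_smul {A : Matrix ι ι K}
    (hA : Module.End.IsSemisimple (Matrix.toLin' A)) :
    ∃ (b : Module.Basis ι K (ι → K)) (x : ι → K), ∀ j, A.mulVec (b j) = x j • b j := by
  set S : Set (ι → K) := {v | ∃ μ : K, A.mulVec v = μ • v}
  have hS : ⊤ ≤ Submodule.span K S := by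
    rw [← hA.iSup_eigenspace_eq_top]
    exact iSup_le fun μ v hv => Submodule.subset_span ⟨μ, Module.End.mem_eigenspace_iff.1 hv⟩
  let b := Module.Basis.ofSpan hS
  have hb : ∀ i, b i ∈ S := fun i => Module.Basis.ofSpan_subset hS (Set.mem_range_self i)
  let e := b.indexEquiv (Pi.basisFun K ι)
  choose x hx using fun j => hb (e.symm j)
  refine ⟨b.reindex e, x, fun j => ?_⟩
  rw [Module.Basis.reindex_apply]
  exact hx j

theorem exists_conj_diagonal {N : ℕ} (hN : (N : K) ≠ 0) {g : Matrix.GeneralLinearGroup ι K}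
    (hg : g ^ N = 1) : ∃ (h D : Matrix.GeneralLinearGroup ι K) (x : ι → K),
      D.val = Matrix.diagonal x ∧ g = h * D * h⁻¹ := by
  obtain ⟨b, x, hb⟩ := exists_basis_mulVec_eq_smul (isSemisimple_toLin'_of_pow_eq_one hN
    (A := g.val) (by rw [← Units.val_pow_eq_pow_val, hg, Units.val_one]))
  let e := Pi.basisFun K ι
  let h : Matrix.GeneralLinearGroup ι K :=
    ⟨e.toMatrix b, b.toMatrix e, e.toMatrix_mul_toMatrix_flip b, b.toMatrix_mul_toMatrix_flip e⟩
  have hcol : g.val * h.val = h.val * Matrix.diagonal x := by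
    ext i j
    rw [Matrix.mul_diagonal, mul_comm]
    exact congrFun (hb j) i
  refine ⟨h, h⁻¹ * g * h, x, ?_, by group⟩
  rw [Units.val_mul, Units.val_mul, mul_assoc, hcol, ← mul_assoc, ← Units.val_mul, inv_mul_cancel,
    Units.val_one, one_mul]

end Diagonalization

section ConjDiagonal

variable {ι K : Type*} [Fintype ι] [DecidableEq ι] [Field K]
  {g h D : Matrix.GeneralLinearGroup ι K} {x : ι → K}

theorem roots_charpoly_conj_diagonal (hD : D.val = Matrix.diagonal x) (hg : g = h * D * h⁻¹) :
    g.val.charpoly.roots = Finset.univ.val.map x := by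
  have hroots := Polynomial.roots_multiset_prod_X_sub_C (Finset.univ.val.map x)
  rw [Multiset.map_map] at hroots
  rw [hg, Units.val_mul, Units.val_mul, hD, Matrix.coe_units_inv, Matrix.charpoly_units_conj,
    Matrix.charpoly_diagonal]
  exact hroots

theorem trace_pow_conj_diagonal (hD : D.val = Matrix.diagonal x) (hg : g = h * D * h⁻¹) (r : ℕ) :
    (g.val ^ r).trace = ∑ i, x i ^ r := by
  rw [← Units.val_pow_eq_pow_val, hg, conj_pow, Units.val_mul, Units.val_mul,
    Matrix.trace_units_conj, Units.val_pow_eq_pow_val, hD, Matrix.diagonal_pow,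
    Matrix.trace_diagonal]
  rfl

end ConjDiagonal

section FiniteOrder

variable {m n : ℕ} [NeZero m]

instance finite_wreathGroup : Finite (WreathGroup m n) :=
  Finite.of_injective (fun γ => (γ.left, γ.right)) fun _ _ h =>
    SemidirectProduct.ext (congrArg Prod.fst h) (congrArg Prod.snd h)

theorem exists_conj_diagonal_toGL (γ : WreathGroup m n) :
    ∃ (h D : Matrix.GeneralLinearGroup (Fin n) ℂ) (x : Fin n → ℂ),
      D.val = Matrix.diagonal x ∧ toGL γ = h * D * h⁻¹ := by
  obtain ⟨N, hN, hγ⟩ := (isOfFinOrder_of_finite γ).exists_pow_eq_one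
  exact exists_conj_diagonal (Nat.cast_ne_zero.2 hN.ne') (by rw [← map_pow, hγ, map_one])

theorem sum_map_pow_roots_charpoly (γ : WreathGroup m n) (r : ℕ) :
    ((toMatrix γ).charpoly.roots.map fun a => a ^ r).sum = (toMatrix (γ ^ r)).trace := by
  obtain ⟨h, D, x, hD, hg⟩ := exists_conj_diagonal_toGL γ
  have hroots := roots_charpoly_conj_diagonal hD hg
  have htrace := trace_pow_conj_diagonal hD hg r
  change (toMatrix γ).charpoly.roots = _ at hroots
  change ((toMatrix γ) ^ r).trace = _ at htrace
  rw [map_pow, htrace, hroots, Multiset.map_map]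
  rfl

end FiniteOrder

/-! ### Traces of powers of monomial matrices -/

section Trace

variable {m n : ℕ}

/-- The cycle of `γ` through the point `i`. -/
def cycleOf (γ : WreathGroup m n) (i : Fin n) : Cycle γ := Quotient.mk _ i

theorem exists_cycleOf_eq {γ : WreathGroup m n} (q : Cycle γ) : ∃ i, cycleOf γ i = q :=
  Quotient.exists_rep q

theorem cycleOf_eq_cycleOf {γ : WreathGroup m n} {i j : Fin n} :
    cycleOf γ i = cycleOf γ j ↔ γ.right.SameCycle i j :=
  Quotient.eq

theorem mem_points {γ : WreathGroup m n} {q : Cycle γ} {i : Fin n} :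
    i ∈ q.points ↔ cycleOf γ i = q := by
  classical
  rw [Cycle.points, Finset.mem_filter, and_iff_right (Finset.mem_univ i)]
  rfl

theorem points_card_pos {γ : WreathGroup m n} (q : Cycle γ) : 0 < q.points.card := by
  obtain ⟨i, hi⟩ := exists_cycleOf_eq q
  exact Finset.card_pos.2 ⟨i, mem_points.2 hi⟩

theorem pow_right (γ : WreathGroup m n) (r : ℕ) : (γ ^ r).right = γ.right ^ r :=
  map_pow SemidirectProduct.rightHom γ r

theorem pow_left (γ : WreathGroup m n) (r : ℕ) (i : Fin n) :
    (γ ^ r).left i = ∏ k ∈ Finset.range r, γ.left ((⇑γ.right⁻¹)^[k] i) := by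
  induction r generalizing i with
  | zero => rfl
  | succ r ih =>
    rw [pow_succ', SemidirectProduct.mul_left, Finset.prod_range_succ']
    change γ.left i * (γ ^ r).left (γ.right⁻¹ i) = _
    rw [ih, mul_comm]
    rfl

theorem trace_toMatrix (γ : WreathGroup m n) :
    (toMatrix γ).trace = ∑ i, if γ.right i = i then ((γ.left i : ℂˣ) : ℂ) else 0 :=
  Finset.sum_congr rfl fun _ _ => if_congr eq_comm rfl rfl

theorem points_cycleOf (γ : WreathGroup m n) (i : Fin n) :
    (cycleOf γ i).points =
      (Finset.range (Function.minimalPeriod (⇑γ.right⁻¹) i)).image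
        fun k => (⇑γ.right⁻¹)^[k] i := by
  ext j
  rw [mem_points, cycleOf_eq_cycleOf, Equiv.Perm.sameCycle_comm, ← Equiv.Perm.sameCycle_inv]
  simp only [Finset.mem_image, Finset.mem_range, Equiv.Perm.iterate_eq_pow]
  constructor
  · intro h
    obtain ⟨k, hk⟩ := h.exists_nat_pow_eq
    have hpos : 0 < Function.minimalPeriod (⇑γ.right⁻¹) i :=
      Function.minimalPeriod_pos_of_mem_periodicPts
        (Function.Injective.mem_periodicPts (Equiv.injective _) i)
    refine ⟨k % Function.minimalPeriod (⇑γ.right⁻¹) i, Nat.mod_lt _ hpos, ?_⟩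
    rw [← Equiv.Perm.iterate_eq_pow, Function.iterate_mod_minimalPeriod_eq,
      Equiv.Perm.iterate_eq_pow, hk]
  · rintro ⟨k, -, hk⟩
    exact ⟨k, by rw [zpow_natCast, hk]⟩

theorem injOn_iterate (γ : WreathGroup m n) (i : Fin n) :
    Set.InjOn (fun k => (⇑γ.right⁻¹)^[k] i)
      (Finset.range (Function.minimalPeriod (⇑γ.right⁻¹) i)) := by
  rw [Finset.coe_range]
  exact Function.iterate_injOn_Iio_minimalPeriod

theorem card_points_cycleOf (γ : WreathGroup m n) (i : Fin n) :
    (cycleOf γ i).points.card = Function.minimalPeriod (⇑γ.right⁻¹) i := by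
  rw [points_cycleOf, Finset.card_image_of_injOn (injOn_iterate γ i), Finset.card_range]

theorem cycleProduct_cycleOf (γ : WreathGroup m n) (i : Fin n) :
    cycleProduct (cycleOf γ i) =
      ∏ k ∈ Finset.range (Function.minimalPeriod (⇑γ.right⁻¹) i),
        γ.left ((⇑γ.right⁻¹)^[k] i) := by
  rw [cycleProduct, points_cycleOf, Finset.prod_image (injOn_iterate γ i)]

theorem pow_card_points_mul_left (γ : WreathGroup m n) (i : Fin n) (s : ℕ) :
    (γ ^ ((cycleOf γ i).points.card * s)).left i = cycleProduct (cycleOf γ i) ^ s := by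
  rw [card_points_cycleOf, pow_left, cycleProduct_cycleOf]
  induction s with
  | zero => rfl
  | succ s ih =>
    rw [Nat.mul_succ, Finset.prod_range_add, ih, pow_succ]
    refine congrArg _ (Finset.prod_congr rfl fun k _ => ?_)
    have hper := (Function.isPeriodicPt_minimalPeriod (⇑γ.right⁻¹) i).mul_const s
    rw [add_comm, Function.iterate_add_apply, hper.eq]

theorem pow_right_apply_eq_iff (γ : WreathGroup m n) (i : Fin n) (r : ℕ) :
    (γ ^ r).right i = i ↔ (cycleOf γ i).points.card ∣ r := by
  rw [card_points_cycleOf, ← Function.isPeriodicPt_iff_minimalPeriod_dvd, pow_right,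
    Function.IsPeriodicPt, Function.IsFixedPt, Equiv.Perm.iterate_eq_pow, inv_pow,
    Equiv.Perm.inv_eq_iff_eq, eq_comm]

theorem pow_left_of_mem_points {γ : WreathGroup m n} {q : Cycle γ} {i : Fin n}
    (hi : i ∈ q.points) {r : ℕ} (hr : q.points.card ∣ r) :
    (γ ^ r).left i = cycleProduct q ^ (r / q.points.card) := by
  obtain rfl := mem_points.1 hi
  rw [← pow_card_points_mul_left, Nat.mul_div_cancel' hr]

theorem trace_toMatrix_pow (γ : WreathGroup m n) [Fintype (Cycle γ)] (r : ℕ) :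
    (toMatrix (γ ^ r)).trace = ∑ q : Cycle γ, if q.points.card ∣ r then
      (q.points.card : ℂ) * (((cycleProduct q : rootsOfUnity m ℂ) : ℂˣ) : ℂ) ^ (r / q.points.card)
      else 0 := by
  classical
  rw [trace_toMatrix, ← Finset.sum_fiberwise Finset.univ (cycleOf γ)]
  refine Finset.sum_congr rfl fun q _ => ?_
  have hfiber : Finset.univ.filter (fun i => cycleOf γ i = q) = q.points := by
    ext i
    rw [Finset.mem_filter_univ, mem_points]
  have hdiag : ∀ i ∈ q.points, (if (γ ^ r).right i = i then (((γ ^ r).left i : ℂˣ) : ℂ) else 0) =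
      if q.points.card ∣ r then
        (((cycleProduct q : rootsOfUnity m ℂ) : ℂˣ) : ℂ) ^ (r / q.points.card) else 0 := by
    intro i hi
    refine if_ctx_congr ?_ (fun hr => ?_) fun _ => rfl
    · rw [pow_right_apply_eq_iff, mem_points.1 hi]
    · rw [pow_left_of_mem_points hi hr, SubmonoidClass.coe_pow, Units.val_pow_eq_pow_val]
  rw [hfiber, Finset.sum_congr rfl hdiag, Finset.sum_const, nsmul_eq_mul, mul_ite, mul_zero]

open Classical in
theorem map_card_points_of_mem_conjClass {γ : WreathGroup m n} [Fintype (Cycle γ)] {ρ : Phi m}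
    (h : γ ∈ conjClass n ρ) (ζ : rootsOfUnity m ℂ) :
    ((Finset.univ.filter fun q : Cycle γ => cycleProduct q = ζ).val.map
      fun q => q.points.card) = (ρ ζ).parts := by
  ext l
  rw [Multiset.count_map]
  rcases Nat.eq_zero_or_pos l with rfl | hl
  · rw [Multiset.count_eq_zero.2 fun hmem => lt_irrefl 0 ((ρ ζ).pos hmem), Multiset.card_eq_zero,
      Multiset.filter_eq_nil]
    exact fun q _ hzero => (points_card_pos q).ne hzero
  · have hcount : Nat.card {q : Cycle γ // cycleProduct q = ζ ∧ q.points.card = l} =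
        (ρ ζ).parts.count l := h ζ l hl
    rw [← hcount, Nat.card_eq_fintype_card, Fintype.card_subtype, ← Finset.filter_filter]
    simp only [eq_comm (a := l)]
    rfl

theorem trace_pow_of_mem_conjClass [NeZero m] {γ : WreathGroup m n} {ρ : Phi m}
    (h : γ ∈ conjClass n ρ) (r : ℕ) : (toMatrix (γ ^ r)).trace = eigenPowerSum ρ r := by
  classical
  rw [trace_toMatrix_pow, eigenPowerSum, ← Finset.sum_fiberwise Finset.univ
    (fun q : Cycle γ => (cycleProduct q : rootsOfUnity m ℂ))]
  refine Finset.sum_congr rfl fun ζ _ => ?_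
  rw [← map_card_points_of_mem_conjClass h ζ, Multiset.map_map]
  refine Finset.sum_congr rfl fun q hq => ?_
  rw [(Finset.mem_filter.1 hq).2]
  rfl

end Trace

/-! ### Every class is nonempty -/

theorem finRotate_apply_of_lt {l : ℕ} (j : Fin l) (hj : j.val + 1 < l) :
    finRotate l j = ⟨j.val + 1, hj⟩ := by
  cases l with
  | zero => exact j.elim0
  | succ l => exact finRotate_of_lt (Nat.lt_of_succ_lt_succ hj)

theorem sameCycle_permCongr {α β : Type*} (e : α ≃ β) (f : Equiv.Perm α) {x y : α} :
    (e.permCongr f).SameCycle (e x) (e y) ↔ f.SameCycle x y := by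
  refine exists_congr fun k => ?_
  have hpow : e.permCongr f ^ k = e.permCongr (f ^ k) := (map_zpow e.permCongrHom f k).symm
  rw [hpow, Equiv.permCongr_apply, e.symm_apply_apply, e.injective.eq_iff]

section StandardElement

variable {m : ℕ} (ρ : Phi m)

/-- The index set of the cycles of an element of `C_ρ`. -/
abbrev CycleIndex : Type := Σ ζ : rootsOfUnity m ℂ, Fin (ρ ζ).parts.toList.length

/-- The length of the cycle with a given index. -/
def cycleLen (i : CycleIndex ρ) : ℕ := (ρ i.1).parts.toList.get i.2

/-- The set permuted by the standard element of `C_ρ`: the disjoint union of its cycles. -/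
abbrev CyclePoint : Type := Σ i : CycleIndex ρ, Fin (cycleLen ρ i)

theorem cycleLen_pos (i : CycleIndex ρ) : 0 < cycleLen ρ i :=
  (ρ i.1).pos (Multiset.mem_toList.1 (List.get_mem _ _))

/-- The permutation of the cycle points that rotates each cycle. -/
def rotation : Equiv.Perm (CyclePoint ρ) :=
  Equiv.Perm.sigmaCongrRight fun i => finRotate (cycleLen ρ i)

theorem sameCycle_rotation_zero (i : CycleIndex ρ) (k : ℕ) (hk : k < cycleLen ρ i) :
    (rotation ρ).SameCycle ⟨i, ⟨0, cycleLen_pos ρ i⟩⟩ ⟨i, ⟨k, hk⟩⟩ := by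
  induction k with
  | zero => exact Equiv.Perm.SameCycle.refl _ _
  | succ k ih =>
    have hk' : k < cycleLen ρ i := Nat.lt_of_succ_lt hk
    have hrot : rotation ρ ⟨i, ⟨k, hk'⟩⟩ = ⟨i, ⟨k + 1, hk⟩⟩ :=
      congrArg (Sigma.mk i) (finRotate_apply_of_lt ⟨k, hk'⟩ hk)
    rw [← hrot, Equiv.Perm.sameCycle_apply_right]
    exact ih hk'

theorem rotation_pow_fst (k : ℕ) (u : CyclePoint ρ) : ((rotation ρ ^ k) u).1 = u.1 := by
  induction k with
  | zero => rfl
  | succ k ih =>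
    rw [pow_succ', Equiv.Perm.mul_apply]
    exact ih

theorem sameCycle_rotation_iff [Finite (CyclePoint ρ)] (u v : CyclePoint ρ) :
    (rotation ρ).SameCycle u v ↔ u.1 = v.1 := by
  constructor
  · intro h
    obtain ⟨k, rfl⟩ := h.exists_nat_pow_eq
    exact (rotation_pow_fst ρ k u).symm
  · obtain ⟨i, j, hj⟩ := u
    obtain ⟨i', j', hj'⟩ := v
    rintro rfl
    exact (sameCycle_rotation_zero ρ i j hj).symm.trans (sameCycle_rotation_zero ρ i j' hj')

variable [NeZero m]

theorem card_cyclePoint : Fintype.card (CyclePoint ρ) = ρ.size := by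
  rw [Fintype.card_sigma, Fintype.sum_sigma, Phi.size]
  refine Finset.sum_congr rfl fun ζ _ => ?_
  have hsum := sum_get_toList (ρ ζ).parts id
  rw [Multiset.map_id, Par.sum_parts] at hsum
  simp only [Fintype.card_fin]
  exact hsum

/-- A numbering of the cycle points. -/
def pointEquiv : CyclePoint ρ ≃ Fin ρ.size := Fintype.equivFinOfCardEq (card_cyclePoint ρ)

/-- The standard element of `C_ρ`: it rotates each cycle, and the entries of the cycle of index
`(ζ, k)` are `ζ, 1, …, 1`. -/
def standardElement : WreathGroup m ρ.size where
  left := fun x => if ((pointEquiv ρ).symm x).2.val = 0 then ((pointEquiv ρ).symm x).1.1 else 1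
  right := (pointEquiv ρ).permCongr (rotation ρ)

theorem standardElement_left_apply (u : CyclePoint ρ) :
    (standardElement ρ).left (pointEquiv ρ u) = if u.2.val = 0 then u.1.1 else 1 :=
  congrArg (fun u : CyclePoint ρ => if u.2.val = 0 then u.1.1 else 1)
    ((pointEquiv ρ).symm_apply_apply u)

theorem cycleOf_standardElement_eq_iff (u v : CyclePoint ρ) :
    cycleOf (standardElement ρ) (pointEquiv ρ u) = cycleOf (standardElement ρ) (pointEquiv ρ v) ↔
      u.1 = v.1 := by
  rw [cycleOf_eq_cycleOf, ← sameCycle_rotation_iff]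
  exact sameCycle_permCongr _ _

/-- The bijection from indices to cycles of the standard element. -/
def cycleEquiv : CycleIndex ρ ≃ Cycle (standardElement ρ) :=
  Equiv.ofBijective
    (fun i => cycleOf (standardElement ρ) (pointEquiv ρ ⟨i, ⟨0, cycleLen_pos ρ i⟩⟩)) <| by
    constructor
    · exact fun i i' h => (cycleOf_standardElement_eq_iff ρ _ _).1 h
    · intro q
      obtain ⟨x, rfl⟩ := exists_cycleOf_eq q
      obtain ⟨u, rfl⟩ := (pointEquiv ρ).surjective x
      exact ⟨u.1, (cycleOf_standardElement_eq_iff ρ _ _).2 rfl⟩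

theorem points_cycleEquiv (i : CycleIndex ρ) : (cycleEquiv ρ i).points =
    (Finset.univ : Finset (Fin (cycleLen ρ i))).map
      ((Function.Embedding.sigmaMk i).trans (pointEquiv ρ).toEmbedding) := by
  ext x
  obtain ⟨u, rfl⟩ := (pointEquiv ρ).surjective x
  rw [mem_points, Finset.mem_map]
  refine (cycleOf_standardElement_eq_iff ρ _ _).trans ?_
  constructor
  · obtain ⟨i', j⟩ := u
    rintro rfl
    exact ⟨j, Finset.mem_univ j, rfl⟩
  · rintro ⟨j, -, hj⟩
    rw [← (pointEquiv ρ).injective hj]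
    rfl

theorem card_points_cycleEquiv (i : CycleIndex ρ) :
    (cycleEquiv ρ i).points.card = cycleLen ρ i := by
  rw [points_cycleEquiv, Finset.card_map, Finset.card_univ, Fintype.card_fin]

theorem cycleProduct_cycleEquiv (i : CycleIndex ρ) : cycleProduct (cycleEquiv ρ i) = i.1 := by
  rw [cycleProduct, points_cycleEquiv, Finset.prod_map,
    Finset.prod_eq_single (⟨0, cycleLen_pos ρ i⟩ : Fin (cycleLen ρ i))]
  · exact (standardElement_left_apply ρ _).trans (if_pos rfl)
  · exact fun j _ hj => (standardElement_left_apply ρ _).trans (if_neg fun h => hj (Fin.ext h))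
  · exact fun h => absurd (Finset.mem_univ _) h

theorem standardElement_mem_conjClass : standardElement ρ ∈ conjClass ρ.size ρ := by
  classical
  intro ζ l _
  have hcard : Nat.card {q : Cycle (standardElement ρ) //
        cycleProduct q = ζ ∧ q.points.card = l} =
      Nat.card {i : CycleIndex ρ // i.1 = ζ ∧ cycleLen ρ i = l} :=
    Nat.card_congr ((cycleEquiv ρ).subtypeEquiv fun i => by
      rw [card_points_cycleEquiv, cycleProduct_cycleEquiv]).symm
  rw [hcard, Nat.card_eq_fintype_card, Fintype.card_subtype, Finset.card_filter, Fintype.sum_sigma,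
    Finset.sum_eq_single ζ]
  · simp only [true_and]
    refine (sum_get_toList (ρ ζ).parts fun k => if k = l then 1 else 0).trans ?_
    rw [Par.mult, Finset.sum_multiset_map_count]
    simp only [smul_eq_mul, mul_ite, mul_one, mul_zero, Finset.sum_ite_eq', Multiset.mem_toFinset]
    exact ite_eq_left_iff.2 fun hl => (Multiset.count_eq_zero.2 hl).symm
  · exact fun ζ' _ hζ => Finset.sum_eq_zero fun k _ => if_neg fun h => hζ h.1
  · exact fun h => absurd (Finset.mem_univ _) h

theorem conjClass_nonempty : (conjClass ρ.size ρ).Nonempty := ⟨_, standardElement_mem_conjClass ρ⟩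

theorem classRep_mem_conjClass : classRep ρ.size ρ ∈ conjClass ρ.size ρ := by
  rw [classRep, dif_pos (conjClass_nonempty ρ)]
  exact (conjClass_nonempty ρ).some_mem

end StandardElement

section Eigenvalues

variable {m : ℕ} [NeZero m] {ρ : Phi m}

theorem sum_map_pow_roots_of_mem_conjClass {n : ℕ} {γ : WreathGroup m n} (h : γ ∈ conjClass n ρ)
    (r : ℕ) : ((toMatrix γ).charpoly.roots.map fun a => a ^ r).sum = eigenPowerSum ρ r := by
  rw [sum_map_pow_roots_charpoly, trace_pow_of_mem_conjClass h]

theorem roots_charpoly_eq_Xi {γ : WreathGroup m ρ.size} (h : γ ∈ conjClass ρ.size ρ) :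
    (toMatrix γ).charpoly.roots = Xi ρ :=
  eq_of_sum_map_pow_eq fun r => by
    rw [sum_map_pow_roots_of_mem_conjClass h, Xi,
      sum_map_pow_roots_of_mem_conjClass (classRep_mem_conjClass ρ)]

theorem evalMultiset_Xi (ρ : Phi m) (f : SymmFun) :
    evalMultiset f (Xi ρ) = evalPower (eigenPowerSum ρ) f := by
  rw [evalMultiset_eq_evalPower]
  exact LinearMap.congr_fun (evalPower_congr fun r _ =>
    sum_map_pow_roots_of_mem_conjClass (classRep_mem_conjClass ρ) r) f

end Eigenvalues

/-! ### The generating series -/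

section GeneratingSeries

variable {m : ℕ} [NeZero m] (lam : Par)

theorem coeff_FTerm_eq_zero {ρ : Phi m} {a : rootsOfUnity m ℂ × ℕ →₀ ℕ}
    (h : ρ ∉ phiOf m a.degree) : MvPowerSeries.coeff a (FTerm lam ρ) = 0 := by
  have hdeg : a.degree ≠ ρ.size := fun h' => h (mem_phiOf.2 h'.symm)
  rw [FTerm, map_smul, MvPowerSeries.IsHomogeneous.coeff_eq_zero (isHomogeneous_P ρ) hdeg,
    smul_zero]

theorem hasSum_coeff_FTerm (a : rootsOfUnity m ℂ × ℕ →₀ ℕ) :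
    HasSum (fun ρ : Phi m => MvPowerSeries.coeff a (FTerm lam ρ))
      (∑ ρ ∈ phiOf m a.degree, MvPowerSeries.coeff a (FTerm lam ρ)) :=
  hasSum_sum_of_ne_finset_zero fun _ h => coeff_FTerm_eq_zero lam h

theorem summable_FTerm : Summable fun ρ : Phi m => FTerm lam ρ := by
  rw [MvPowerSeries.WithPiTopology.summable_iff_summable_coeff]
  exact fun a => (hasSum_coeff_FTerm lam a).summable

theorem coeff_F (a : rootsOfUnity m ℂ × ℕ →₀ ℕ) : MvPowerSeries.coeff a (F m lam) =
    ∑ ρ ∈ phiOf m a.degree, MvPowerSeries.coeff a (FTerm lam ρ) :=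
  (MvPowerSeries.WithPiTopology.hasSum_iff_hasSum_coeff.1
    (summable_FTerm lam).hasSum a).unique (hasSum_coeff_FTerm lam a)

theorem F_eq_pairingY : F m lam =
    pairingY (plethysticExp (kernelAlphabet m)) isSymmY_kernel (schur lam) := by
  ext a
  rw [coeff_F, coeff_pairingY_kernel]
  refine Finset.sum_congr rfl fun ρ _ => ?_
  rw [FTerm, map_smul, evalMultiset_Xi, smul_eq_mul]

theorem homogeneousComponent_F (n : ℕ) : MvPowerSeries.homogeneousComponent n (F m lam) =
    ∑ ρ ∈ phiOf m n, FTerm lam ρ := by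
  ext a
  rw [MvPowerSeries.coeff_homogeneousComponent, map_sum]
  split_ifs with h
  · rw [coeff_F, h]
  · refine (Finset.sum_eq_zero fun ρ hρ => coeff_FTerm_eq_zero lam fun ha => h ?_).symm
    rw [← mem_phiOf.1 hρ, ← mem_phiOf.1 ha]

end GeneratingSeries

/-! ### Exchange relations between minors -/

section Replacement

variable {ι α M : Type*} {P : ι → Prop} [DecidablePred P]

@[to_additive]
theorem prod_extend_val [Fintype ι] [CommMonoid M] (g : {b // P b} → α) (c : ι → α)
    (f : ι → α → M) : ∏ b, f b (Function.extend Subtype.val g c b) =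
      (∏ b : {b // P b}, f b (g b)) * ∏ b : {b // ¬ P b}, f b (c b) := by
  rw [← Fintype.prod_subtype_mul_prod_subtype P]
  congr 1
  · exact Finset.prod_congr rfl fun b _ => by rw [Subtype.val_injective.extend_apply]
  · refine Finset.prod_congr rfl fun b _ => ?_
    rw [Function.extend_apply' _ _ _ fun ⟨a, ha⟩ => b.2 (ha ▸ a.2)]

theorem extend_val_comp_perm (w : Equiv.Perm {b // P b}) (c : ι → α) :
    Function.extend Subtype.val (fun b => c (w b)) c = c ∘ Equiv.Perm.ofSubtype w := by
  funext b
  rw [Function.comp_apply]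
  by_cases hb : P b
  · rw [Equiv.Perm.ofSubtype_apply_of_mem _ hb]
    exact Subtype.val_injective.extend_apply _ _ ⟨b, hb⟩
  · rw [Equiv.Perm.ofSubtype_apply_of_not_mem _ hb,
      Function.extend_apply' _ _ _ fun ⟨a, ha⟩ => hb (ha ▸ a.2)]

@[to_additive]
theorem prod_update_update {β : ι → Type*} [Fintype ι] [DecidableEq ι] [CommMonoid M]
    (f : ∀ i, β i → M) {j j' : ι} (h : j ≠ j') (T : ∀ i, β i) (c : β j) (d : β j') :
    ∏ i, f i (Function.update (Function.update T j c) j' d i) =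
      f j c * f j' d * ∏ k ∈ (Finset.univ.erase j).erase j', f k (T k) := by
  have hj' : j' ∈ Finset.univ.erase j := Finset.mem_erase.2 ⟨h.symm, Finset.mem_univ _⟩
  rw [← Finset.mul_prod_erase _ _ (Finset.mem_univ j), ← Finset.mul_prod_erase _ _ hj',
    Function.update_of_ne h, Function.update_self, Function.update_self, ← mul_assoc]
  congr 1
  refine Finset.prod_congr rfl fun k hk => ?_
  obtain ⟨hkj', hkj⟩ : k ≠ j' ∧ k ≠ j := by
    simpa only [Finset.mem_erase, Finset.mem_univ, and_true] using hk
  rw [Function.update_of_ne hkj', Function.update_of_ne hkj]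

end Replacement

section PreservesColumns

variable {α β : Type*}

/-- A permutation of the entries of two columns, indexed by `α` and `β`, that does not move any
entry from one column to the other. -/
def PreservesColumns (w : Equiv.Perm (α ⊕ β)) : Prop :=
  Set.MapsTo w (Set.range Sum.inl) (Set.range Sum.inl)

theorem preservesColumns_one : PreservesColumns (1 : Equiv.Perm (α ⊕ β)) := Set.mapsTo_id _

theorem exists_apply_inl_eq_inr {w : Equiv.Perm (α ⊕ β)} (hw : ¬ PreservesColumns w) :
    ∃ a b, w (Sum.inl a) = Sum.inr b := by
  by_contra! hne
  refine hw ?_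
  rintro _ ⟨a, rfl⟩
  cases ha : w (Sum.inl a) with
  | inl a' => exact ⟨a', rfl⟩
  | inr b => exact absurd ha (hne a b)

theorem sum_apply_inl_lt [Fintype α] [Finite β] {s : α ⊕ β → ℕ} {θ : ℕ}
    (hl : ∀ a, θ ≤ s (Sum.inl a)) (hr : ∀ b, s (Sum.inr b) < θ) {w : Equiv.Perm (α ⊕ β)}
    (hw : ¬ PreservesColumns w) : ∑ a, s (w (Sum.inl a)) < ∑ a, s (Sum.inl a) := by
  -- The truncated excess `s - θ` vanishes on the right entries.
  have := Fintype.ofFinite β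
  have hle : ∀ k, s k ≤ (s k - θ) + θ := fun k => le_tsub_add
  have hlt : ∑ a, s (w (Sum.inl a)) < ∑ a, ((s (w (Sum.inl a)) - θ) + θ) := by
    obtain ⟨a, b, hab⟩ := exists_apply_inl_eq_inr hw
    refine Finset.sum_lt_sum (fun a _ => hle _) ⟨a, Finset.mem_univ a, ?_⟩
    rw [hab]
    exact (hr b).trans_le le_add_self
  calc ∑ a, s (w (Sum.inl a)) < ∑ a, ((s (w (Sum.inl a)) - θ) + θ) := hlt
    _ = ∑ a, (s (w (Sum.inl a)) - θ) + ∑ _a : α, θ := Finset.sum_add_distrib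
    _ ≤ ∑ k, (s (w k) - θ) + ∑ _a : α, θ := by
        rw [Fintype.sum_sum_type]
        exact Nat.add_le_add_right (Nat.le_add_right _ _) _
    _ = ∑ a, (s (Sum.inl a) - θ) + ∑ _a : α, θ := by
        rw [Equiv.sum_comp w fun k => s k - θ, Fintype.sum_sum_type,
          Finset.sum_eq_zero fun b _ => Nat.sub_eq_zero_of_le (hr b).le, add_zero]
    _ = ∑ a, s (Sum.inl a) := by
        rw [← Finset.sum_add_distrib]
        exact Finset.sum_congr rfl fun a _ => Nat.sub_add_cancel (hl a)

end PreservesColumns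

theorem sum_sign_smul_prod_eq_zero {κ ρ R : Type*} [Fintype κ] [DecidableEq κ] [Fintype ρ]
    [CommRing R] (hcard : Fintype.card ρ < Fintype.card κ) (row : κ → ρ) (x : ρ → κ → R) :
    ∑ w : Equiv.Perm κ, Equiv.Perm.sign w • ∏ k, x (row k) (w k) = 0 := by
  obtain ⟨k, l, hkl, hrow⟩ := Fintype.exists_ne_map_eq_of_card_lt row hcard
  have hdet : (Matrix.of fun i j => x (row j) i).det = 0 :=
    Matrix.det_zero_of_column_eq hkl fun i => congrArg (x · i) hrow
  rwa [Matrix.det_apply] at hdet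

section Exchange

variable {ι κ V : Type*} (c : ι → V) (d : κ → V) (P : ι → Prop) (Q : κ → Prop)

/-- The entries of two columns at the positions selected by `P` and `Q`. -/
def selected : {b // P b} ⊕ {b // Q b} → V := Sum.elim (fun b => c b) fun b => d b

/-- The first column, after permuting the selected entries. -/
def exchangeLeft (w : Equiv.Perm ({b // P b} ⊕ {b // Q b})) : ι → V :=
  Function.extend Subtype.val (fun b => selected c d P Q (w (Sum.inl b))) c

/-- The second column, after permuting the selected entries. -/
def exchangeRight (w : Equiv.Perm ({b // P b} ⊕ {b // Q b})) : κ → V :=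
  Function.extend Subtype.val (fun b => selected c d P Q (w (Sum.inr b))) d

theorem exchangeLeft_sumCongr [DecidablePred P] (w₁ : Equiv.Perm {b // P b})
    (w₂ : Equiv.Perm {b // Q b}) :
    exchangeLeft c d P Q (Equiv.Perm.sumCongr w₁ w₂) = c ∘ Equiv.Perm.ofSubtype w₁ :=
  extend_val_comp_perm w₁ c

theorem exchangeRight_sumCongr [DecidablePred Q] (w₁ : Equiv.Perm {b // P b})
    (w₂ : Equiv.Perm {b // Q b}) :
    exchangeRight c d P Q (Equiv.Perm.sumCongr w₁ w₂) = d ∘ Equiv.Perm.ofSubtype w₂ :=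
  extend_val_comp_perm w₂ d

theorem sum_exchange [Fintype ι] [Fintype κ] {M : Type*} [AddCommMonoid M]
    (w : Equiv.Perm ({b // P b} ⊕ {b // Q b})) (f : V → M) :
    ∑ b, f (exchangeLeft c d P Q w b) + ∑ b, f (exchangeRight c d P Q w b) =
      ∑ b, f (c b) + ∑ b, f (d b) := by
  classical
  have hperm := Equiv.sum_comp w fun k => f (selected c d P Q k)
  rw [Fintype.sum_sum_type, Fintype.sum_sum_type] at hperm
  rw [exchangeLeft, exchangeRight, sum_extend_val _ _ fun _ => f, sum_extend_val _ _ fun _ => f,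
    add_add_add_comm, hperm, ← Fintype.sum_subtype_add_sum_subtype P,
    ← Fintype.sum_subtype_add_sum_subtype Q, add_add_add_comm]
  rfl

theorem sum_exchangeLeft_lt [Fintype ι] [Finite κ] {s : V → ℕ} {θ : ℕ} (hc : ∀ b, P b → θ ≤ s (c b))
    (hd : ∀ b, Q b → s (d b) < θ) {w : Equiv.Perm ({b // P b} ⊕ {b // Q b})}
    (hw : ¬ PreservesColumns w) : ∑ b, s (exchangeLeft c d P Q w b) < ∑ b, s (c b) := by
  classical
  rw [exchangeLeft, sum_extend_val _ _ fun _ => s, ← Fintype.sum_subtype_add_sum_subtype P]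
  exact Nat.add_lt_add_right (sum_apply_inl_lt (s := s ∘ selected c d P Q)
    (fun b => hc b b.2) (fun b => hd b b.2) hw) _

variable [Fintype ι] [Fintype κ] [DecidableEq ι] [DecidableEq κ] [DecidablePred P]
  [DecidablePred Q]

theorem sum_sign_smul_prod_exchange_eq_zero {ρ R : Type*} [Fintype ρ] [CommRing R]
    (hcard : Fintype.card ρ < Fintype.card ({b // P b} ⊕ {b // Q b})) (rowLeft : ι → ρ)
    (rowRight : κ → ρ) (x : ρ → V → R) :
    ∑ w : Equiv.Perm ({b // P b} ⊕ {b // Q b}), Equiv.Perm.sign w •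
      ((∏ b, x (rowLeft b) (exchangeLeft c d P Q w b)) *
        ∏ b, x (rowRight b) (exchangeRight c d P Q w b)) = 0 := by
  have hterm : ∀ w : Equiv.Perm ({b // P b} ⊕ {b // Q b}),
      (∏ b, x (rowLeft b) (exchangeLeft c d P Q w b)) *
        ∏ b, x (rowRight b) (exchangeRight c d P Q w b) =
      (∏ k, x (selected rowLeft rowRight P Q k) (selected c d P Q (w k))) *
        ((∏ b : {b // ¬ P b}, x (rowLeft b) (c b)) *
          ∏ b : {b // ¬ Q b}, x (rowRight b) (d b)) := by
    intro w
    rw [exchangeLeft, exchangeRight, prod_extend_val _ _ fun b => x (rowLeft b),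
      prod_extend_val _ _ fun b => x (rowRight b), mul_mul_mul_comm, Fintype.prod_sum_type]
    rfl
  simp only [hterm, ← smul_mul_assoc]
  rw [← Finset.sum_mul, sum_sign_smul_prod_eq_zero hcard _ fun r k => x r (selected c d P Q k),
    zero_mul]

end Exchange

section Minor

variable {n p q : ℕ}

theorem minor_comp_perm (c : Fin p → Fin n) (w : Equiv.Perm (Fin p)) :
    minor (c ∘ w) = Equiv.Perm.sign w • minor c := by
  rw [minor, minor, Units.smul_def, zsmul_eq_mul, ← Matrix.det_permute']
  rfl

theorem minor_eq_zero {c : Fin p → Fin n} (h : ¬ Function.Injective c) : minor c = 0 := by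
  obtain ⟨a, b, hab, hne⟩ := Function.not_injective_iff.1 h
  exact Matrix.det_zero_of_column_eq hne fun k => by rw [Matrix.of_apply, Matrix.of_apply, hab]

theorem minor_mul_minor (c : Fin p → Fin n) (d : Fin q → Fin n) :
    minor c * minor d = ∑ α : Equiv.Perm (Fin p), ∑ β : Equiv.Perm (Fin q),
      (Equiv.Perm.sign α * Equiv.Perm.sign β) •
        ((∏ b, MvPolynomial.X ((α b : ℕ), c b)) * ∏ b, MvPolynomial.X ((β b : ℕ), d b)) := by
  simp only [minor, Matrix.det_apply, Matrix.of_apply, Finset.sum_mul_sum, smul_mul_smul_comm]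

variable (c : Fin p → Fin n) (d : Fin q → Fin n) (P : Fin p → Prop) (Q : Fin q → Prop)
  [DecidablePred P] [DecidablePred Q]

theorem sum_sign_smul_minor_exchange (hqp : q ≤ p)
    (hcard : p < Fintype.card ({b // P b} ⊕ {b // Q b})) :
    ∑ w : Equiv.Perm ({b // P b} ⊕ {b // Q b}), Equiv.Perm.sign w •
      (minor (exchangeLeft c d P Q w) * minor (exchangeRight c d P Q w)) = 0 := by
  have hzero : ∀ (α : Equiv.Perm (Fin p)) (β : Equiv.Perm (Fin q)),
      ∑ w : Equiv.Perm ({b // P b} ⊕ {b // Q b}), Equiv.Perm.sign w •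
        ((∏ b, (MvPolynomial.X ((α b : ℕ), exchangeLeft c d P Q w b) :
            MvPolynomial (ℕ × Fin n) ℂ)) *
          ∏ b, MvPolynomial.X ((β b : ℕ), exchangeRight c d P Q w b)) = 0 := fun α β =>
    sum_sign_smul_prod_exchange_eq_zero c d P Q ((Fintype.card_fin p).trans_lt hcard) α
      (fun b => Fin.castLE hqp (β b)) fun r v => MvPolynomial.X ((r : ℕ), v)
  simp only [minor_mul_minor, Finset.smul_sum]
  rw [Finset.sum_comm]
  refine Finset.sum_eq_zero fun α _ => ?_
  rw [Finset.sum_comm]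
  refine Finset.sum_eq_zero fun β _ => ?_
  simp only [smul_comm (Equiv.Perm.sign _) (Equiv.Perm.sign α * Equiv.Perm.sign β)]
  rw [← Finset.smul_sum, hzero, smul_zero]

theorem sign_smul_minor_exchange {w : Equiv.Perm ({b // P b} ⊕ {b // Q b})}
    (hw : PreservesColumns w) :
    Equiv.Perm.sign w • (minor (exchangeLeft c d P Q w) * minor (exchangeRight c d P Q w)) =
      minor c * minor d := by
  obtain ⟨⟨w₁, w₂⟩, rfl⟩ := Equiv.Perm.mem_sumCongrHom_range_of_perm_mapsTo_inl hw
  rw [Equiv.Perm.sumCongrHom_apply, exchangeLeft_sumCongr, exchangeRight_sumCongr, minor_comp_perm,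
    minor_comp_perm, Equiv.Perm.sign_ofSubtype, Equiv.Perm.sign_ofSubtype,
    Equiv.Perm.sign_sumCongr, smul_mul_smul_comm, smul_smul, Int.units_mul_self, one_smul]

end Minor

/-! ### Standard fillings span -/

section Straightening

variable {n : ℕ} {mu : YoungDiagram}

/-- Fillings of a diagram, column by column. -/
abbrev Filling (mu : YoungDiagram) (n : ℕ) : Type :=
  (j : Fin (mu.rowLen 0)) → Fin (mu.colLen j) → Fin n

/-- A filling whose columns increase strictly and whose rows increase weakly. -/
def IsStandard (T : Filling mu n) : Prop :=
  (∀ j, StrictMono (T j)) ∧ ∀ (j j' : Fin (mu.rowLen 0)) (h : j < j') (b : Fin (mu.colLen j')),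
    T j (Fin.castLE (mu.colLen_anti j j' h.le) b) ≤ T j' b

/-- The sum of the column sums, weighted by the column index. Straightening increases it. -/
def potential (T : Filling mu n) : ℕ := ∑ j : Fin (mu.rowLen 0), (j : ℕ) * ∑ b, (T j b : ℕ)

/-- The filling with the entries of each column in increasing order. -/
def sortColumns (T : Filling mu n) : Filling mu n := fun j => T j ∘ Tuple.sort (T j)

theorem potential_sortColumns (T : Filling mu n) : potential (sortColumns T) = potential T :=
  Finset.sum_congr rfl fun j _ =>
    congrArg ((j : ℕ) * ·) (Equiv.sum_comp (Tuple.sort (T j)) fun b => (T j b : ℕ))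

theorem minorProd_sortColumns (T : Filling mu n) : minorProd mu (sortColumns T) =
    (∏ j, Equiv.Perm.sign (Tuple.sort (T j))) • minorProd mu T := by
  simp only [minorProd, sortColumns, minor_comp_perm, Finset.prod_smul]

theorem strictMono_sortColumns {T : Filling mu n} (hT : minorProd mu T ≠ 0)
    (j : Fin (mu.rowLen 0)) : StrictMono (sortColumns T j) := by
  have hinj : Function.Injective (T j) := by
    by_contra h
    exact hT (Finset.prod_eq_zero (Finset.mem_univ j) (minor_eq_zero h))
  exact (Tuple.monotone_sort (T j)).strictMono_of_injective (hinj.comp (Equiv.injective _))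

/-- The filling obtained from `T` by permuting the selected entries of its columns `j` and `j'`. -/
def exchangeColumns (T : Filling mu n) (j j' : Fin (mu.rowLen 0)) (P : Fin (mu.colLen j) → Prop)
    (Q : Fin (mu.colLen j') → Prop) (w : Equiv.Perm ({b // P b} ⊕ {b // Q b})) : Filling mu n :=
  Function.update (Function.update T j (exchangeLeft (T j) (T j') P Q w)) j'
    (exchangeRight (T j) (T j') P Q w)

section ExchangeColumns

variable (T : Filling mu n) {j j' : Fin (mu.rowLen 0)} (P : Fin (mu.colLen j) → Prop)
  (Q : Fin (mu.colLen j') → Prop)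

theorem minorProd_exchangeColumns (h : j ≠ j') (w : Equiv.Perm ({b // P b} ⊕ {b // Q b})) :
    minorProd mu (exchangeColumns T j j' P Q w) =
      minor (exchangeLeft (T j) (T j') P Q w) * minor (exchangeRight (T j) (T j') P Q w) *
        ∏ k ∈ (Finset.univ.erase j).erase j', minor (T k) :=
  prod_update_update (fun _ => minor) h T _ _

theorem potential_lt_potential_exchangeColumns (h : j < j') {θ : ℕ} (hP : ∀ b, P b → θ ≤ T j b)
    (hQ : ∀ b, Q b → (T j' b : ℕ) < θ) {w : Equiv.Perm ({b // P b} ⊕ {b // Q b})}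
    (hw : ¬ PreservesColumns w) : potential T < potential (exchangeColumns T j j' P Q w) := by
  let weight (k : Fin (mu.rowLen 0)) (c : Fin (mu.colLen k) → Fin n) : ℕ := k * ∑ b, (c b : ℕ)
  have hT := sum_update_update weight h.ne T (T j) (T j')
  rw [Function.update_eq_self, Function.update_eq_self] at hT
  have hexchange : potential (exchangeColumns T j j' P Q w) = _ :=
    sum_update_update weight h.ne T _ _
  rw [potential, hT, hexchange]
  refine Nat.add_lt_add_right ?_ _
  have hleft := sum_exchangeLeft_lt (T j) (T j') P Q (s := Fin.val) hP hQ hw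
  have htotal := sum_exchange (T j) (T j') P Q w Fin.val
  have hjj' : (j : ℕ) < j' := h
  simp only [weight]
  nlinarith only [hleft, htotal, hjj']

variable [DecidablePred P] [DecidablePred Q]

theorem sum_sign_smul_minorProd_exchangeColumns (h : j < j')
    (hcard : mu.colLen j < Fintype.card ({b // P b} ⊕ {b // Q b})) :
    ∑ w : Equiv.Perm ({b // P b} ⊕ {b // Q b}),
      Equiv.Perm.sign w • minorProd mu (exchangeColumns T j j' P Q w) = 0 := by
  simp only [minorProd_exchangeColumns T P Q h.ne, ← smul_mul_assoc _ (minor _ * minor _)]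
  rw [← Finset.sum_mul,
    sum_sign_smul_minor_exchange _ _ _ _ (mu.colLen_anti j j' h.le) hcard, zero_mul]

theorem sign_smul_minorProd_exchangeColumns (h : j ≠ j')
    {w : Equiv.Perm ({b // P b} ⊕ {b // Q b})} (hw : PreservesColumns w) :
    Equiv.Perm.sign w • minorProd mu (exchangeColumns T j j' P Q w) = minorProd mu T := by
  have hT := prod_update_update
    (fun k : Fin (mu.rowLen 0) => minor (n := n) (k := mu.colLen k)) h T (T j) (T j')
  rw [Function.update_eq_self, Function.update_eq_self] at hT
  rw [minorProd_exchangeColumns T P Q h, ← smul_mul_assoc, sign_smul_minor_exchange _ _ _ _ hw]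
  exact hT.symm

theorem minorProd_mem_of_exchangeColumns_mem {S : Submodule ℂ (MvPolynomial (ℕ × Fin n) ℂ)}
    (h : j < j') (hcard : mu.colLen j < Fintype.card ({b // P b} ⊕ {b // Q b}))
    (hS : ∀ w : Equiv.Perm ({b // P b} ⊕ {b // Q b}), ¬ PreservesColumns w →
      minorProd mu (exchangeColumns T j j' P Q w) ∈ S) : minorProd mu T ∈ S := by
  classical
  have hrel := sum_sign_smul_minorProd_exchangeColumns T P Q h hcard
  rw [← Finset.sum_filter_add_sum_filter_not _ PreservesColumns,
    Finset.sum_congr rfl fun w hw =>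
      sign_smul_minorProd_exchangeColumns T P Q h.ne (Finset.mem_filter.1 hw).2,
    Finset.sum_const, ← Nat.cast_smul_eq_nsmul ℂ] at hrel
  have hcard_ne : ((Finset.univ.filter fun w : Equiv.Perm ({b // P b} ⊕ {b // Q b}) =>
      PreservesColumns w).card : ℂ) ≠ 0 :=
    Nat.cast_ne_zero.2 <| Finset.card_ne_zero_of_mem <|
      Finset.mem_filter.2 ⟨Finset.mem_univ 1, preservesColumns_one⟩
  rw [← S.smul_mem_iff hcard_ne, eq_neg_of_add_eq_zero_left hrel]
  exact S.neg_mem <| S.sum_mem fun w hw =>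
    (S.smul_mem_iff' _).2 (hS w (Finset.mem_filter.1 hw).2)

end ExchangeColumns

theorem lt_card_Ici_sum_Iic {p q : ℕ} (hqp : q ≤ p) (i : Fin q) :
    p < Fintype.card ({b // Fin.castLE hqp i ≤ b} ⊕ {b // b ≤ i}) := by
  rw [Fintype.card_sum, Fintype.card_subtype, Fintype.card_subtype, Finset.filter_le_eq_Ici,
    Finset.filter_ge_eq_Iic, Fin.card_Ici, Fin.card_Iic, Fin.val_castLE]
  omega

theorem minorProd_mem_of_not_isStandard {S : Submodule ℂ (MvPolynomial (ℕ × Fin n) ℂ)}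
    {T : Filling mu n} (hcol : ∀ j, StrictMono (T j)) (hT : ¬ IsStandard T)
    (hS : ∀ T' : Filling mu n, potential T < potential T' → minorProd mu T' ∈ S) :
    minorProd mu T ∈ S := by
  obtain ⟨j, j', h, i, hi⟩ : ∃ (j j' : Fin (mu.rowLen 0)) (h : j < j') (b : Fin (mu.colLen j')),
      T j' b < T j (Fin.castLE (mu.colLen_anti j j' h.le) b) := by
    by_contra! hrow
    exact hT ⟨hcol, hrow⟩
  have hanti : mu.colLen j' ≤ mu.colLen j := mu.colLen_anti j j' h.le
  -- Select the entries weakly below the violation on the left and weakly above it on the right.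
  exact minorProd_mem_of_exchangeColumns_mem T (Fin.castLE hanti i ≤ ·) (· ≤ i) h
    (lt_card_Ici_sum_Iic hanti i) fun w hw => hS _ <|
      potential_lt_potential_exchangeColumns T _ _ h (θ := T j (Fin.castLE hanti i))
        (fun _ hb => (hcol j).monotone hb) (fun _ hb => ((hcol j').monotone hb).trans_lt hi) hw

theorem minorProd_mem_span_isStandard (T : Filling mu n) : minorProd mu T ∈
    Submodule.span ℂ (minorProd (n := n) mu '' {T | IsStandard T}) := by
  set S := Submodule.span ℂ (minorProd (n := n) mu '' {T | IsStandard T})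
  by_contra hT
  obtain ⟨T₀, hT₀, hmax⟩ := Set.exists_max_image {T : Filling mu n | minorProd mu T ∉ S} potential
    (Set.toFinite _) ⟨T, hT⟩
  have hcol := strictMono_sortColumns fun h => hT₀ (h ▸ S.zero_mem)
  refine hT₀ ((S.smul_mem_iff' (∏ j, Equiv.Perm.sign (Tuple.sort (T₀ j)))).1 ?_)
  rw [← minorProd_sortColumns]
  by_cases hstd : IsStandard (sortColumns T₀)
  · exact Submodule.subset_span ⟨_, hstd, rfl⟩
  · refine minorProd_mem_of_not_isStandard hcol hstd fun T' hlt => ?_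
    rw [potential_sortColumns] at hlt
    by_contra hT'
    exact (hmax T' hT').not_gt hlt

end Straightening

/-! ### Leading monomials -/

section Leading

variable {σ R Γ : Type*} [CommSemiring R] [AddCommMonoid Γ] [LinearOrder Γ]

/-- `e` is the exponent of the unique term of largest weight of `f`, and its coefficient is `1`. -/
def IsLeading (w : (σ →₀ ℕ) →+ Γ) (f : MvPolynomial σ R) (e : σ →₀ ℕ) : Prop :=
  MvPolynomial.coeff e f = 1 ∧ ∀ u, MvPolynomial.coeff u f ≠ 0 → u = e ∨ w u < w e

variable {w : (σ →₀ ℕ) →+ Γ}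

theorem IsLeading.le {f : MvPolynomial σ R} {e u : σ →₀ ℕ} (hf : IsLeading w f e)
    (hu : MvPolynomial.coeff u f ≠ 0) : w u ≤ w e :=
  (hf.2 u hu).elim (fun h => (congrArg w h).le) le_of_lt

theorem isLeading_one : IsLeading w (1 : MvPolynomial σ R) 0 := by
  classical
  refine ⟨MvPolynomial.coeff_zero_one, fun u hu => Or.inl ?_⟩
  rw [MvPolynomial.coeff_one] at hu
  exact (of_not_not fun h => hu (if_neg h)).symm

theorem isLeading_sum_monomial {ι : Type*} {s : Finset ι} {e : ι → σ →₀ ℕ} {a : ι → R} {i₀ : ι}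
    (hi₀ : i₀ ∈ s) (ha : a i₀ = 1) (h : ∀ i ∈ s, i ≠ i₀ → w (e i) < w (e i₀)) :
    IsLeading w (∑ i ∈ s, MvPolynomial.monomial (e i) (a i)) (e i₀) := by
  classical
  constructor
  · rw [MvPolynomial.coeff_sum, Finset.sum_eq_single_of_mem i₀ hi₀, MvPolynomial.coeff_monomial,
      if_pos rfl, ha]
    intro i hi hne
    rw [MvPolynomial.coeff_monomial, if_neg fun he => (h i hi hne).ne (congrArg w he)]
  · intro u hu
    rw [MvPolynomial.coeff_sum] at hu
    obtain ⟨i, hi, hne⟩ := Finset.exists_ne_zero_of_sum_ne_zero hu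
    rw [MvPolynomial.coeff_monomial] at hne
    obtain rfl : e i = u := of_not_not fun h => hne (if_neg h)
    rcases eq_or_ne i i₀ with rfl | hi'
    · exact Or.inl rfl
    · exact Or.inr (h i hi hi')

section Mul

variable [IsOrderedCancelAddMonoid Γ]

theorem IsLeading.eq_or_lt_of_mul_ne_zero {f g : MvPolynomial σ R} {e e' u v : σ →₀ ℕ}
    (hf : IsLeading w f e) (hg : IsLeading w g e')
    (h : MvPolynomial.coeff u f * MvPolynomial.coeff v g ≠ 0) :
    (u = e ∧ v = e') ∨ w (u + v) < w (e + e') := by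
  have hu := left_ne_zero_of_mul h
  have hv := right_ne_zero_of_mul h
  rw [map_add, map_add]
  rcases hf.2 u hu with rfl | hlt
  · exact (hg.2 v hv).imp (fun h => ⟨rfl, h⟩) fun h => add_lt_add_right h _
  · exact Or.inr (add_lt_add_of_lt_of_le hlt (hg.le hv))

theorem IsLeading.mul {f g : MvPolynomial σ R} {e e' : σ →₀ ℕ} (hf : IsLeading w f e)
    (hg : IsLeading w g e') : IsLeading w (f * g) (e + e') := by
  classical
  constructor
  · rw [MvPolynomial.coeff_mul, Finset.sum_eq_single_of_mem (e, e')
      (Finset.HasAntidiagonal.mem_antidiagonal.2 rfl), hf.1, hg.1, one_mul]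
    rintro ⟨u, v⟩ huv hne
    by_contra hmul
    rcases hf.eq_or_lt_of_mul_ne_zero hg hmul with ⟨rfl, rfl⟩ | hlt
    · exact hne rfl
    · exact hlt.ne (congrArg w (Finset.HasAntidiagonal.mem_antidiagonal.1 huv))
  · intro u hu
    rw [MvPolynomial.coeff_mul] at hu
    obtain ⟨⟨u₁, u₂⟩, hsum, hmul⟩ := Finset.exists_ne_zero_of_sum_ne_zero hu
    obtain rfl := Finset.HasAntidiagonal.mem_antidiagonal.1 hsum
    exact (hf.eq_or_lt_of_mul_ne_zero hg hmul).imp_left fun h => congrArg₂ (· + ·) h.1 h.2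

theorem IsLeading.prod {ι : Type*} {s : Finset ι} {f : ι → MvPolynomial σ R} {e : ι → σ →₀ ℕ}
    (h : ∀ i ∈ s, IsLeading w (f i) (e i)) : IsLeading w (∏ i ∈ s, f i) (∑ i ∈ s, e i) := by
  induction s using Finset.cons_induction with
  | empty => exact isLeading_one
  | cons i s hi ih =>
    rw [Finset.prod_cons, Finset.sum_cons]
    exact (h i (Finset.mem_cons_self i s)).mul (ih fun j hj => h j (Finset.mem_cons_of_mem hj))

end Mul

end Leading

theorem linearIndependent_of_isLeading {σ R Γ ι : Type*} [CommRing R] [AddCommMonoid Γ]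
    [LinearOrder Γ] {w : (σ →₀ ℕ) →+ Γ} {f : ι → MvPolynomial σ R} {e : ι → σ →₀ ℕ}
    (h : ∀ i, IsLeading w (f i) (e i)) (he : Function.Injective e) : LinearIndependent R f := by
  rw [linearIndependent_iff]
  intro l hl
  by_contra hne
  obtain ⟨i, hi, hmax⟩ := Finset.exists_max_image l.support (fun i => w (e i))
    (Finsupp.support_nonempty_iff.2 hne)
  have hcoeff := congrArg (MvPolynomial.coeff (e i)) hl
  rw [Finsupp.linearCombination_apply, Finsupp.sum, MvPolynomial.coeff_sum,
    MvPolynomial.coeff_zero, Finset.sum_eq_single_of_mem i hi, MvPolynomial.coeff_smul, (h i).1,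
    smul_eq_mul, mul_one] at hcoeff
  · exact Finsupp.mem_support_iff.1 hi hcoeff
  · intro k hk hki
    rw [MvPolynomial.coeff_smul]
    by_contra hterm
    rcases (h k).2 (e i) (right_ne_zero_of_smul hterm) with heq | hlt
    · exact hki (he heq.symm)
    · exact (hmax k hk).not_gt hlt

section LeadingMinor

variable {n p : ℕ}

/-- The weight of a monomial, with `x_{a,c}` of weight `a * c`. It is chosen so that the diagonal
term of a minor with increasing columns is the heaviest, by the rearrangement inequality. -/
def monWeight : (ℕ × Fin n →₀ ℕ) →+ ℕ := Finsupp.weight fun q => q.1 * (q.2 : ℕ)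

theorem monWeight_sum_single {ι : Type*} (s : Finset ι) (r : ι → ℕ) (c : ι → Fin n) :
    monWeight (∑ b ∈ s, Finsupp.single (r b, c b) 1) = ∑ b ∈ s, r b * (c b : ℕ) := by
  simp only [monWeight, map_sum, Finsupp.weight_single, one_smul]

theorem minor_eq_sum_monomial (c : Fin p → Fin n) : minor c =
    ∑ α : Equiv.Perm (Fin p), MvPolynomial.monomial
      (∑ b, Finsupp.single ((α b : ℕ), c b) 1) (((Equiv.Perm.sign α : ℤ) : ℂ)) := by
  rw [minor, Matrix.det_apply']
  refine Finset.sum_congr rfl fun α _ => ?_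
  rw [← mul_one (((Equiv.Perm.sign α : ℤ) : ℂ)), ← MvPolynomial.C_mul_monomial,
    MvPolynomial.monomial_sum_one, map_intCast]
  rfl

theorem sum_perm_mul_lt {c : Fin p → Fin n} (hc : StrictMono c) {α : Equiv.Perm (Fin p)}
    (hα : α ≠ 1) : ∑ b, (α b : ℕ) * (c b : ℕ) < ∑ b : Fin p, (b : ℕ) * (c b : ℕ) := by
  have hmono : Monovary (fun b : Fin p => (b : ℕ)) fun b => (c b : ℕ) := fun _ _ hab =>
    (hc.lt_iff_lt.1 (Fin.lt_def.2 hab)).le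
  rw [hmono.sum_comp_perm_mul_lt_sum_mul_iff]
  refine fun hvary => hα ((Equiv.Perm.monotone_iff α).1 fun a b hab => ?_)
  rcases hab.eq_or_lt with rfl | hab
  · exact le_rfl
  · exact hvary (Fin.lt_def.1 (hc hab))

theorem isLeading_minor {c : Fin p → Fin n} (hc : StrictMono c) :
    IsLeading monWeight (minor c) (∑ b : Fin p, Finsupp.single ((b : ℕ), c b) 1) := by
  rw [minor_eq_sum_monomial]
  refine isLeading_sum_monomial (Finset.mem_univ (1 : Equiv.Perm (Fin p))) ?_ fun α _ hα => ?_
  · rw [Equiv.Perm.sign_one, Units.val_one, Int.cast_one]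
  · rw [monWeight_sum_single, monWeight_sum_single]
    exact sum_perm_mul_lt hc hα

end LeadingMinor

/-! ### The basis of semistandard tableaux -/

section Tableaux

variable {mu : YoungDiagram} {n : ℕ}

/-- Semistandard tableaux with entries in `{0, …, n-1}`. -/
abbrev BoundedTableau (mu : YoungDiagram) (n : ℕ) : Type :=
  {T : SemistandardYoungTableau mu // ∀ i j, (i, j) ∈ mu → T i j < n}

/-- The columns of a semistandard tableau. -/
def toFilling (T : BoundedTableau mu n) : Filling mu n := fun j b =>
  ⟨T.1 b j, T.2 b j (YoungDiagram.mem_iff_lt_colLen.2 b.2)⟩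

theorem lt_rowLen_zero {i j : ℕ} (h : (i, j) ∈ mu) : j < mu.rowLen 0 :=
  YoungDiagram.mem_iff_lt_rowLen.1 (mu.up_left_mem (Nat.zero_le i) le_rfl h)

theorem isStandard_toFilling (T : BoundedTableau mu n) : IsStandard (toFilling T) := by
  refine ⟨fun j b b' h => ?_, fun j j' h b => ?_⟩
  · exact T.1.col_strict (Fin.lt_def.1 h) (YoungDiagram.mem_iff_lt_colLen.2 b'.2)
  · exact T.1.row_weak (Fin.lt_def.1 h) (YoungDiagram.mem_iff_lt_colLen.2 b.2)

theorem exists_toFilling_eq {T : Filling mu n} (hT : IsStandard T) :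
    ∃ T' : BoundedTableau mu n, toFilling T' = T := by
  classical
  let entry : ℕ → ℕ → ℕ := fun i j =>
    if h : (i, j) ∈ mu then T ⟨j, lt_rowLen_zero h⟩ ⟨i, YoungDiagram.mem_iff_lt_colLen.1 h⟩ else 0
  have hentry : ∀ {i j : ℕ} (h : (i, j) ∈ mu), entry i j =
      T ⟨j, lt_rowLen_zero h⟩ ⟨i, YoungDiagram.mem_iff_lt_colLen.1 h⟩ := fun h => dif_pos h
  refine ⟨⟨⟨entry, ?row_weak, ?col_strict, fun h => dif_neg h⟩, ?bounded⟩, ?columns⟩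
  case row_weak =>
    intro i j₁ j₂ hlt hcell
    rw [hentry hcell, hentry (mu.up_left_mem le_rfl hlt.le hcell)]
    exact hT.2 ⟨j₁, _⟩ ⟨j₂, _⟩ hlt ⟨i, _⟩
  case col_strict =>
    intro i₁ i₂ j hlt hcell
    rw [hentry hcell, hentry (mu.up_left_mem hlt.le le_rfl hcell)]
    exact hT.1 ⟨j, _⟩ hlt
  case bounded =>
    intro i j h
    exact (hentry h).trans_lt (Fin.is_lt _)
  case columns =>
    funext j b
    exact Fin.ext (hentry (YoungDiagram.mem_iff_lt_colLen.2 b.2))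

theorem span_minorProd_toFilling :
    Submodule.span ℂ (Set.range fun T : BoundedTableau mu n => minorProd mu (toFilling T)) =
      weylModule n mu := by
  refine le_antisymm (Submodule.span_mono ?_) (Submodule.span_le.2 ?_)
  · rintro _ ⟨T, rfl⟩
    exact ⟨toFilling T, rfl⟩
  · rintro _ ⟨T, rfl⟩
    refine Submodule.span_mono ?_ (minorProd_mem_span_isStandard T)
    rintro _ ⟨T, hT, rfl⟩
    obtain ⟨T', rfl⟩ := exists_toFilling_eq hT
    exact ⟨T', rfl⟩

/-- The exponent of the product of the diagonal terms of the minors given by the columns of a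
filling. -/
def leadingMon (T : Filling mu n) : ℕ × Fin n →₀ ℕ :=
  ∑ j : Fin (mu.rowLen 0), ∑ b : Fin (mu.colLen j), Finsupp.single ((b : ℕ), T j b) 1

theorem isLeading_minorProd (T : BoundedTableau mu n) :
    IsLeading monWeight (minorProd mu (toFilling T)) (leadingMon (toFilling T)) :=
  IsLeading.prod fun j _ => isLeading_minor ((isStandard_toFilling T).1 j)

theorem sum_columns {M : Type*} [AddCommMonoid M] (f : ℕ × ℕ → M) :
    ∑ j : Fin (mu.rowLen 0), ∑ b : Fin (mu.colLen j), f ((b : ℕ), (j : ℕ)) =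
      ∑ c ∈ mu.cells, f c := by
  rw [Finset.sum_sigma']
  refine Finset.sum_bij (fun q _ => ((q.2 : ℕ), (q.1 : ℕ))) (fun q _ => ?_) ?_ ?_ fun _ _ => rfl
  · exact (YoungDiagram.mem_cells _).2 (YoungDiagram.mem_iff_lt_colLen.2 q.2.2)
  · rintro ⟨j, b⟩ - ⟨j', b'⟩ - h
    obtain ⟨hb, hj⟩ := Prod.mk.inj h
    obtain rfl : j = j' := Fin.ext hj
    obtain rfl : b = b' := Fin.ext hb
    rfl
  · rintro ⟨i, j⟩ hc
    have hmem : (i, j) ∈ mu := (YoungDiagram.mem_cells _).1 hc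
    exact ⟨⟨⟨j, lt_rowLen_zero hmem⟩, ⟨i, YoungDiagram.mem_iff_lt_colLen.1 hmem⟩⟩,
      Finset.mem_sigma.2 ⟨Finset.mem_univ _, Finset.mem_univ _⟩, rfl⟩

theorem num_eq_weight_leadingMon (T : BoundedTableau mu n) (r v : ℕ) :
    BenderKnuth.num T.1 r v = Finsupp.weight
      (fun q : ℕ × Fin n => if q.1 = r ∧ (q.2 : ℕ) < v then 1 else 0)
      (leadingMon (toFilling T)) := by
  classical
  simp only [leadingMon, map_sum, Finsupp.weight_single, one_smul]
  refine Eq.trans ?_ (sum_columns fun c => if c.1 = r ∧ T.1 c.1 c.2 < v then 1 else 0).symm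
  rw [← Finset.card_filter, BenderKnuth.num]
  refine Finset.card_bij (fun j _ => (r, j)) (fun j hj => ?_)
    (fun _ _ _ _ h => (Prod.mk.inj h).2) ?_
  · rw [Finset.mem_filter, Finset.mem_range] at hj
    exact Finset.mem_filter.2
      ⟨(YoungDiagram.mem_cells _).2 (YoungDiagram.mem_iff_lt_rowLen.2 hj.1), rfl, hj.2⟩
  · rintro ⟨i, j⟩ hc
    obtain ⟨hcell, rfl, hlt⟩ := Finset.mem_filter.1 hc
    exact ⟨j, Finset.mem_filter.2 ⟨Finset.mem_range.2
      (YoungDiagram.mem_iff_lt_rowLen.1 ((YoungDiagram.mem_cells _).1 hcell)), hlt⟩, rfl⟩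

theorem leadingMon_toFilling_injective :
    Function.Injective fun T : BoundedTableau mu n => leadingMon (toFilling T) := by
  intro T T' h
  refine Subtype.ext (SemistandardYoungTableau.ext fun i j => ?_)
  by_cases hcell : (i, j) ∈ mu
  · have hj := YoungDiagram.mem_iff_lt_rowLen.1 hcell
    refine eq_of_forall_gt_iff fun v => ?_
    rw [BenderKnuth.lt_num_iff T.1 hj, BenderKnuth.lt_num_iff T'.1 hj,
      num_eq_weight_leadingMon, num_eq_weight_leadingMon]
    exact iff_of_eq (congrArg (fun e => j < Finsupp.weight _ e) h)
  · rw [T.1.zeros hcell, T'.1.zeros hcell]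

instance finite_boundedTableau : Finite (BoundedTableau mu n) :=
  Finite.of_injective (β := Filling mu n) toFilling
    (Function.Injective.of_comp (f := leadingMon) leadingMon_toFilling_injective)

instance fintypeBoundedTableau : Fintype (BoundedTableau mu n) := Fintype.ofFinite _

/-- The semistandard basis of `V^λ`. -/
def tableauBasis (mu : YoungDiagram) (n : ℕ) :
    Module.Basis (BoundedTableau mu n) ℂ (weylModule n mu) :=
  (Module.Basis.span (linearIndependent_of_isLeading isLeading_minorProd
    leadingMon_toFilling_injective)).map (LinearEquiv.ofEq _ _ span_minorProd_toFilling)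

theorem coe_tableauBasis (T : BoundedTableau mu n) :
    (tableauBasis mu n T : MvPolynomial (ℕ × Fin n) ℂ) = minorProd mu (toFilling T) := by
  rw [tableauBasis, Module.Basis.map_apply, LinearEquiv.coe_ofEq_apply]
  exact Module.Basis.coe_span_apply _ _

end Tableaux

/-! ### The character of `V^λ` -/

section Character

variable {mu : YoungDiagram} {n : ℕ} {D : Matrix.GeneralLinearGroup (Fin n) ℂ} {x : Fin n → ℂ}

theorem polyRep_diagonal_minor (hD : D.val = Matrix.diagonal x) {p : ℕ} (c : Fin p → Fin n) :
    polyRep n D (minor c) = (∏ b, x (c b)) • minor c := by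
  rw [polyRep_minor, Fintype.sum_eq_single c]
  · simp only [hD, Matrix.diagonal_apply_eq]
  · intro d hd
    obtain ⟨b, hb⟩ := Function.ne_iff.1 hd
    rw [Finset.prod_eq_zero (Finset.mem_univ b), zero_smul]
    rw [hD, Matrix.diagonal_apply_ne _ hb]

theorem polyRep_diagonal_minorProd (hD : D.val = Matrix.diagonal x) (T : Filling mu n) :
    polyRep n D (minorProd mu T) =
      (∏ j : Fin (mu.rowLen 0), ∏ b, x (T j b)) • minorProd mu T := by
  have hprod : polyRep n D (minorProd mu T) = ∏ j, polyRep n D (minor (T j)) :=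
    map_prod (MvPolynomial.aeval fun q : ℕ × Fin n =>
      ∑ d, (D.val d q.2) • (MvPolynomial.X (q.1, d) : MvPolynomial (ℕ × Fin n) ℂ)) _ _
  rw [hprod]
  simp only [polyRep_diagonal_minor hD, Finset.prod_smul, minorProd]

theorem trace_eq_sum_of_eigenbasis {ι R V : Type*} [Fintype ι] [CommRing R] [AddCommGroup V]
    [Module R V] (b : Module.Basis ι R V) (f : V →ₗ[R] V) (c : ι → R)
    (h : ∀ i, f (b i) = c i • b i) : LinearMap.trace R V f = ∑ i, c i := by
  classical
  rw [LinearMap.trace_eq_matrix_trace R b, Matrix.trace]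
  refine Finset.sum_congr rfl fun i _ => ?_
  rw [Matrix.diag_apply, LinearMap.toMatrix_apply, h, map_smul, Module.Basis.repr_self,
    Finsupp.smul_apply, Finsupp.single_eq_same, smul_eq_mul, mul_one]

theorem character_weylRep_diagonal (hD : D.val = Matrix.diagonal x) (lam : Par) :
    (weylRep n lam).character D = ∑ T : BoundedTableau lam.diagram n,
      ∏ j : Fin (lam.diagram.rowLen 0), ∏ b, x (toFilling T j b) := by
  refine trace_eq_sum_of_eigenbasis (tableauBasis lam.diagram n) _ _ fun T => Subtype.ext ?_
  change polyRep n D (tableauBasis lam.diagram n T : MvPolynomial (ℕ × Fin n) ℂ) =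
    _ • (tableauBasis lam.diagram n T : MvPolynomial (ℕ × Fin n) ℂ)
  rw [coe_tableauBasis, polyRep_diagonal_minorProd hD]

/-- The number of occurrences of each entry of a filling. -/
def fillingContent (T : Filling mu n) : Fin n →₀ ℕ :=
  ∑ j : Fin (mu.rowLen 0), ∑ b, Finsupp.single (T j b) 1

theorem embDomain_fillingContent (T : BoundedTableau mu n) :
    (fillingContent (toFilling T)).embDomain Fin.valEmbedding = content T.1 := by
  rw [content, ← sum_columns (mu := mu) fun c => Finsupp.single (T.1 c.1 c.2) 1, fillingContent,
    Finsupp.embDomain_eq_mapDomain, Finsupp.mapDomain_finsetSum]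
  refine Finset.sum_congr rfl fun j _ => ?_
  rw [Finsupp.mapDomain_finsetSum]
  exact Finset.sum_congr rfl fun b _ => Finsupp.mapDomain_single

theorem prod_pow_fillingContent {M : Type*} [CommMonoid M] (T : Filling mu n) (y : Fin n → M) :
    ∏ i, y i ^ fillingContent T i = ∏ j : Fin (mu.rowLen 0), ∏ b, y (T j b) := by
  rw [← Finsupp.prod_fintype (fillingContent T) (fun i k => y i ^ k) fun i => pow_zero (y i),
    fillingContent, ← Finsupp.prod_finsetSum_index (fun i => pow_zero (y i)) fun i => pow_add (y i)]
  refine Finset.prod_congr rfl fun j _ => ?_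
  rw [← Finsupp.prod_finsetSum_index (fun i => pow_zero (y i)) fun i => pow_add (y i)]
  refine Finset.prod_congr rfl fun b _ => ?_
  exact (Finsupp.prod_single_index (h := fun i k => y i ^ k) (pow_zero _)).trans (pow_one _)

theorem content_apply_ne_zero (T : SemistandardYoungTableau mu) {i j : ℕ} (h : (i, j) ∈ mu) :
    content T (T i j) ≠ 0 := by
  intro h0
  rw [content, Finsupp.finsetSum_apply, Finset.sum_eq_zero_iff] at h0
  exact one_ne_zero (Finsupp.single_eq_same.symm.trans (h0 (i, j) ((YoungDiagram.mem_cells _).2 h)))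

theorem lt_of_content_eq_embDomain {T : SemistandardYoungTableau mu} {a : Fin n →₀ ℕ}
    (h : content T = a.embDomain Fin.valEmbedding) {i j : ℕ} (hcell : (i, j) ∈ mu) :
    T i j < n := by
  by_contra hlt
  refine content_apply_ne_zero T hcell ?_
  rw [h]
  refine Finsupp.embDomain_of_notMem_range _ _ _ ?_
  rintro ⟨k, hk⟩
  exact hlt (hk ▸ k.2)

theorem coeff_schur_embDomain (lam : Par) (a : Fin n →₀ ℕ) :
    MvPowerSeries.coeff (a.embDomain Fin.valEmbedding) (schur lam : MvPowerSeries ℕ ℂ) =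
      (Nat.card {T : BoundedTableau lam.diagram n // fillingContent (toFilling T) = a} : ℂ) := by
  have hiff : ∀ T : BoundedTableau lam.diagram n, fillingContent (toFilling T) = a ↔
      content T.1 = a.embDomain Fin.valEmbedding := fun T => by
    rw [← embDomain_fillingContent, (Finsupp.embDomain_injective _).eq_iff]
  refine congrArg Nat.cast (Nat.card_congr
    { toFun := fun T => ⟨⟨T.1, fun i j h => lt_of_content_eq_embDomain T.2 h⟩, (hiff _).2 T.2⟩
      invFun := fun T => ⟨T.1.1, (hiff _).1 T.2⟩
      left_inv := fun _ => rfl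
      right_inv := fun _ => rfl })

theorem finsum_natCard_fiber_mul {ι β R : Type*} [Fintype ι] [Semiring R] (κ : ι → β)
    (g : β → R) : ∑ᶠ b, (Nat.card {i // κ i = b} : R) * g b = ∑ i, g (κ i) := by
  classical
  have hcard : ∀ b, Nat.card {i // κ i = b} =
      (Finset.univ.filter fun i => κ i = b).card := fun b => by
    rw [Nat.card_eq_fintype_card, Fintype.card_subtype]
  simp only [hcard]
  rw [finsum_eq_sum_of_support_subset (s := Finset.univ.image κ), Finset.sum_comp]
  · simp only [nsmul_eq_mul]
  · intro b hb
    have hne : (Finset.univ.filter fun i => κ i = b).card ≠ 0 := fun h =>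
      left_ne_zero_of_mul hb (by rw [h, Nat.cast_zero])
    obtain ⟨i, hi⟩ := Finset.card_ne_zero.1 hne
    exact Finset.mem_coe.2 (Finset.mem_image.2 ⟨i, Finset.mem_univ i, (Finset.mem_filter.1 hi).2⟩)

theorem evalFin_schur (lam : Par) (x : Fin n → ℂ) :
    evalFin (schur lam) x = ∑ T : BoundedTableau lam.diagram n,
      ∏ j : Fin (lam.diagram.rowLen 0), ∏ b, x (toFilling T j b) := by
  simp only [evalFin, coeff_schur_embDomain, ← prod_pow_fillingContent]
  exact finsum_natCard_fiber_mul _ fun a : Fin n →₀ ℕ => ∏ i, x i ^ a i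

theorem character_resWeylRep {m : ℕ} [NeZero m] (lam : Par) {γ : WreathGroup m n} {ρ : Phi m}
    (h : γ ∈ conjClass n ρ) :
    (resWeylRep m n lam).character γ = evalPower (eigenPowerSum ρ) (schur lam) := by
  obtain ⟨g, D, x, hD, hg⟩ := exists_conj_diagonal_toGL γ
  have hconj : (resWeylRep m n lam).character γ = (weylRep n lam).character D := by
    rw [← Representation.char_conj _ D g, ← hg]
    rfl
  rw [hconj, character_weylRep_diagonal hD, ← evalFin_schur, evalFin_eq_evalPower]
  refine LinearMap.congr_fun (evalPower_congr fun r _ => ?_) _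
  rw [← trace_pow_of_mem_conjClass h, map_pow]
  exact (trace_pow_conj_diagonal hD hg r).symm

theorem homogeneousComponent_F_eq_frobeniusChar {m : ℕ} [NeZero m] (lam : Par) (n : ℕ) :
    MvPowerSeries.homogeneousComponent n (F m lam) = frobeniusChar (resWeylRep m n lam) := by
  have hterm : ∀ ρ : Phi m, ρ.size = n → FTerm lam ρ =
      ((resWeylRep m n lam).character (classRep n ρ) / (ρ.Z : ℂ)) • P ρ := by
    rintro ρ rfl
    rw [FTerm, evalMultiset_Xi, character_resWeylRep lam (classRep_mem_conjClass ρ)]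
  have hfin := Fintype.ofFinite {ρ : Phi m // ρ.size = n}
  rw [homogeneousComponent_F, frobeniusChar, finsum_eq_sum_of_fintype,
    ← Finset.sum_subtype (phiOf m n) (fun ρ => mem_phiOf)
      fun ρ => ((resWeylRep m n lam).character (classRep n ρ) / (ρ.Z : ℂ)) • P ρ]
  exact Finset.sum_congr rfl fun ρ hρ => hterm ρ (mem_phiOf.1 hρ)

end Character

end WreathSym

end

theorem mainTheorem2 (m : ℕ) [NeZero m] (lam : WreathSym.Par) :
    -- `Ξ_ρ` is well defined: `C_ρ` is nonempty, and all of its elements have eigenvalues `Ξ_ρ`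
    (∀ ρ : WreathSym.Phi m, (WreathSym.conjClass ρ.size ρ).Nonempty ∧
      ∀ γ ∈ WreathSym.conjClass ρ.size ρ,
        (WreathSym.toMatrix γ).charpoly.roots = WreathSym.Xi ρ) ∧
    -- the series defining `F_λ` and `Ω((1/m) ∑_ζ X_ζ Ω(Y; ζ))` converge
    Summable (fun ρ : WreathSym.Phi m => WreathSym.FTerm lam ρ) ∧
    Summable (fun n : ℕ =>
      WreathSym.plethysm (WreathSym.kernelAlphabet m) (WreathSym.hSym n)) ∧
    -- the formula for `F_λ`; the kernel is symmetric in `Y`, so that the pairing makes sense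
    (∃ hK : WreathSym.IsSymmY (WreathSym.plethysticExp (WreathSym.kernelAlphabet m)),
      WreathSym.F m lam =
        WreathSym.pairingY (WreathSym.plethysticExp (WreathSym.kernelAlphabet m)) hK
          (WreathSym.schur lam)) ∧
    -- the component of degree `n` is the Frobenius characteristic of the restriction of `V^λ`
    (∀ n : ℕ, lam.length ≤ n →
      MvPowerSeries.homogeneousComponent n (WreathSym.F m lam) =
        WreathSym.frobeniusChar (WreathSym.resWeylRep m n lam)) :=
  ⟨fun ρ => ⟨WreathSym.conjClass_nonempty ρ, fun _ h => WreathSym.roots_charpoly_eq_Xi h⟩,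
    WreathSym.summable_FTerm lam, WreathSym.summable_kernel,
    ⟨WreathSym.isSymmY_kernel, WreathSym.F_eq_pairingY lam⟩,
    fun n _ => WreathSym.homogeneousComponent_F_eq_frobeniusChar lam n⟩
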